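/- Let $\Omega=\mathbb R\times S^1$ with coordinates $(t,\beta)$, $S^1=\mathbb R/2\pi\mathbb Z$, let $\Delta=\partial_t^2+\partial_\beta^2$, and let $\mathcal A$ be the smallest C*-subalgebra of $\mathcal L(L^2(\Omega))$ containing multiplication by $a(\beta)$ for $a\in C^\infty(S^1)$, multiplication by $b(t)$ for $b\in C([-\infty,+\infty])$, multiplication by $e^{ijt}$ for $j\in\mathbb Z$, and the operators $\Lambda=(1-\Delta)^{-1/2}$, $\frac1i\partial_t\Lambda$ and $\frac1i\partial_\beta\Lambda$. Let $\mathcal E$ be the closed two-sided ideal of $\mathcal A$ generated by the commutators, $\mathcal K$ the ideal of compact operators in $\mathcal A$, and $\mathcal K_{\mathbb Z\times S^1}$ the algebra of compact operators on $L^2(\mathbb Z\times S^1)=\ell^2(\mathbb Z,L^2(S^1))$. For $\varphi\in\mathbb R$ let $Y_\varphi=F_dU_\varphi F_d^{-1}$ on $L^2(\mathbb Z\times S^1)$, where $F_d^{-1}\big((u_j)_j\big)=\sum_j e^{ij\theta}u_j$ and $U_\varphi$ is multiplication by $e^{-i\varphi\theta}$, $-\pi<\theta\le\pi$. For $\tau\in\mathbb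 R$ put $\tilde\Lambda(\tau)=(1+\tau^2-\partial_\beta^2)^{-1/2}$ on $L^2(S^1)$, and $S_0(\tau)=\tilde\Lambda(\tau)$, $S_1(\tau)=\tau\tilde\Lambda(\tau)$, $S_2(\tau)=\frac1i\partial_\beta\tilde\Lambda(\tau)$. There is a *-homomorphism $\gamma:\mathcal A\to C(S^1\times\{-1,+1\},\mathcal L(L^2(\mathbb Z\times S^1)))$, $A\mapsto\gamma_A$, that takes the following values on the generators: multiplication by $a(\beta)$ is mapped to multiplication by $a(\beta)$ (constant in $(z,\pm1)$); multiplication by $b(t)$ to $\gamma(z,\pm1)=b(\pm\infty)I$; multiplication by $e^{ijt}$ to the constant $Y_{-j}$; and $\Lambda$, $\frac1i\partial_t\Lambda$, $\frac1i\partial_\beta\Lambda$ to $\gamma(e^{2\pi i\varphi},\pm1)=Y_\varphi\,\mathrm{diag}\big(S_m(j-\varphi)\big)_{j\in\mathbb Z}\,Y_{-\varphi}$ with $m=0,1,2$ respectively. It induces an algebra homomorphism $\Psi:\mathcal E/\mathcal K\to C(S^1\times\{-1,+1\},\mathcal K_{\mathbb Z\times S^1})$, $\Psi(A+\mathcal K)=\gamma_A$.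 Let $\delta_1:K_1(\mathcal A/\mathcal E)\to K_0(\mathcal E/\mathcal K)$ be the index map of $0\to\mathcal E/\mathcal K\to\mathcal A/\mathcal K\to\mathcal A/\mathcal E\to0$, and regard its values as elements of $K_0(\mathcal K_{\mathbb Z\times S^1})\oplus K_0(\mathcal K_{\mathbb Z\times S^1})$ by means of $\Psi_*$ followed by the evaluations at the points $(1,-1)$ and $(1,+1)$. Let $A\in\mathcal A$ be such that its class $[A]$ is invertible in $\mathcal A/\mathcal E$. Then $\gamma_A(z,-1)$ and $\gamma_A(z,+1)$ are Fredholm operators on $L^2(\mathbb Z\times S^1)$ for every $z\in S^1$, and $$\delta_1([[A]]_1)=\big(\operatorname{ind}\gamma_A(1,-1)\,[E]_0,\ \operatorname{ind}\gamma_A(1,+1)\,[E]_0\big)\in K_0(\mathcal K_{\mathbb Z\times S^1})\oplus K_0(\mathcal K_{\mathbb Z\times S^1})$$ for every orthogonal projection $E\in\mathcal K_{\mathbb Z\times S^1}$ of rank $1$, where $\operatorname{ind}T=\dim\ker T-\dim\operatorname{coker}T$. -/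

import Mathlib

namespace OpKTheory

universe u v

section KZeroUnital

variable (B : Type u) [Ring B]

/-- Idempotent square matrices of arbitrary finite size over `B`. -/
abbrev IdemMat : Type u := Σ n : ℕ, {e : Matrix (Fin n) (Fin n) B // e * e = e}

variable {B}

/-- Algebraic Murray-von Neumann equivalence of square matrices (of possibly different sizes). -/
def MvN {ι κ : Type*} [Fintype ι] [Fintype κ] (e : Matrix ι ι B) (f : Matrix κ κ B) : Prop :=
  ∃ (x : Matrix ι κ B) (y : Matrix κ ι B), x * y = e ∧ y * x = f

theorem MvN.refl {ι : Type*} [Fintype ι] {e : Matrix ι ι B} (he : e * e = e) : MvN e e :=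
  ⟨e, e, he, he⟩

theorem MvN.symm {ι κ : Type*} [Fintype ι] [Fintype κ] {e : Matrix ι ι B} {f : Matrix κ κ B} :
    MvN e f → MvN f e := fun ⟨x, y, h, h'⟩ => ⟨y, x, h', h⟩

theorem MvN.trans {ι κ l : Type*} [Fintype ι] [Fintype κ] [Fintype l]
    {e : Matrix ι ι B} {f : Matrix κ κ B} {g : Matrix l l B}
    (he : e * e = e) (hg : g * g = g) : MvN e f → MvN f g → MvN e g := by
  rintro ⟨x, y, rfl, rfl⟩ ⟨z, w, h, rfl⟩
  refine ⟨x * z, w * y, ?_, ?_⟩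
  · calc x * z * (w * y) = x * (z * w) * y := by simp only [Matrix.mul_assoc]
      _ = x * y * (x * y) := by rw [h]; simp only [Matrix.mul_assoc]
      _ = x * y := he
  · calc w * y * (x * z) = w * (y * x) * z := by simp only [Matrix.mul_assoc]
      _ = w * z * (w * z) := by rw [← h]; simp only [Matrix.mul_assoc]
      _ = w * z := hg

theorem MvN.reindex {ι κ : Type*} [Fintype ι] [Fintype κ] {e : Matrix ι ι B} (he : e * e = e)
    (σ : ι ≃ κ) : MvN e (Matrix.reindex σ σ e) := by
  refine ⟨e.submatrix id σ.symm, e.submatrix σ.symm id, ?_, ?_⟩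
  · rw [Matrix.submatrix_mul_equiv, he, Matrix.submatrix_id_id]
  · have := Matrix.submatrix_mul_equiv e e σ.symm (Equiv.refl ι) σ.symm
    rw [he] at this
    simpa using this

theorem MvN.fromBlocks {ι κ ι' κ' : Type*} [Fintype ι] [Fintype κ] [Fintype ι'] [Fintype κ']
    {e : Matrix ι ι B} {f : Matrix κ κ B} {e' : Matrix ι' ι' B} {f' : Matrix κ' κ' B} :
    MvN e e' → MvN f f' →
      MvN (Matrix.fromBlocks e 0 0 f) (Matrix.fromBlocks e' 0 0 f') := by
  rintro ⟨x, y, rfl, rfl⟩ ⟨z, w, rfl, rfl⟩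
  exact ⟨Matrix.fromBlocks x 0 0 z, Matrix.fromBlocks y 0 0 w, by
    simp [Matrix.fromBlocks_multiply], by simp [Matrix.fromBlocks_multiply]⟩

theorem idem_reindex {ι κ : Type*} [Fintype ι] [Fintype κ] {e : Matrix ι ι B} (he : e * e = e)
    (σ : ι ≃ κ) : Matrix.reindex σ σ e * Matrix.reindex σ σ e = Matrix.reindex σ σ e := by
  simp only [Matrix.reindex_apply]
  rw [Matrix.submatrix_mul_equiv, he]

theorem idem_fromBlocks {ι κ : Type*} [Fintype ι] [Fintype κ] {e : Matrix ι ι B}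
    {f : Matrix κ κ B} (he : e * e = e) (hf : f * f = f) :
    Matrix.fromBlocks e 0 0 f * Matrix.fromBlocks e 0 0 f = Matrix.fromBlocks e 0 0 f := by
  simp [Matrix.fromBlocks_multiply, he, hf]

variable (B)

instance idemSetoid : Setoid (IdemMat B) where
  r e f := MvN e.2.1 f.2.1
  iseqv := ⟨fun e => MvN.refl e.2.2, fun h => h.symm, fun {e _ g} h h' => h.trans e.2.2 g.2.2 h'⟩

/-- The monoid `V(B)` of classes of idempotent matrices under direct sum. -/
def VMon : Type u := Quotient (idemSetoid B)

variable {B}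

/-- The class in `V(B)` of an idempotent matrix over an arbitrary finite index type. -/
noncomputable def vcls {ι : Type*} [Fintype ι] (e : Matrix ι ι B) (he : e * e = e) : VMon B :=
  ⟦⟨Fintype.card ι, Matrix.reindex (Fintype.equivFin ι) (Fintype.equivFin ι) e,
    idem_reindex he _⟩⟧

theorem vcls_eq {ι κ : Type*} [Fintype ι] [Fintype κ] {e : Matrix ι ι B} {f : Matrix κ κ B}
    (he : e * e = e) (hf : f * f = f) (h : MvN e f) : vcls e he = vcls f hf := by
  refine Quotient.sound ?_
  change MvN _ _
  exact (MvN.reindex he _).symm.trans (idem_reindex he _) (idem_reindex hf _)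
    (h.trans he (idem_reindex hf _) (MvN.reindex hf _))

theorem mk_eq_vcls (e : IdemMat B) : (⟦e⟧ : VMon B) = vcls e.2.1 e.2.2 :=
  Quotient.sound (MvN.reindex e.2.2 _)

/-- Direct sum of classes: `[e] + [f] = [diag(e, f)]`. -/
noncomputable instance : Add (VMon B) where
  add := Quotient.map₂ (fun e f => ⟨Fintype.card (Fin e.1 ⊕ Fin f.1),
      Matrix.reindex (Fintype.equivFin _) (Fintype.equivFin _)
        (Matrix.fromBlocks e.2.1 0 0 f.2.1),
      idem_reindex (idem_fromBlocks e.2.2 f.2.2) _⟩) (by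
    intro e e' h f f' h'
    change MvN _ _
    refine (MvN.reindex (idem_fromBlocks e.2.2 f.2.2) _).symm.trans (idem_reindex
      (idem_fromBlocks e.2.2 f.2.2) _) (idem_reindex (idem_fromBlocks e'.2.2 f'.2.2) _) ?_
    exact (MvN.fromBlocks h h').trans (idem_fromBlocks e.2.2 f.2.2)
      (idem_reindex (idem_fromBlocks e'.2.2 f'.2.2) _)
      (MvN.reindex (idem_fromBlocks e'.2.2 f'.2.2) _))

theorem vcls_add {ι κ : Type*} [Fintype ι] [Fintype κ] {e : Matrix ι ι B} {f : Matrix κ κ B}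
    (he : e * e = e) (hf : f * f = f) :
    vcls e he + vcls f hf = vcls (Matrix.fromBlocks e 0 0 f) (idem_fromBlocks he hf) := by
  have h := vcls_eq (idem_fromBlocks (idem_reindex he (Fintype.equivFin ι))
    (idem_reindex hf (Fintype.equivFin κ))) (idem_fromBlocks he hf)
    (MvN.fromBlocks (MvN.reindex he _).symm (MvN.reindex hf _).symm)
  exact h

theorem idem_zero {ι : Type*} [Fintype ι] :
    (0 : Matrix ι ι B) * (0 : Matrix ι ι B) = 0 := Matrix.zero_mul _

noncomputable instance : Zero (VMon B) := ⟨vcls (0 : Matrix (Fin 0) (Fin 0) B) idem_zero⟩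

noncomputable instance : AddCommMonoid (VMon B) where
  add_assoc a b c := by
    induction a using Quotient.inductionOn with | _ e
    induction b using Quotient.inductionOn with | _ f
    induction c using Quotient.inductionOn with | _ g
    simp only [mk_eq_vcls, vcls_add]
    refine vcls_eq _ _ ?_
    have h := idem_fromBlocks (idem_fromBlocks e.2.2 f.2.2) g.2.2
    convert MvN.reindex h (Equiv.sumAssoc _ _ _) using 1
    ext i j
    rcases i with i | i | i <;> rcases j with j | j | j <;> simp
  add_comm a b := by
    induction a using Quotient.inductionOn with | _ e
    induction b using Quotient.inductionOn with | _ f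
    simp only [mk_eq_vcls, vcls_add]
    refine vcls_eq _ _ ?_
    convert MvN.reindex (idem_fromBlocks e.2.2 f.2.2) (Equiv.sumComm _ _) using 1
    ext i j
    rcases i with i | i <;> rcases j with j | j <;> simp
  zero_add a := by
    induction a using Quotient.inductionOn with | _ e
    rw [mk_eq_vcls]
    change vcls _ _ + _ = _
    rw [vcls_add]
    refine vcls_eq _ _ ?_
    convert MvN.reindex (idem_fromBlocks _ e.2.2) (Equiv.emptySum (Fin 0) _) using 1
    · ext i j; simp
    · simp
  add_zero a := by
    induction a using Quotient.inductionOn with | _ e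
    rw [mk_eq_vcls]
    change _ + vcls _ _ = _
    rw [vcls_add]
    refine vcls_eq _ _ ?_
    convert MvN.reindex (idem_fromBlocks e.2.2 _) (Equiv.sumEmpty _ (Fin 0)) using 1
    · ext i j; simp
    · simp
  nsmul := nsmulRec

variable (B) in
/-- `K₀` of a unital ring: the Grothendieck group of `V(B)`. -/
abbrev K0 : Type u := Algebra.GrothendieckAddGroup (VMon B)

/-- The class `[e]₀ ∈ K₀(B)` of an idempotent matrix. -/
noncomputable def k0cls {ι : Type*} [Fintype ι] (e : Matrix ι ι B) (he : e * e = e) : K0 B :=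
  Algebra.GrothendieckAddGroup.of (vcls e he)

theorem idem_map {C : Type v} [Ring C] (f : B →+* C) {ι : Type*} [Fintype ι] {e : Matrix ι ι B}
    (he : e * e = e) : e.map f * e.map f = e.map f := by
  rw [← Matrix.map_mul, he]

/-- Functoriality of `V`. -/
noncomputable def VMon.map {C : Type v} [Ring C] (f : B →+* C) : VMon B →+ VMon C where
  toFun := Quotient.map (fun e => ⟨e.1, e.2.1.map f, idem_map f e.2.2⟩) (by
    rintro e e' ⟨x, y, h, h'⟩
    exact ⟨x.map f, y.map f, by rw [← Matrix.map_mul, h], by rw [← Matrix.map_mul, h']⟩)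
  map_zero' := by
    refine Quotient.sound (s := idemSetoid C) ?_
    have : IsEmpty (Fin (Fintype.card (Fin 0))) := by simpa using Fin.isEmpty
    exact ⟨0, 0, by ext i; exact isEmptyElim i, by ext i; exact isEmptyElim i⟩
  map_add' a b := by
    induction a using Quotient.inductionOn with | _ e
    induction b using Quotient.inductionOn with | _ g
    have key : ∀ {ι : Type} [Fintype ι] (e : Matrix ι ι B) (he : e * e = e),
        (Quotient.map (fun e => ⟨e.1, e.2.1.map f, idem_map f e.2.2⟩) (by
          rintro e e' ⟨x, y, h, h'⟩
          exact ⟨x.map f, y.map f, by rw [← Matrix.map_mul, h],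
            by rw [← Matrix.map_mul, h']⟩) (vcls e he) : VMon C) =
          vcls (e.map f) (idem_map f he) := by
      intro ι _ e he
      rfl
    simp only [mk_eq_vcls, vcls_add, key]
    refine vcls_eq _ _ ?_
    rw [Matrix.fromBlocks_map, Matrix.map_zero _ (map_zero f), Matrix.map_zero _ (map_zero f)]
    exact MvN.refl (idem_fromBlocks (idem_map f e.2.2) (idem_map f g.2.2))

theorem VMon.map_vcls {C : Type v} [Ring C] (f : B →+* C) {ι : Type*} [Fintype ι]
    (e : Matrix ι ι B) (he : e * e = e) :
    VMon.map f (vcls e he) = vcls (e.map f) (idem_map f he) := rfl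

/-- Functoriality of `K₀` on unital rings. -/
noncomputable def K0.map {C : Type v} [Ring C] (f : B →+* C) : K0 B →+ K0 C :=
  Algebra.GrothendieckAddGroup.lift (Algebra.GrothendieckAddGroup.of.comp (VMon.map f))

theorem K0.map_k0cls {C : Type v} [Ring C] (f : B →+* C) {ι : Type*} [Fintype ι]
    (e : Matrix ι ι B) (he : e * e = e) :
    K0.map f (k0cls e he) = k0cls (e.map f) (idem_map f he) := by
  have := DFunLike.congr_fun (Algebra.GrothendieckAddGroup.lift.symm_apply_apply
    (Algebra.GrothendieckAddGroup.of.comp (VMon.map f))) (vcls e he)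
  exact this

theorem K0.map_comp {C : Type*} [Ring C] {D : Type*} [Ring D] (g : C →+* D) (f : B →+* C) :
    (K0.map g).comp (K0.map f) = K0.map (g.comp f) := by
  refine Algebra.GrothendieckAddGroup.lift.symm.injective ?_
  ext x
  induction x using Quotient.inductionOn with | _ e
  rw [mk_eq_vcls]
  change K0.map g (K0.map f (k0cls _ _)) = K0.map (g.comp f) (k0cls _ _)
  rw [K0.map_k0cls, K0.map_k0cls, K0.map_k0cls]
  rfl

end KZeroUnital


section KOneDef

variable {B : Type u} [Ring B]

/-- The inclusion `GLₙ(B) → GLₘ(B)`, `u ↦ diag(u, 1)`, at the level of matrices. -/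
def stabMat {n m : ℕ} (h : n ≤ m) : Matrix (Fin n) (Fin n) B →* Matrix (Fin m) (Fin m) B where
  toFun u := Matrix.reindex (finSumFinEquiv.trans (finCongr (Nat.add_sub_of_le h)))
    (finSumFinEquiv.trans (finCongr (Nat.add_sub_of_le h)))
    (Matrix.fromBlocks u 0 0 (1 : Matrix (Fin (m - n)) (Fin (m - n)) B))
  map_one' := by
    rw [Matrix.fromBlocks_one]
    exact Matrix.submatrix_one_equiv _
  map_mul' u v := by
    simp only [Matrix.reindex_apply]
    rw [Matrix.submatrix_mul_equiv]
    simp [Matrix.fromBlocks_multiply]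

theorem stabMat_apply {n m : ℕ} (h : n ≤ m) (u : Matrix (Fin n) (Fin n) B) (i j : Fin m) :
    stabMat h u i j = if hij : i.1 < n ∧ j.1 < n then u ⟨i, hij.1⟩ ⟨j, hij.2⟩
      else if i = j then 1 else 0 := by
  obtain ⟨i, rfl⟩ := (finSumFinEquiv.trans (finCongr (Nat.add_sub_of_le h))).surjective i
  obtain ⟨j, rfl⟩ := (finSumFinEquiv.trans (finCongr (Nat.add_sub_of_le h))).surjective j
  rcases i with i | i <;> rcases j with j | j <;>
    simp [stabMat, Matrix.one_apply, Fin.ext_iff] <;> omega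

/-- The inclusion `GLₙ(B) → GLₘ(B)`, `u ↦ diag(u, 1)`. -/
def stab {n m : ℕ} (h : n ≤ m) : (Matrix (Fin n) (Fin n) B)ˣ →* (Matrix (Fin m) (Fin m) B)ˣ :=
  Units.map (stabMat h)

instance : DirectedSystem (fun n : ℕ => (Matrix (Fin n) (Fin n) B)ˣ)
    (fun n m h => (stab h : (Matrix (Fin n) (Fin n) B)ˣ →* (Matrix (Fin m) (Fin m) B)ˣ)) where
  map_self n u := by
    ext i j
    simp [stab, stabMat_apply]
  map_map k j i hij hjk u := by
    ext a b
    simp only [stab, Units.coe_map, stabMat_apply]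
    split_ifs <;> simp_all <;> omega

variable (B) in
/-- `GL_∞(B)`, the union of the groups `GLₙ(B)`. -/
abbrev GLInf : Type u :=
  DirectLimit (fun n : ℕ => (Matrix (Fin n) (Fin n) B)ˣ) (fun _ _ h => stab h)

/-- The image of an element of `GLₙ(B)` in `GL_∞(B)`. -/
def toGLInf {n : ℕ} (u : (Matrix (Fin n) (Fin n) B)ˣ) : GLInf B := ⟦⟨n, u⟩⟧

theorem toGLInf_stab {n m : ℕ} (h : n ≤ m) (u : (Matrix (Fin n) (Fin n) B)ˣ) :
    toGLInf (stab h u) = toGLInf u :=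
  Quotient.sound ⟨m, le_rfl, h, DirectedSystem.map_self' (fun n m h =>
    (stab h : (Matrix (Fin n) (Fin n) B)ˣ →* (Matrix (Fin m) (Fin m) B)ˣ)) _⟩

theorem toGLInf_mul {n : ℕ} (u v : (Matrix (Fin n) (Fin n) B)ˣ) :
    toGLInf (u * v) = toGLInf u * toGLInf v :=
  (DirectLimit.mul_def _ _ _).symm

theorem toGLInf_eq {n m : ℕ} {u : (Matrix (Fin n) (Fin n) B)ˣ} {v : (Matrix (Fin m) (Fin m) B)ˣ}
    (h : toGLInf u = toGLInf v) : ∃ k, ∃ (hn : n ≤ k) (hm : m ≤ k), stab hn u = stab hm v := by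
  obtain ⟨k, hn, hm, e⟩ := Quotient.exact h
  exact ⟨k, hn, hm, e⟩

theorem stabMat_map {C : Type v} [Ring C] (f : B →+* C) {n m : ℕ} (h : n ≤ m)
    (u : Matrix (Fin n) (Fin n) B) : (stabMat h u).map f = stabMat h (u.map f) := by
  ext i j
  simp only [Matrix.map_apply, stabMat_apply]
  split_ifs <;> simp

/-- The map `GLₙ(B) → GLₙ(C)` induced by a ring homomorphism. -/
def glMap {C : Type v} [Ring C] (f : B →+* C) (n : ℕ) :
    (Matrix (Fin n) (Fin n) B)ˣ →* (Matrix (Fin n) (Fin n) C)ˣ :=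
  Units.map f.mapMatrix.toMonoidHom

theorem glMap_stab {C : Type v} [Ring C] (f : B →+* C) {n m : ℕ} (h : n ≤ m)
    (u : (Matrix (Fin n) (Fin n) B)ˣ) : glMap f m (stab h u) = stab h (glMap f n u) :=
  Units.ext (stabMat_map f h u.1)

variable [TopologicalSpace B]

theorem continuous_stab {n m : ℕ} (h : n ≤ m) :
    Continuous (stab h : (Matrix (Fin n) (Fin n) B)ˣ → (Matrix (Fin m) (Fin m) B)ˣ) := by
  refine Continuous.units_map _ ?_
  refine continuous_matrix fun i j => ?_
  simp only [stabMat_apply]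
  split_ifs
  · exact continuous_id.matrix_elem _ _
  · exact continuous_const
  · exact continuous_const

variable [IsTopologicalRing B]

variable (B) in
/-- The homotopy relation on `GL_∞(B)`: two elements are equivalent when they are joined by a
continuous path of invertible matrices of some finite size. -/
def homotopyCon : Con (GLInf B) where
  r x y := ∃ (n : ℕ) (u v : (Matrix (Fin n) (Fin n) B)ˣ),
    x = toGLInf u ∧ y = toGLInf v ∧ Joined u v
  iseqv := by
    refine ⟨fun x => ?_, ?_, ?_⟩
    · induction x using Quotient.inductionOn with | _ x
      exact ⟨x.1, x.2, x.2, rfl, rfl, Joined.refl _⟩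
    · rintro x y ⟨n, u, v, h, h', j⟩
      exact ⟨n, v, u, h', h, j.symm⟩
    · rintro x y z ⟨n, u, v, rfl, rfl, j⟩ ⟨m, v', w, h, rfl, j'⟩
      obtain ⟨k, hn, hm, e⟩ := toGLInf_eq h
      refine ⟨k, stab hn u, stab hm w, (toGLInf_stab _ _).symm, (toGLInf_stab _ _).symm, ?_⟩
      exact (j.map (continuous_stab hn)).trans (e ▸ j'.map (continuous_stab hm))
  mul' := by
    rintro x y z t ⟨n, u, v, rfl, rfl, j⟩ ⟨m, u', v', rfl, rfl, j'⟩
    refine ⟨max n m, stab (le_max_left n m) u * stab (le_max_right n m) u',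
      stab (le_max_left n m) v * stab (le_max_right n m) v', ?_, ?_, ?_⟩
    · rw [toGLInf_mul, toGLInf_stab, toGLInf_stab]
    · rw [toGLInf_mul, toGLInf_stab, toGLInf_stab]
    · exact (j.map (continuous_stab _)).mul (j'.map (continuous_stab _))

variable (B) in
/-- `K₁(B)`: homotopy classes of invertible matrices over the topological ring `B`. The group
operation, written multiplicatively, is `[u][v] = [uv] = [diag(u, v)]`. -/
abbrev K1 : Type u := (homotopyCon B).Quotient

/-- The class `[u]₁` of an invertible matrix. -/
noncomputable def k1cls {n : ℕ} (u : (Matrix (Fin n) (Fin n) B)ˣ) : K1 B := (toGLInf u : (homotopyCon B).Quotient)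

/-- The class `[u]₁` of an invertible element. -/
noncomputable def k1unit (u : Bˣ) : K1 B := k1cls (Units.map (Matrix.scalar (Fin 1)).toMonoidHom u)

/-- Functoriality of `K₁` for continuous ring homomorphisms. -/
noncomputable def K1.map {C : Type v} [Ring C] [TopologicalSpace C] [IsTopologicalRing C] (f : B →+* C)
    (hf : Continuous f) : K1 B →* K1 C :=
  Con.lift (homotopyCon B)
    { toFun := fun x => DirectLimit.lift (C := K1 C) _ (fun n u => k1cls (glMap f n u)) (by
        intro i j h u
        unfold k1cls
        rw [glMap_stab, toGLInf_stab]) x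
      map_one' := by
        rw [DirectLimit.one_def 0, DirectLimit.lift_def, map_one]
        exact congrArg (fun x : GLInf C => (x : (homotopyCon C).Quotient))
          (DirectLimit.one_def (f := fun n m h =>
            (stab h : (Matrix (Fin n) (Fin n) C)ˣ →* (Matrix (Fin m) (Fin m) C)ˣ)) 0).symm
      map_mul' := by
        refine DirectLimit.induction₂ _ fun i x y => ?_
        rw [DirectLimit.mul_def, DirectLimit.lift_def, DirectLimit.lift_def,
          DirectLimit.lift_def, map_mul]
        unfold k1cls
        rw [toGLInf_mul]
        rfl } (by
    rintro x y ⟨n, u, v, rfl, rfl, j⟩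
    refine (Con.eq _).2 ?_
    refine ⟨n, glMap f n u, glMap f n v, rfl, rfl, j.map ?_⟩
    refine Continuous.units_map _ ?_
    exact continuous_id.matrix_map hf)

end KOneDef

section KZeroNonunital

theorem idem_single {J : Type u} [NonUnitalRing J] [Module ℂ J] {e : J} (he : e * e = e) :
    (Matrix.of fun _ _ : Fin 1 => (e : Unitization ℂ J)) *
      (Matrix.of fun _ _ : Fin 1 => (e : Unitization ℂ J)) =
      Matrix.of fun _ _ : Fin 1 => (e : Unitization ℂ J) := by
  refine Matrix.ext fun i j => ?_
  simp only [Matrix.mul_apply, Matrix.of_apply, Finset.univ_unique, Finset.sum_const,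
    Finset.card_singleton, one_smul]
  rw [← Unitization.inr_mul, he]

variable (J : Type u) [NonUnitalRing J] [Module ℂ J] [IsScalarTower ℂ J J] [SMulCommClass ℂ J J]

/-- `K₀` of a (not necessarily unital) complex algebra: the kernel of the map
`K₀(J⁺) → K₀(ℂ)` induced by the augmentation of the algebra `J⁺` with adjoined unit. -/
noncomputable def KZero : AddSubgroup (K0 (Unitization ℂ J)) :=
  (K0.map (Unitization.fstHom ℂ J).toRingHom).ker

variable {J}

/-- The class `[e]₀ ∈ K₀(J)` of an idempotent `e ∈ J`. -/
noncomputable def KZero.cls (e : J) (he : e * e = e) : KZero J :=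
  ⟨k0cls (Matrix.of fun _ _ : Fin 1 => (e : Unitization ℂ J)) (idem_single he), by
    rw [KZero, AddMonoidHom.mem_ker, K0.map_k0cls]
    have h : vcls ((Matrix.of fun _ _ : Fin 1 => (e : Unitization ℂ J)).map
        (Unitization.fstHom ℂ J).toRingHom) (idem_map _ (idem_single he)) =
          vcls (0 : Matrix (Fin 0) (Fin 0) ℂ) idem_zero := by
      refine vcls_eq _ _ ⟨0, 0, ?_, by ext i; exact i.elim0⟩
      ext i j
      simp
    unfold k0cls
    rw [h]
    exact map_zero Algebra.GrothendieckAddGroup.of⟩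

/-- The unital extension of a homomorphism of non-unital algebras. -/
noncomputable def unitMap {J' : Type v} [NonUnitalRing J'] [Module ℂ J'] [IsScalarTower ℂ J' J']
    [SMulCommClass ℂ J' J'] (f : J →ₙₐ[ℂ] J') : Unitization ℂ J →ₐ[ℂ] Unitization ℂ J' :=
  Unitization.lift ((Unitization.inrNonUnitalAlgHom ℂ J').comp f)

/-- Functoriality of `K₀` for homomorphisms of non-unital algebras. -/
noncomputable def KZero.map {J' : Type v} [NonUnitalRing J'] [Module ℂ J'] [IsScalarTower ℂ J' J']
    [SMulCommClass ℂ J' J'] (f : J →ₙₐ[ℂ] J') : KZero J →+ KZero J' :=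
  ((K0.map (unitMap f).toRingHom).comp (KZero J).subtype).codRestrict (KZero J') (by
    rintro ⟨x, hx⟩
    rw [KZero, AddMonoidHom.mem_ker] at hx ⊢
    have hfst : (Unitization.fstHom ℂ J').toRingHom.comp (unitMap f).toRingHom =
        (Unitization.fstHom ℂ J).toRingHom := by
      have : (Unitization.fstHom ℂ J').comp (unitMap f) = Unitization.fstHom ℂ J := by
        refine Unitization.algHom_ext' ?_
        ext a
        change (algebraMap ℂ (Unitization ℂ J') 0 + ((f a : J') : Unitization ℂ J')).fst = 0
        simp
      exact congrArg (fun g : Unitization ℂ J →ₐ[ℂ] ℂ => g.toRingHom) this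
    have key : (K0.map (Unitization.fstHom ℂ J').toRingHom).comp (K0.map (unitMap f).toRingHom) =
        K0.map (Unitization.fstHom ℂ J).toRingHom := by
      rw [← hfst]
      exact K0.map_comp _ _
    have := DFunLike.congr_fun key x
    rw [hx] at this
    exact this)

end KZeroNonunital

section IndexMap

variable {R : Type u} [Ring R] [Algebra ℂ R]

/-- A two-sided ideal regarded as a non-unital algebra. -/
def idealAlg (I : Ideal R) [I.IsTwoSided] : NonUnitalSubalgebra ℂ R where
  carrier := I
  add_mem' := I.add_mem
  zero_mem' := I.zero_mem
  mul_mem' := fun {a _} _ hb => I.mul_mem_left a hb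
  smul_mem' := fun c x hx => by
    rw [Algebra.smul_def]
    exact I.mul_mem_left _ hx

variable [TopologicalSpace R] [IsTopologicalRing R]

instance quotientTopology (I : Ideal R) [I.IsTwoSided] : IsTopologicalRing (R ⧸ I) where
  __ := QuotientAddGroup.instIsTopologicalAddGroup I.toAddSubgroup
  continuous_mul := by
    have h : IsOpenQuotientMap (Ideal.Quotient.mk I) := QuotientAddGroup.isOpenQuotientMap_mk
    exact ((h.prodMap h).isQuotientMap.continuous_iff).2 (continuous_quot_mk.comp continuous_mul)

variable {I : Ideal R} [I.IsTwoSided]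

/-- `y` is a value of the index map on `x`: `x = [u]₁` and `y = [w p w⁻¹]₀ - [p]₀`, where
`p = diag(1, 0)` and `w` is an invertible lift of `diag(u, u⁻¹)`. The matrix `w p w⁻¹`, which is
congruent to `p` modulo `I`, is regarded as a matrix `e` over the algebra `I⁺`. -/
def IsIndexClass (x : K1 (R ⧸ I)) (y : KZero (idealAlg I)) : Prop :=
  ∃ (n : ℕ) (u : (Matrix (Fin n) (Fin n) (R ⧸ I))ˣ)
    (w : (Matrix (Fin n ⊕ Fin n) (Fin n ⊕ Fin n) R)ˣ)
    (e p : Matrix (Fin n ⊕ Fin n) (Fin n ⊕ Fin n) (Unitization ℂ (idealAlg I)))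
    (he : e * e = e) (hp : p * p = p),
    x = k1cls u ∧
    (w : Matrix _ _ R).map (Ideal.Quotient.mk I) =
      Matrix.fromBlocks (u : Matrix (Fin n) (Fin n) (R ⧸ I)) 0 0
        ((u⁻¹ : (Matrix (Fin n) (Fin n) (R ⧸ I))ˣ) : Matrix (Fin n) (Fin n) (R ⧸ I)) ∧
    p = Matrix.fromBlocks 1 0 0 0 ∧
    e.map (Unitization.fstHom ℂ (idealAlg I)) = Matrix.fromBlocks 1 0 0 0 ∧
    e.map (NonUnitalSubalgebra.unitization (idealAlg I)) =
      (w : Matrix _ _ R) * Matrix.fromBlocks 1 0 0 0 * ((w⁻¹ : _ˣ) : Matrix _ _ R) ∧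
    (y : K0 (Unitization ℂ (idealAlg I))) = k0cls e he - k0cls p hp

theorem exists_isIndexClass (x : K1 (R ⧸ I)) : ∃ y : KZero (idealAlg I), IsIndexClass x y := by
  induction x using Con.induction_on with | _ x
  induction x using Quotient.inductionOn with | _ x
  obtain ⟨n, u⟩ := x
  have lift : ∀ M : Matrix (Fin n) (Fin n) (R ⧸ I), ∃ a : Matrix (Fin n) (Fin n) R,
      a.map (Ideal.Quotient.mk I) = M := fun M => by
    choose a ha using fun i j => Ideal.Quotient.mk_surjective (M i j)
    exact ⟨a, by ext i j; exact ha i j⟩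
  obtain ⟨a, ha⟩ := lift u
  obtain ⟨b, hb⟩ := lift (u⁻¹ : _ˣ)
  let π : Matrix (Fin n ⊕ Fin n) (Fin n ⊕ Fin n) R →+*
    Matrix (Fin n ⊕ Fin n) (Fin n ⊕ Fin n) (R ⧸ I) := (Ideal.Quotient.mk I).mapMatrix
  let w₀ : Matrix (Fin n ⊕ Fin n) (Fin n ⊕ Fin n) R :=
    Matrix.fromBlocks (a + a - a * b * a) (a * b - 1) (1 - b * a) b
  let w₁ : Matrix (Fin n ⊕ Fin n) (Fin n ⊕ Fin n) R :=
    Matrix.fromBlocks b (1 - b * a) (a * b - 1) (a + a - a * b * a)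
  have h01 : w₀ * w₁ = 1 := by
    rw [← Matrix.fromBlocks_one]
    simp only [w₀, w₁, Matrix.fromBlocks_multiply]
    congr 1 <;> noncomm_ring
  have h10 : w₁ * w₀ = 1 := by
    rw [← Matrix.fromBlocks_one]
    simp only [w₀, w₁, Matrix.fromBlocks_multiply]
    congr 1 <;> noncomm_ring
  let w : (Matrix (Fin n ⊕ Fin n) (Fin n ⊕ Fin n) R)ˣ := ⟨w₀, w₁, h01, h10⟩
  have mm : ∀ c d : Matrix (Fin n) (Fin n) R, (c * d).map (Ideal.Quotient.mk I) =
    c.map (Ideal.Quotient.mk I) * d.map (Ideal.Quotient.mk I) := fun c d => Matrix.map_mul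
  have hw : w₀.map (Ideal.Quotient.mk I) = Matrix.fromBlocks (u : Matrix _ _ (R ⧸ I)) 0 0
      ((u⁻¹ : _ˣ) : Matrix _ _ (R ⧸ I)) := by
    simp only [w₀, Matrix.fromBlocks_map]
    rw [Matrix.map_sub _ (map_sub _), Matrix.map_sub _ (map_sub _), Matrix.map_sub _ (map_sub _),
      Matrix.map_add _ (map_add _), mm, mm, mm, ha, hb,
      Matrix.map_one _ (map_zero _) (map_one _)]
    simp
  have hw' : π w₀ = Matrix.fromBlocks (u : Matrix _ _ (R ⧸ I)) 0 0
      ((u⁻¹ : _ˣ) : Matrix _ _ (R ⧸ I)) := hw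
  let P : Matrix (Fin n ⊕ Fin n) (Fin n ⊕ Fin n) R := Matrix.fromBlocks 1 0 0 0
  let P' : Matrix (Fin n ⊕ Fin n) (Fin n ⊕ Fin n) (R ⧸ I) := Matrix.fromBlocks 1 0 0 0
  have hP' : π P = P' := by
    change P.map (Ideal.Quotient.mk I) = P'
    simp only [P, P', Matrix.fromBlocks_map]
    rw [Matrix.map_one _ (map_zero _) (map_one _), Matrix.map_zero _ (map_zero _)]
  have hπ : π (w₀ * P * w₁ - P) = 0 := by
    have hc : π w₀ * P' = P' * π w₀ := by
      rw [hw']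
      simp [P', Matrix.fromBlocks_multiply]
    rw [map_sub, map_mul, map_mul, hP', hc, mul_assoc, ← map_mul, h01, map_one, mul_one, sub_self]
  have hmem : ∀ i j, (w₀ * P * w₁ - P) i j ∈ idealAlg I := fun i j => by
    have : π (w₀ * P * w₁ - P) i j = 0 := by rw [hπ]; rfl
    exact Ideal.Quotient.eq_zero_iff_mem.1 this
  let Q : Matrix (Fin n ⊕ Fin n) (Fin n ⊕ Fin n) ℂ := Matrix.fromBlocks 1 0 0 0
  let e : Matrix (Fin n ⊕ Fin n) (Fin n ⊕ Fin n) (Unitization ℂ (idealAlg I)) := fun i j =>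
    Unitization.inl (Q i j) + ((⟨_, hmem i j⟩ : idealAlg I) : Unitization ℂ (idealAlg I))
  let f₁ : Unitization ℂ (idealAlg I) →+* ℂ := (Unitization.fstHom ℂ _).toRingHom
  let f₂ : Unitization ℂ (idealAlg I) →+* R :=
    (NonUnitalSubalgebra.unitization (idealAlg I)).toRingHom
  have hQP : ∀ i j, algebraMap ℂ R (Q i j) = P i j := fun i j => by
    rcases i with i | i <;> rcases j with j | j <;>
      simp [Q, P, Matrix.one_apply, apply_ite (algebraMap ℂ R)]
  have e1 : f₁.mapMatrix e = Q := by
    refine Matrix.ext fun i j => ?_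
    change (e i j).fst = Q i j
    simp [e]
  have e2 : f₂.mapMatrix e = w₀ * P * w₁ := by
    refine Matrix.ext fun i j => ?_
    change algebraMap ℂ R (e i j).fst + ((e i j).snd : R) = (w₀ * P * w₁) i j
    simp [e, hQP]
  have hPP : P * P = P := by simp [P, Matrix.fromBlocks_multiply]
  have inj : ∀ s t : Unitization ℂ (idealAlg I), f₁ s = f₁ t → f₂ s = f₂ t → s = t := by
    intro s t h1 h2
    have h1' : s.fst = t.fst := h1
    refine Unitization.ext h1' ?_
    have h2' : algebraMap ℂ R s.fst + (s.snd : R) = algebraMap ℂ R t.fst + (t.snd : R) := h2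
    rw [h1'] at h2'
    exact Subtype.ext (add_left_cancel h2')
  have he : e * e = e := by
    have k1 : f₁.mapMatrix (e * e) = f₁.mapMatrix e := by
      rw [map_mul, e1]
      simp [Q, Matrix.fromBlocks_multiply]
    have k2 : f₂.mapMatrix (e * e) = f₂.mapMatrix e := by
      rw [map_mul, e2]
      calc w₀ * P * w₁ * (w₀ * P * w₁) = w₀ * P * (w₁ * w₀) * P * w₁ := by
            simp only [mul_assoc]
        _ = w₀ * (P * P) * w₁ := by rw [h10]; simp only [mul_assoc, one_mul]
        _ = w₀ * P * w₁ := by rw [hPP]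
    refine Matrix.ext fun i j => ?_
    exact inj _ _ (congrFun (congrFun k1 i) j) (congrFun (congrFun k2 i) j)
  have hp : (Matrix.fromBlocks 1 0 0 0 : Matrix (Fin n ⊕ Fin n) (Fin n ⊕ Fin n)
      (Unitization ℂ (idealAlg I))) * Matrix.fromBlocks 1 0 0 0 = Matrix.fromBlocks 1 0 0 0 := by
    simp [Matrix.fromBlocks_multiply]
  have hk : (k0cls e he - k0cls _ hp : K0 (Unitization ℂ (idealAlg I))) ∈ KZero (idealAlg I) := by
    rw [KZero, AddMonoidHom.mem_ker, map_sub, K0.map_k0cls, K0.map_k0cls, sub_eq_zero]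
    have : e.map f₁ = (Matrix.fromBlocks 1 0 0 0 : Matrix (Fin n ⊕ Fin n) (Fin n ⊕ Fin n)
      (Unitization ℂ (idealAlg I))).map f₁ := by
      rw [Matrix.fromBlocks_map, Matrix.map_one _ (map_zero _) (map_one _),
        Matrix.map_zero _ (map_zero _)]
      exact e1
    change k0cls (e.map f₁) _ = k0cls (Matrix.map _ f₁) _
    simp only [this]
  exact ⟨⟨_, hk⟩, n, u, w, e, _, he, hp, rfl, hw, rfl, e1, e2, rfl⟩

/-- The index map `K₁(R/I) → K₀(I)` of the extension `0 → I → R → R/I → 0`. -/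
noncomputable def indexMap (x : K1 (R ⧸ I)) : KZero (idealAlg I) :=
  Classical.choose (exists_isIndexClass x)

end IndexMap

section Quotients

variable {A : Type u} [Ring A] (K E : Ideal A) [K.IsTwoSided] [E.IsTwoSided]

/-- The image of the ideal `E` in `A/K`. -/
def quotIdeal : Ideal (A ⧸ K) := E.map (Ideal.Quotient.mk K)

instance quotIdeal_twoSided : (quotIdeal K E).IsTwoSided where
  mul_mem_of_left := fun {a} b ha => by
    obtain ⟨a, ha', rfl⟩ :=
      (Ideal.mem_map_iff_of_surjective _ Ideal.Quotient.mk_surjective).1 ha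
    obtain ⟨b, rfl⟩ := Ideal.Quotient.mk_surjective b
    rw [← map_mul]
    exact Ideal.mem_map_of_mem _ (Ideal.mul_mem_right b _ ha')

/-- The canonical homomorphism `A/E → (A/K)/(E/K)`, an isomorphism if `K ⊆ E`. -/
def canQuot : A ⧸ E →+* (A ⧸ K) ⧸ quotIdeal K E :=
  Ideal.Quotient.lift E
    ((Ideal.Quotient.mk (quotIdeal K E)).comp (Ideal.Quotient.mk K)) fun _ ha =>
      Ideal.Quotient.eq_zero_iff_mem.2 (Ideal.mem_map_of_mem _ ha)

theorem continuous_canQuot [TopologicalSpace A] : Continuous (canQuot K E) :=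
  continuous_quot_lift _ (continuous_quot_mk.comp continuous_quot_mk)

variable [Algebra ℂ A]

/-- The class of an element of `E` in the algebra `E/K`. -/
def toQuotIdeal (a : A) (ha : a ∈ E) : idealAlg (quotIdeal K E) :=
  ⟨Ideal.Quotient.mk K a, Ideal.mem_map_of_mem _ ha⟩

variable [TopologicalSpace A] [IsTopologicalRing A]

/-- The connecting map `K₁(A/E) → K₀(E/K)` of the exact sequence
`0 → E/K → A/K → A/E → 0`, where `K ⊆ E`. -/
noncomputable def connecting (x : K1 (A ⧸ E)) : KZero (idealAlg (quotIdeal K E)) :=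
  indexMap (K1.map (canQuot K E) (continuous_canQuot K E) x)

end Quotients

end OpKTheory

namespace CylinderAlgebra

open MeasureTheory OpKTheory

universe u

/-! ### Hilbert spaces -/

instance factTwoPi : Fact (0 < 2 * Real.pi) := ⟨Real.two_pi_pos⟩

/-- The circle `S¹ = ℝ / 2πℤ`, with angular coordinate `β` (or `θ`). -/
abbrev Circ : Type := AddCircle (2 * Real.pi)

/-- The normalised arc length measure on the circle. -/
noncomputable abbrev circMeas : Measure Circ := AddCircle.haarAddCircle

/-- `L²(S¹)`. -/
abbrev L2S1 : Type := Lp ℂ 2 circMeas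

/-- `L²(Ω)` for the cylinder `Ω = ℝ × S¹`, in the form `L²(ℝ, L²(S¹))`. -/
abbrev L2Cyl : Type := Lp L2S1 2 (volume : Measure ℝ)

/-- `L²(ℤ × S¹)`, in the form `ℓ²(ℤ, L²(S¹))`. -/
abbrev L2ZS1 : Type := lp (fun _ : ℤ => L2S1) 2

section Operators

variable {X : Type*} [MeasurableSpace X] {E : Type*} [NormedAddCommGroup E] [NormedSpace ℂ E]

/-- Multiplication by an essentially bounded scalar function `g` on `L²(X, E)`. -/
noncomputable def smulOp (μ : Measure X) (g : X → ℂ) (hg : MemLp g ⊤ μ) :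
    Lp E 2 μ →L[ℂ] Lp E 2 μ :=
  (ContinuousLinearMap.lsmul ℂ ℂ : ℂ →L[ℂ] E →L[ℂ] E).holderL μ ⊤ 2 2 (hg.toLp g)

theorem smulOp_coeFn (μ : Measure X) (g : X → ℂ) (hg : MemLp g ⊤ μ) (f : Lp E 2 μ) :
    smulOp μ g hg f =ᵐ[μ] fun x => g x • f x := by
  refine (ContinuousLinearMap.coeFn_holder (r := 2) _ (hg.toLp g) f).trans ?_
  filter_upwards [hg.coeFn_toLp] with x hx
  simp [hx]

/-- Multiplication by an essentially bounded operator-valued function `B` on `L²(X, E)`,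
`f ↦ (x ↦ B(x) f(x))`. -/
noncomputable def mulOp (μ : Measure X) (B : X → E →L[ℂ] E) (hB : MemLp B ⊤ μ) :
    Lp E 2 μ →L[ℂ] Lp E 2 μ :=
  (ContinuousLinearMap.id ℂ (E →L[ℂ] E)).holderL μ ⊤ 2 2 (hB.toLp B)

end Operators

/-- The diagonal operator `(u_j)_j ↦ (d_j u_j)_j` on `ℓ²(ℤ, L²(S¹))` defined by a bounded sequence
of operators. -/
noncomputable def diagOp (d : lp (fun _ : ℤ => L2S1 →L[ℂ] L2S1) ⊤) : L2ZS1 →L[ℂ] L2ZS1 :=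
  lp.holderL 2 (fun _ : ℤ => ContinuousLinearMap.id ℂ (L2S1 →L[ℂ] L2S1)) (K := 1)
    (fun _ => ContinuousLinearMap.norm_id_le) d

/-- The Fourier multiplier on `L²(S¹)` that multiplies the `k`-th Fourier coefficient by `d k`. -/
noncomputable def circMult (d : lp (fun _ : ℤ => ℂ) ⊤) : L2S1 →L[ℂ] L2S1 :=
  (fourierBasis (T := 2 * Real.pi)).repr.symm.toContinuousLinearEquiv.conjContinuousAlgEquiv
    (lp.holderL 2 (fun _ : ℤ => ContinuousLinearMap.mul ℂ ℂ) (K := 1) (fun _ => by simp) d)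

theorem continuous_circMult : Continuous circMult :=
  (ContinuousLinearEquiv.conjContinuousAlgEquiv _).continuous.comp
    (ContinuousLinearMap.continuous _)

theorem norm_circMult_le (d : lp (fun _ : ℤ => ℂ) ⊤) : ‖circMult d‖ ≤ ‖d‖ := by
  refine ContinuousLinearMap.opNorm_le_bound _ (norm_nonneg _) fun v => ?_
  change ‖(fourierBasis (T := 2 * Real.pi)).repr.symm (lp.holderL 2
    (fun _ : ℤ => ContinuousLinearMap.mul ℂ ℂ) (K := 1) (fun _ => by simp) d
      ((fourierBasis (T := 2 * Real.pi)).repr v))‖ ≤ _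
  rw [LinearIsometryEquiv.norm_map]
  refine (ContinuousLinearMap.le_opNorm₂ _ _ _).trans ?_
  rw [LinearIsometryEquiv.norm_map]
  have h := lp.norm_holderL_le (p := ⊤) (q := 2) 2 (fun _ : ℤ => ContinuousLinearMap.mul ℂ ℂ)
    (K := 1) (fun _ => by simp)
  have h' := mul_le_mul_of_nonneg_right h (mul_nonneg (norm_nonneg d) (norm_nonneg v))
  simpa [mul_assoc] using h'

/-- The symbols `(1 + τ² + k²)^(-1/2)`, `τ (1 + τ² + k²)^(-1/2)` and `k (1 + τ² + k²)^(-1/2)`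
(for `i = 0, 1, 2`), where `τ` is dual to `t ∈ ℝ` and `k ∈ ℤ` is dual to `β ∈ S¹`. -/
noncomputable def symb (i : Fin 3) (τ : ℝ) (k : ℤ) : ℝ :=
  ![1, τ, (k : ℝ)] i / Real.sqrt (1 + τ ^ 2 + (k : ℝ) ^ 2)

theorem le_rad (i : Fin 3) (τ : ℝ) (k : ℤ) :
    |![1, τ, (k : ℝ)] i| ≤ Real.sqrt (1 + τ ^ 2 + (k : ℝ) ^ 2) := by
  refine Real.abs_le_sqrt ?_
  fin_cases i <;> simp <;> nlinarith [sq_nonneg τ, sq_nonneg (k : ℝ)]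

theorem one_le_rad (τ : ℝ) (k : ℤ) : 1 ≤ Real.sqrt (1 + τ ^ 2 + (k : ℝ) ^ 2) := by
  simpa using le_rad 0 τ k

theorem abs_symb_le (i : Fin 3) (τ : ℝ) (k : ℤ) : |symb i τ k| ≤ 1 := by
  have h := one_le_rad τ k
  rw [symb, abs_div, abs_of_nonneg (Real.sqrt_nonneg _), div_le_one (by linarith)]
  exact le_rad i τ k

theorem rad_sub_le (τ σ : ℝ) (k : ℤ) :
    |Real.sqrt (1 + τ ^ 2 + (k : ℝ) ^ 2) - Real.sqrt (1 + σ ^ 2 + (k : ℝ) ^ 2)| ≤ |τ - σ| := by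
  have h1 := one_le_rad τ k
  have h2 := one_le_rad σ k
  have h3 := le_rad 1 τ k
  have h4 := le_rad 1 σ k
  simp only [Matrix.cons_val_one, Matrix.cons_val_zero] at h3 h4
  set r := Real.sqrt (1 + τ ^ 2 + (k : ℝ) ^ 2) with hr
  set s := Real.sqrt (1 + σ ^ 2 + (k : ℝ) ^ 2) with hs
  have hr2 : r ^ 2 = 1 + τ ^ 2 + (k : ℝ) ^ 2 := Real.sq_sqrt (by positivity)
  have hs2 : s ^ 2 = 1 + σ ^ 2 + (k : ℝ) ^ 2 := Real.sq_sqrt (by positivity)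
  have key : |r - s| * (r + s) = |τ - σ| * |τ + σ| := by
    rw [← abs_of_pos (show 0 < r + s by linarith), ← abs_mul, ← abs_mul]
    congr 1
    linear_combination hr2 - hs2
  have h5 : |τ + σ| ≤ r + s := (abs_add_le _ _).trans (add_le_add h3 h4)
  have h6 : |r - s| * (r + s) ≤ |τ - σ| * (r + s) := by
    rw [key]
    exact mul_le_mul_of_nonneg_left h5 (abs_nonneg _)
  exact le_of_mul_le_mul_right h6 (by linarith)

theorem abs_symb_sub_le (i : Fin 3) (τ σ : ℝ) (k : ℤ) :
    |symb i τ k - symb i σ k| ≤ 2 * |τ - σ| := by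
  have h1 := one_le_rad τ k
  have h2 := one_le_rad σ k
  have h3 := le_rad i σ k
  have h4 := rad_sub_le σ τ k
  rw [abs_sub_comm σ τ] at h4
  have h7 : |![1, τ, (k : ℝ)] i - ![1, σ, (k : ℝ)] i| ≤ |τ - σ| := by
    fin_cases i <;> simp
  simp only [symb]
  set r := Real.sqrt (1 + τ ^ 2 + (k : ℝ) ^ 2) with hr
  set s := Real.sqrt (1 + σ ^ 2 + (k : ℝ) ^ 2) with hs
  generalize ![1, τ, (k : ℝ)] i = a at *
  generalize ![1, σ, (k : ℝ)] i = b at *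
  have hr0 : 0 < r := by linarith
  have hs0 : 0 < s := by linarith
  have e : a / r - b / s = (a - b) / r + (b / s) * ((s - r) / r) := by
    field_simp
    ring
  have hb : |b / s| ≤ 1 := by
    rw [abs_div, abs_of_pos hs0, div_le_one hs0]
    exact h3
  have hd : ∀ c : ℝ, |c| ≤ |τ - σ| → |c / r| ≤ |τ - σ| := fun c hc => by
    rw [abs_div, abs_of_pos hr0]
    exact (div_le_self (abs_nonneg _) h1).trans hc
  rw [e]
  refine (abs_add_le _ _).trans ?_
  rw [abs_mul]
  have := hd _ h7
  have := hd _ h4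
  nlinarith [abs_nonneg ((s - r) / r), abs_nonneg (b / s)]

/-- The bounded sequence `k ↦ symb i τ k`. -/
noncomputable def symbSeq (i : Fin 3) (τ : ℝ) : lp (fun _ : ℤ => ℂ) ⊤ :=
  ⟨fun k => (symb i τ k : ℂ), memℓp_infty ⟨1, by
    rintro _ ⟨k, rfl⟩
    simpa using abs_symb_le i τ k⟩⟩

theorem continuous_symbSeq (i : Fin 3) : Continuous (symbSeq i) := by
  refine (LipschitzWith.of_dist_le_mul (K := 2) fun τ σ => ?_).continuous
  rw [dist_eq_norm, Real.dist_eq]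
  refine lp.norm_le_of_forall_le (by positivity) fun k => ?_
  have : (symbSeq i τ - symbSeq i σ) k = ((symb i τ k - symb i σ k : ℝ) : ℂ) := by
    rw [Complex.ofReal_sub]
    rfl
  rw [this, Complex.norm_real]
  exact abs_symb_sub_le i τ σ k

theorem norm_symbSeq_le (i : Fin 3) (τ : ℝ) : ‖symbSeq i τ‖ ≤ 1 := by
  refine lp.norm_le_of_forall_le zero_le_one fun k => ?_
  change ‖(symb i τ k : ℂ)‖ ≤ 1
  simpa using abs_symb_le i τ k

/-- For `i = 0, 1, 2` the operators `Λ̃(τ) = (1 + τ² - Δ)^(-1/2)`, `τ Λ̃(τ)` and `(1/i) ∂_β Λ̃(τ)`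
on `L²(S¹)`. -/
noncomputable def symbOp (i : Fin 3) (τ : ℝ) : L2S1 →L[ℂ] L2S1 := circMult (symbSeq i τ)

theorem continuous_symbOp (i : Fin 3) : Continuous (symbOp i) :=
  continuous_circMult.comp (continuous_symbSeq i)

theorem norm_symbOp_le (i : Fin 3) (τ : ℝ) : ‖symbOp i τ‖ ≤ 1 :=
  (norm_circMult_le _).trans (norm_symbSeq_le i τ)

/-! ### The generators of the algebra -/

/-- Multiplication by `a(β)` on `L²(S¹)`. -/
noncomputable def circMul (a : C(Circ, ℂ)) : L2S1 →L[ℂ] L2S1 :=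
  smulOp circMeas a (memLp_top_of_bound a.continuous.aestronglyMeasurable ‖a‖
    (ae_of_all _ a.norm_coe_le_norm))

/-- Multiplication by `a(β)` on `L²(Ω)`. -/
noncomputable def mulBeta (a : C(Circ, ℂ)) : L2Cyl →L[ℂ] L2Cyl :=
  ContinuousLinearMap.compLpL 2 volume (circMul a)

/-- Smoothness of a function on the circle. -/
def IsSmooth (a : C(Circ, ℂ)) : Prop := ContDiff ℝ (⊤ : ℕ∞) fun β : ℝ => a (β : Circ)

/-- Multiplication by `b(t)` on `L²(Ω)`, for `b` continuous on `[-∞, +∞]`. -/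
noncomputable def mulT (b : C(EReal, ℂ)) : L2Cyl →L[ℂ] L2Cyl :=
  smulOp volume (fun t : ℝ => b (t : EReal))
    (memLp_top_of_bound (b.continuous.comp continuous_coe_real_ereal).aestronglyMeasurable ‖b‖
      (ae_of_all _ fun t => b.norm_coe_le_norm t))

/-- Multiplication by `p_j(t) = e^{ijt}` on `L²(Ω)`. -/
noncomputable def mulExp (j : ℤ) : L2Cyl →L[ℂ] L2Cyl :=
  smulOp volume (fun t : ℝ => Complex.exp (Complex.I * j * t))
    (memLp_top_of_bound (by fun_prop) 1 (ae_of_all _ fun t => by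
      rw [Complex.norm_exp]
      simp))

/-- The operators `Λ = (1 - Δ)^(-1/2)`, `(1/i) ∂_t Λ` and `(1/i) ∂_β Λ` on `L²(Ω)` (for
`i = 0, 1, 2`), by means of the Fourier transform in `t`; Mathlib's Fourier transform has the
kernel `e^{-2πi t ξ}`, so that `(1/i) ∂_t` becomes multiplication by `2πξ`. -/
noncomputable def lamOp (i : Fin 3) : L2Cyl →L[ℂ] L2Cyl :=
  (Lp.fourierTransformₗᵢ ℝ L2S1).symm.toContinuousLinearEquiv.conjContinuousAlgEquiv
    (mulOp volume (fun ξ : ℝ => symbOp i (2 * Real.pi * ξ))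
      (memLp_top_of_bound
        ((continuous_symbOp i).comp (continuous_const_mul _)).aestronglyMeasurable 1
        (ae_of_all _ fun _ => norm_symbOp_le i _)))

/-- The generators of the algebra. -/
def generators : Set (L2Cyl →L[ℂ] L2Cyl) :=
  {A | ∃ a, IsSmooth a ∧ A = mulBeta a} ∪ Set.range mulT ∪ Set.range mulExp ∪ Set.range lamOp

/-- The C*-algebra `𝒜`: the smallest C*-subalgebra of the bounded operators on `L²(Ω)` that
contains the generators. -/
noncomputable def cylAlg : StarSubalgebra ℂ (L2Cyl →L[ℂ] L2Cyl) :=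
  (StarAlgebra.adjoin ℂ generators).topologicalClosure

/-! ### The operators `Y_φ` on `L²(ℤ × S¹)` -/

/-- The map `v ↦ e^{ilθ} v` from `L²(S¹)` to `L²(S¹, L²(S¹))`. -/
noncomputable def expMap (l : ℤ) : L2S1 →L[ℂ] Lp L2S1 2 circMeas :=
  (smulOp circMeas (fourier l) (memLp_top_of_bound (fourier l).continuous.aestronglyMeasurable
    ‖fourier (T := 2 * Real.pi) l‖ (ae_of_all _ (fourier l).norm_coe_le_norm))).comp
    (Lp.constL 2 circMeas ℂ)

theorem inner_expMap (l m : ℤ) (v w : L2S1) :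
    inner ℂ (expMap l v) (expMap m w) = if l = m then inner ℂ v w else 0 := by
  have h : ∀ (l : ℤ) (v : L2S1), expMap l v =ᵐ[circMeas] fun θ => fourier l θ • v := by
    intro l v
    refine (smulOp_coeFn _ _ _ _).trans ?_
    filter_upwards [Lp.coeFn_const 2 circMeas v] with θ hθ
    change fourier l θ • (Lp.const 2 circMeas v) θ = _
    rw [hθ]
    rfl
  have h2 : ∫ θ, inner ℂ (fourier l θ) (fourier m θ) ∂circMeas = if l = m then 1 else 0 := by
    have h3 := orthonormal_iff_ite.1 (orthonormal_fourier (T := 2 * Real.pi)) l m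
    rw [L2.inner_def] at h3
    rw [← h3]
    refine integral_congr_ae ?_
    filter_upwards [coeFn_fourierLp (T := 2 * Real.pi) 2 l, coeFn_fourierLp (T := 2 * Real.pi) 2 m]
      with θ h4 h5
    rw [h4, h5]
  rw [L2.inner_def]
  have h6 : ∀ᵐ θ ∂circMeas, inner ℂ (expMap l v θ) (expMap m w θ) =
      inner ℂ (fourier l θ) (fourier m θ) * inner ℂ v w := by
    filter_upwards [h l v, h m w] with θ h4 h5
    rw [h4, h5, inner_smul_left, inner_smul_right]
    simp only [RCLike.inner_apply]
    ring
  rw [integral_congr_ae h6, integral_mul_const, h2]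
  split_ifs <;> simp

/-- The isometric embedding `v ↦ e^{ilθ} v` of `L²(S¹)` into `L²(S¹, L²(S¹))`. -/
noncomputable def expEmb (l : ℤ) : L2S1 →ₗᵢ[ℂ] Lp L2S1 2 circMeas :=
  (expMap l : L2S1 →ₗ[ℂ] Lp L2S1 2 circMeas).isometryOfInner fun v w => by
    simpa using inner_expMap l l v w

theorem expEmb_orthogonal : OrthogonalFamily ℂ (fun _ : ℤ => L2S1) expEmb := by
  intro l m hlm v w
  exact (inner_expMap l m v w).trans (if_neg hlm)

/-- The synthesis map `(u_j)_j ↦ ∑_j e^{ijθ} u_j`, which is the inverse of the discrete Fourier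
transform `F_d : L²(S¹, L²(S¹)) → ℓ²(ℤ, L²(S¹))`. -/
noncomputable def synth : L2ZS1 →L[ℂ] Lp L2S1 2 circMeas :=
  expEmb_orthogonal.linearIsometry.toContinuousLinearMap

/-- The function `z^{-φ}` on the circle, `z = e^{iθ}` with `-π < θ ≤ π`. -/
noncomputable def negPow (φ : ℝ) (θ : Circ) : ℂ :=
  Complex.exp (-(Complex.I * φ *
    ((AddCircle.measurableEquivIoc (2 * Real.pi) (-Real.pi) θ : ℝ) : ℂ)))

theorem negPow_memLp (φ : ℝ) : MemLp (negPow φ) ⊤ circMeas := by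
  refine memLp_top_of_bound (Measurable.aestronglyMeasurable ?_) 1 (ae_of_all _ fun θ => ?_)
  · have h : Measurable fun θ : Circ =>
        (AddCircle.measurableEquivIoc (2 * Real.pi) (-Real.pi) θ : ℝ) :=
      measurable_subtype_coe.comp (MeasurableEquiv.measurable _)
    unfold negPow
    fun_prop
  · rw [negPow, Complex.norm_exp]
    simp

/-- The unitary operator `Y_φ = F_d U_φ F_d⁻¹` on `L²(ℤ × S¹)`, where `U_φ` is multiplication
by `z^{-φ}` and `F_d` is the adjoint of the unitary map `F_d⁻¹`. -/
noncomputable def yOp (φ : ℝ) : L2ZS1 →L[ℂ] L2ZS1 :=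
  (ContinuousLinearMap.adjoint synth).comp
    ((smulOp circMeas (negPow φ) (negPow_memLp φ)).comp synth)

/-- The operator `S_i(M_j - φ)` on `L²(ℤ × S¹)`, which acts on the `j`-th component by
`S_i(j - φ)`, with `S_i` one of `Λ̃(τ)`, `τ Λ̃(τ)`, `(1/i) ∂_β Λ̃(τ)`. -/
noncomputable def shiftedSymbOp (i : Fin 3) (φ : ℝ) : L2ZS1 →L[ℂ] L2ZS1 :=
  diagOp ⟨fun j => symbOp i (j - φ), memℓp_infty ⟨1, by
    rintro _ ⟨j, rfl⟩
    exact norm_symbOp_le i _⟩⟩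

/-- The operator `A ⊗ 1`, acting as `A` on every component of `L²(ℤ × S¹)`. -/
noncomputable def constDiag (A : L2S1 →L[ℂ] L2S1) : L2ZS1 →L[ℂ] L2ZS1 :=
  diagOp ⟨fun _ => A, memℓp_infty ⟨‖A‖, by
    rintro _ ⟨j, rfl⟩
    exact le_rfl⟩⟩


/-! ### The ideals -/

/-- The ideal of compact operators in `𝒜`. -/
noncomputable def compactIdeal : Ideal cylAlg where
  carrier := {A | IsCompactOperator (A : L2Cyl →L[ℂ] L2Cyl)}
  add_mem' := fun ha hb => IsCompactOperator.add ha hb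
  zero_mem' := isCompactOperator_zero
  smul_mem' := fun c _ ha => IsCompactOperator.clm_comp ha (c : L2Cyl →L[ℂ] L2Cyl)

instance compactIdeal_twoSided : compactIdeal.IsTwoSided where
  mul_mem_of_left := fun b ha => IsCompactOperator.comp_clm ha (b : L2Cyl →L[ℂ] L2Cyl)

/-- The commutator ideal `ℰ` of `𝒜`: the smallest closed two-sided ideal that contains all
commutators. -/
noncomputable def commIdeal : Ideal cylAlg :=
  sInf {I | I.IsTwoSided ∧ IsClosed (I : Set cylAlg) ∧ ∀ A B : cylAlg, A * B - B * A ∈ I}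

instance commIdeal_twoSided : commIdeal.IsTwoSided where
  mul_mem_of_left := fun {a} b ha => by
    rw [commIdeal, Submodule.mem_sInf] at ha ⊢
    intro I hI
    have := hI.1
    exact Ideal.mul_mem_right b I (ha I hI)

/-- The non-unital algebra `ℰ/𝒦`. -/
noncomputable abbrev commQuot : NonUnitalSubalgebra ℂ (cylAlg ⧸ compactIdeal) :=
  idealAlg (quotIdeal compactIdeal commIdeal)

/-- The connecting map `δ₁ : K₁(𝒜/ℰ) → K₀(ℰ/𝒦)` of the exact sequence
`0 → ℰ/𝒦 → 𝒜/𝒦 → 𝒜/ℰ → 0`. -/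
noncomputable def deltaOne (x : K1 (cylAlg ⧸ commIdeal)) : KZero commQuot :=
  connecting compactIdeal commIdeal x

/-- The algebra of compact operators on `L²(ℤ × S¹)`. -/
def compactZS1 : NonUnitalSubalgebra ℂ (L2ZS1 →L[ℂ] L2ZS1) where
  carrier := {A | IsCompactOperator A}
  add_mem' := fun ha hb => IsCompactOperator.add ha hb
  zero_mem' := isCompactOperator_zero
  mul_mem' := fun {_ b} ha _ => IsCompactOperator.comp_clm ha b
  smul_mem' := fun c _ ha => IsCompactOperator.smul ha c

/-! ### The symbol `γ` -/

/-- The compact space `S¹ × {-1, +1}`. -/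
abbrev Bd : Type := Circle × ℤˣ

/-- The *-homomorphism `γ` has the prescribed values on the generators of `𝒜`. -/
structure IsBoundarySymbol (γ : cylAlg →⋆ₐ[ℂ] C(Bd, L2ZS1 →L[ℂ] L2ZS1)) : Prop where
  mulBeta : ∀ (a : C(Circ, ℂ)) (A : cylAlg), IsSmooth a → (A : L2Cyl →L[ℂ] L2Cyl) = mulBeta a →
    ∀ (z : Circle) (s : ℤˣ), γ A (z, s) = constDiag (circMul a)
  mulT_pos : ∀ (b : C(EReal, ℂ)) (A : cylAlg), (A : L2Cyl →L[ℂ] L2Cyl) = mulT b →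
    ∀ z : Circle, γ A (z, 1) = b ⊤ • ContinuousLinearMap.id ℂ L2ZS1
  mulT_neg : ∀ (b : C(EReal, ℂ)) (A : cylAlg), (A : L2Cyl →L[ℂ] L2Cyl) = mulT b →
    ∀ z : Circle, γ A (z, -1) = b ⊥ • ContinuousLinearMap.id ℂ L2ZS1
  mulExp : ∀ (j : ℤ) (A : cylAlg), (A : L2Cyl →L[ℂ] L2Cyl) = mulExp j →
    ∀ (z : Circle) (s : ℤˣ), γ A (z, s) = yOp (-j)
  lamOp : ∀ (i : Fin 3) (A : cylAlg), (A : L2Cyl →L[ℂ] L2Cyl) = lamOp i →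
    ∀ (φ : ℝ) (s : ℤˣ), γ A (Circle.exp (2 * Real.pi * φ), s) =
      (yOp φ).comp ((shiftedSymbOp i φ).comp (yOp (-φ)))

section FunctionAlgebra

variable (X : Type*) [TopologicalSpace X] {B : Type*} [NormedRing B] [NormedAlgebra ℂ B]
  (S : NonUnitalSubalgebra ℂ B)

/-- The algebra of continuous functions on `X` with values in a subalgebra `S` of a normed
algebra. -/
abbrev FunAlg : Type _ := C(X, S)

noncomputable instance funRing : NonUnitalRing (FunAlg X S) := inferInstance

noncomputable instance funModule : Module ℂ (FunAlg X S) := inferInstance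

instance funTower : IsScalarTower ℂ (FunAlg X S) (FunAlg X S) := inferInstance

instance funComm : SMulCommClass ℂ (FunAlg X S) (FunAlg X S) := inferInstance

end FunctionAlgebra

/-- The algebra `C(S¹ × {-1, +1}, 𝒦)`, with `𝒦` the compact operators on `L²(ℤ × S¹)`. -/
abbrev BdCompact : Type := FunAlg Bd compactZS1

/-- Evaluation at a point of `S¹ × {-1, +1}`. -/
noncomputable def evalAt (x : Bd) : BdCompact →ₙₐ[ℂ] compactZS1 where
  toFun f := f x
  map_smul' _ _ := rfl
  map_zero' := rfl
  map_add' _ _ := rfl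
  map_mul' _ _ := rfl

/-- The map `K₀(ℰ/𝒦) → K₀(C(S¹ × {-1, +1}, 𝒦))` induced by a homomorphism. -/
noncomputable def kMap (Ψ : commQuot →ₙₐ[ℂ] BdCompact) : KZero commQuot →+ KZero BdCompact :=
  KZero.map (J' := BdCompact) Ψ

/-- The map `K₀(C(S¹ × {-1, +1}, 𝒦)) → K₀(𝒦) ⊕ K₀(𝒦)` induced by the evaluations at the points
`(1, -1)` and `(1, +1)`. -/
noncomputable def kEval : KZero BdCompact →+ KZero compactZS1 × KZero compactZS1 :=
  (KZero.map (J := BdCompact) (evalAt (1, -1))).prod (KZero.map (J := BdCompact) (evalAt (1, 1)))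

/-- The index `dim ker T - dim coker T` of a Fredholm operator. -/
noncomputable def fredIndex {H : Type*} [NormedAddCommGroup H] [NormedSpace ℂ H]
    (T : H →L[ℂ] H) : ℤ :=
  (Module.finrank ℂ (T : H →ₗ[ℂ] H).ker : ℤ) -
    (Module.finrank ℂ (H ⧸ (T : H →ₗ[ℂ] H).range) : ℤ)

end CylinderAlgebra

open CylinderAlgebra OpKTheory

/-!
The homomorphism `γ` is obtained from limit operators. For a sign `s` and `φ ∈ ℝ` the isometries
`bloch φ s n` send a sequence `(u_j)_j` in `L²(S¹)` to the wave packet `∑ⱼ e^{i(j-φ)t} u_j`, cut off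
in `t` to an interval of length `2π(n + 1)` that moves to `s∞`, and normalised. Each generator `A`
of the algebra `𝒜` has a limit `B` along these isometries `Vₙ`, in the sense that
`A Vₙ - Vₙ B → 0` strongly: on the distant intervals `b(t)` is nearly constant, multiplication by
`e^{imt}` shifts the index `j`, and after the cut-off is smoothed the Fourier multiplier `lamOp i`,
whose symbol is Lipschitz, acts on the `j`-th summand nearly as `S_i(j - φ)` (`isLimit_mulT`,
`isLimit_mulExp`, `isLimit_lamOp`). Conjugation by `Y_φ` makes the limits periodic in `φ`, hence
functions of `z = e^{2πiφ}` (`lamSymb_periodic`). The pairs consisting of an operator and its family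
of limit operators form a closed *-algebra, and since limits do not increase norms its projection
to the first component is isometric; so the limits exist on all of `𝒜` and define `γ`
(`exists_symbol`, `exists_boundarySymbol`).

The wave packets converge weakly to zero, so `γ` vanishes on compact operators
(`boundarySymbol_compact`). The values of `γ` on the generators commute modulo compact operators:
in the basis `δ_j ⊗ e^{ikβ}` the operators `S_i(j - φ)` are diagonal with symbols that vary slowly
at infinity, so their commutators with shifts of the lattice `ℤ × ℤ` are weighted shifts with
weights tending to zero (`isCompactOperator_commutator`). Hence `γ` maps the commutator ideal to
compact operators (`boundarySymbol_isCompactOperator`). This yields the homomorphism `Ψ`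
(`exists_quotientSymbol`) and, by Atkinson's theorem, the Fredholm property
(`isFredholm_boundarySymbol`).

For the index formula, let `x` be a boundary point and `t = γ_A(x)`. The index class of a unit is
defined from any representative of its class in `K₁` and any invertible lift of `diag(u, u⁻¹)`. Two
representatives differ, after stabilisation, by an invertible matrix that lifts, because the
liftable invertible matrices form an open and hence closed subgroup (`exists_lift_of_k1cls_eq`).
If `s` is a generalised inverse of the Fredholm operator `t`, then the matrix with rows
`(t, 1 - ts)` and `(1 - st, s)` is invertible and lifts `diag(t, t⁻¹)`; with it the index class
becomes `[1 - st] - [1 - ts]` (`index_class_eq`, `map_connecting_k1unit`). These two idempotents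
have the dimensions of the kernel and the cokernel of `t` as their ranks, and a compact idempotent
of rank `r` has the class `r [E]₀` (`k0cls_finiteRank`); the difference is `ind t · [E]₀`
(`map_connecting_eq_fredIndex`, `evalAt_deltaOne`).
-/

section

open Filter Topology

/-! ### Limit operators along a sequence of isometries -/

namespace LimitOperator

variable {H K : Type*} [NormedAddCommGroup H] [InnerProductSpace ℂ H]
  [NormedAddCommGroup K] [InnerProductSpace ℂ K]

/-- The operator `B` is the limit of `A` along the isometries `V n`: the sequence
`A V n - V n B` converges strongly to zero. -/
def IsLimit (V : ℕ → H →ₗᵢ[ℂ] K) (A : K →L[ℂ] K) (B : H →L[ℂ] H) : Prop :=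
  ∀ f, Tendsto (fun n => A (V n f) - V n (B f)) atTop (𝓝 0)

variable {V : ℕ → H →ₗᵢ[ℂ] K} {A A' : K →L[ℂ] K} {B B' : H →L[ℂ] H}

theorem IsLimit.add (h : IsLimit V A B) (h' : IsLimit V A' B') :
    IsLimit V (A + A') (B + B') := fun f => by
  have := (h f).add (h' f)
  rw [add_zero] at this
  refine this.congr fun n => ?_
  simp only [add_apply, map_add]
  abel

theorem IsLimit.smul (c : ℂ) (h : IsLimit V A B) : IsLimit V (c • A) (c • B) := fun f => by
  have := (h f).const_smul c
  rw [smul_zero] at this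
  refine this.congr fun n => ?_
  simp [smul_sub]

theorem IsLimit.sub (h : IsLimit V A B) (h' : IsLimit V A' B') :
    IsLimit V (A - A') (B - B') := by
  simpa [sub_eq_add_neg] using h.add (h'.smul (-1))

theorem IsLimit.one : IsLimit V 1 1 := fun f => by simp

theorem IsLimit.mul (h : IsLimit V A B) (h' : IsLimit V A' B') :
    IsLimit V (A * A') (B * B') := fun f => by
  have := ((A.continuous.tendsto 0).comp (h' f)).add (h (B' f))
  rw [map_zero, add_zero] at this
  refine this.congr fun n => ?_
  simp

theorem IsLimit.norm_le (h : IsLimit V A B) : ‖B‖ ≤ ‖A‖ := by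
  refine B.opNorm_le_bound (norm_nonneg _) fun f => ?_
  have h1 : Tendsto (fun n => ‖A (V n f) - V n (B f)‖ + ‖A‖ * ‖f‖) atTop (𝓝 (‖A‖ * ‖f‖)) := by
    simpa using (h f).norm.add_const (‖A‖ * ‖f‖)
  refine ge_of_tendsto' h1 fun n => ?_
  have h2 : ‖B f‖ = ‖V n (B f)‖ := ((V n).norm_map _).symm
  have h3 : ‖A (V n f)‖ ≤ ‖A‖ * ‖f‖ := by
    simpa using A.le_opNorm (V n f)
  have h4 := norm_sub_norm_le (V n (B f)) (A (V n f))
  rw [norm_sub_rev] at h4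
  linarith

theorem IsLimit.unique (h : IsLimit V A B) (h' : IsLimit V A B') : B = B' := by
  have := (h.sub h').norm_le
  rw [sub_self, norm_zero] at this
  exact sub_eq_zero.1 (norm_le_zero_iff.1 this)

/-- The operators `V n` being isometries, limits along them persist under norm limits: a three-`ε`
argument. -/
theorem isClosed_isLimit (V : ℕ → H →ₗᵢ[ℂ] K) :
    IsClosed {p : (K →L[ℂ] K) × (H →L[ℂ] H) | IsLimit V p.1 p.2} := by
  refine isClosed_of_closure_subset fun p hp f => ?_
  rw [Metric.tendsto_atTop]
  intro ε hε
  obtain ⟨q, hq, hpq⟩ := Metric.mem_closure_iff.1 hp (ε / (3 * (‖f‖ + 1))) (by positivity)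
  obtain ⟨N, hN⟩ := Metric.tendsto_atTop.1 (hq f) (ε / 3) (by positivity)
  refine ⟨N, fun n hn => ?_⟩
  have h0 := hN n hn
  rw [dist_zero_right] at h0 ⊢
  have hf : ε / (3 * (‖f‖ + 1)) * ‖f‖ ≤ ε / 3 := by
    rw [div_mul_eq_mul_div, div_le_div_iff₀ (by positivity) (by positivity)]
    nlinarith [norm_nonneg f]
  have h1 : ‖(p.1 - q.1) (V n f)‖ ≤ ε / 3 := by
    refine ((p.1 - q.1).le_opNorm _).trans (le_trans ?_ hf)
    rw [LinearIsometry.norm_map, ← dist_eq_norm]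
    exact mul_le_mul_of_nonneg_right ((le_max_left _ _).trans hpq.le) (norm_nonneg _)
  have h2 : ‖V n ((p.2 - q.2) f)‖ ≤ ε / 3 := by
    rw [LinearIsometry.norm_map]
    refine ((p.2 - q.2).le_opNorm _).trans (le_trans ?_ hf)
    rw [← dist_eq_norm]
    exact mul_le_mul_of_nonneg_right ((le_max_right _ _).trans hpq.le) (norm_nonneg _)
  have h3 : p.1 (V n f) - V n (p.2 f) =
      (p.1 - q.1) (V n f) + (q.1 (V n f) - V n (q.2 f)) - V n ((p.2 - q.2) f) := by
    simp
  rw [h3]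
  have := norm_sub_le ((p.1 - q.1) (V n f) + (q.1 (V n f) - V n (q.2 f))) (V n ((p.2 - q.2) f))
  have := norm_add_le ((p.1 - q.1) (V n f)) (q.1 (V n f) - V n (q.2 f))
  linarith

/-- A bounded sequence of operators that converges to zero on a total set converges strongly to
zero. -/
theorem tendsto_zero_of_dense {E F : Type*} [NormedAddCommGroup E] [NormedSpace ℂ E]
    [NormedAddCommGroup F] [NormedSpace ℂ F] {T : ℕ → E →L[ℂ] F} {C : ℝ} (hT : ∀ n, ‖T n‖ ≤ C)
    {s : Set E} (hs : Dense (Submodule.span ℂ s : Set E))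
    (h : ∀ f ∈ s, Tendsto (fun n => T n f) atTop (𝓝 0)) (f : E) :
    Tendsto (fun n => T n f) atTop (𝓝 0) := by
  have hspan : ∀ f ∈ Submodule.span ℂ s, Tendsto (fun n => T n f) atTop (𝓝 0) := by
    intro f hf
    induction hf using Submodule.span_induction with
    | mem f hf => exact h f hf
    | zero => simp
    | add f g _ _ hf hg => simpa using hf.add hg
    | smul c f _ hf => simpa using hf.const_smul c
  have hC : 0 ≤ C := (norm_nonneg _).trans (hT 0)
  rw [Metric.tendsto_atTop]
  intro ε hε
  obtain ⟨g, hg, hfg⟩ := Metric.mem_closure_iff.1 (hs f) (ε / (2 * (C + 1))) (by positivity)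
  obtain ⟨N, hN⟩ := Metric.tendsto_atTop.1 (hspan g hg) (ε / 2) (by positivity)
  refine ⟨N, fun n hn => ?_⟩
  have h0 := hN n hn
  rw [dist_zero_right] at h0 ⊢
  have h1 : ‖T n (f - g)‖ ≤ C * ‖f - g‖ := (T n).le_of_opNorm_le (hT n) _
  have h3 : (C + 1) * ‖f - g‖ < ε / 2 := by
    rw [dist_eq_norm, lt_div_iff₀ (by positivity)] at hfg
    linarith
  have h4 : T n f = T n (f - g) + T n g := by simp
  rw [h4]
  have := norm_add_le (T n (f - g)) (T n g)
  nlinarith [norm_nonneg (f - g)]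

/-- It suffices to test the limit on a total set of vectors. -/
theorem isLimit_of_dense {s : Set H} (hs : Dense (Submodule.span ℂ s : Set H))
    (h : ∀ f ∈ s, Tendsto (fun n => A (V n f) - V n (B f)) atTop (𝓝 0)) : IsLimit V A B := by
  refine tendsto_zero_of_dense (C := ‖A‖ + ‖B‖)
    (T := fun n => A.comp (V n).toContinuousLinearMap - (V n).toContinuousLinearMap.comp B)
    (fun n => ?_) hs h
  refine ContinuousLinearMap.opNorm_le_bound _ (by positivity) fun f => ?_
  refine (norm_sub_le _ _).trans ?_
  rw [add_mul]
  refine add_le_add ((A.le_opNorm _).trans_eq ?_) ?_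
  · exact congrArg (‖A‖ * ·) ((V n).norm_map f)
  · exact ((V n).norm_map _).trans_le (B.le_opNorm _)

variable [CompleteSpace K]

/-- A compact operator has the limit zero along isometries that converge weakly to zero. -/
theorem IsLimit.eq_zero_of_isCompactOperator (h : IsLimit V A B) (hA : IsCompactOperator A)
    (hV : ∀ f g, Tendsto (fun n => inner ℂ (V n f) g) atTop (𝓝 0)) : B = 0 := by
  refine ContinuousLinearMap.ext fun f => ?_
  have h0 : Tendsto (fun n => A (V n f)) atTop (𝓝 0) := by
    obtain ⟨C, hC, hAC⟩ := hA.image_closedBall_subset_compact (f := (A : K →ₗ[ℂ] K)) ‖f‖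
    -- every cluster point of the relatively compact sequence `A (V n f)` is also its weak limit,
    -- which is zero
    refine hC.tendsto_nhds_of_unique_mapClusterPt
      (Eventually.of_forall fun n => hAC ⟨V n f, by simp, rfl⟩) fun y _ hy => ?_
    refine ext_inner_right ℂ fun g => ?_
    rw [inner_zero_left]
    have h1 : Tendsto (fun n => inner ℂ (A (V n f)) g) atTop (𝓝 0) := by
      simpa only [ContinuousLinearMap.adjoint_inner_right] using
        hV f (ContinuousLinearMap.adjoint A g)
    have h2 : MapClusterPt (inner ℂ y g) atTop (fun n => inner ℂ (A (V n f)) g) :=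
      hy.continuousAt_comp (f := fun y : K => (inner ℂ y g : ℂ))
        (by fun_prop : Continuous fun y : K => (inner ℂ y g : ℂ)).continuousAt
    exact (eq_of_nhds_neBot (h2.clusterPt.mono h1)).symm ▸ rfl
  have h1 := (h f).sub h0
  rw [sub_zero] at h1
  have h2 : Tendsto (fun _ : ℕ => ‖B f‖) atTop (𝓝 0) := by
    simpa using h1.norm
  simpa using tendsto_nhds_unique tendsto_const_nhds h2

variable [CompleteSpace H]

/-- If both `A` and its adjoint have limits, these are adjoint to each other. -/
theorem IsLimit.star_eq (h : IsLimit V A B) (h' : IsLimit V (star A) B') : B' = star B := by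
  refine ContinuousLinearMap.ext fun f => ext_inner_right ℂ fun g => ?_
  rw [ContinuousLinearMap.star_eq_adjoint, ContinuousLinearMap.adjoint_inner_left]
  have h1 : Tendsto (fun n => inner ℂ (star A (V n f) - V n (B' f)) (V n g) -
      inner ℂ (V n f) (A (V n g) - V n (B g))) atTop (𝓝 0) := by
    refine squeeze_zero_norm (a := fun n => ‖star A (V n f) - V n (B' f)‖ * ‖g‖ +
      ‖f‖ * ‖A (V n g) - V n (B g)‖) (fun n => ?_) ?_
    · refine (norm_sub_le _ _).trans (add_le_add ?_ ?_)
      · rw [← (V n).norm_map g]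
        exact norm_inner_le_norm _ _
      · rw [← (V n).norm_map f]
        exact norm_inner_le_norm _ _
    · simpa using ((h' f).norm.mul_const ‖g‖).add ((h g).norm.const_mul ‖f‖)
  have h2 : ∀ n, inner ℂ (star A (V n f) - V n (B' f)) (V n g) -
      inner ℂ (V n f) (A (V n g) - V n (B g)) = inner ℂ f (B g) - inner ℂ (B' f) g := fun n => by
    rw [inner_sub_left, inner_sub_right, ContinuousLinearMap.star_eq_adjoint,
      ContinuousLinearMap.adjoint_inner_left, LinearIsometry.inner_map_map,
      LinearIsometry.inner_map_map]
    ring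
  simp only [h2] at h1
  exact (sub_eq_zero.1 (tendsto_nhds_unique tendsto_const_nhds h1)).symm

variable {X : Type*} [TopologicalSpace X] [CompactSpace X]

/-- The pairs `(A, B)` of an operator `A` and a continuous family `B` of limit operators of `A`
along the isometries `V x n`, such that the adjoints are limits of the adjoint of `A`. -/
def symbolGraph (V : X → ℕ → H →ₗᵢ[ℂ] K) :
    StarSubalgebra ℂ ((K →L[ℂ] K) × C(X, H →L[ℂ] H)) where
  carrier := {p | ∀ x, IsLimit (V x) p.1 (p.2 x) ∧ IsLimit (V x) (star p.1) (star (p.2 x))}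
  mul_mem' {p q} hp hq x := ⟨(hp x).1.mul (hq x).1, by
    simpa only [Prod.fst_mul, Prod.snd_mul, ContinuousMap.mul_apply, star_mul] using
      (hq x).2.mul (hp x).2⟩
  add_mem' {p q} hp hq x := ⟨(hp x).1.add (hq x).1, by
    simpa only [Prod.fst_add, Prod.snd_add, ContinuousMap.add_apply, star_add] using
      (hp x).2.add (hq x).2⟩
  algebraMap_mem' c x := by
    have h : ∀ c : ℂ, IsLimit (V x) (algebraMap ℂ (K →L[ℂ] K) c) (algebraMap ℂ (H →L[ℂ] H) c) :=
      fun c => by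
        simp only [Algebra.algebraMap_eq_smul_one]
        exact IsLimit.one.smul c
    refine ⟨h c, ?_⟩
    have := h (star c)
    simp only [algebraMap_star_comm] at this
    exact this
  star_mem' {p} hp x := ⟨(hp x).2, by
    simpa using (hp x).1⟩

theorem mem_symbolGraph {V : X → ℕ → H →ₗᵢ[ℂ] K} {p : (K →L[ℂ] K) × C(X, H →L[ℂ] H)} :
    p ∈ symbolGraph V ↔
      ∀ x, IsLimit (V x) p.1 (p.2 x) ∧ IsLimit (V x) (star p.1) (star (p.2 x)) := Iff.rfl

theorem isClosed_symbolGraph (V : X → ℕ → H →ₗᵢ[ℂ] K) :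
    IsClosed (symbolGraph V : Set ((K →L[ℂ] K) × C(X, H →L[ℂ] H))) := by
  have : (symbolGraph V : Set ((K →L[ℂ] K) × C(X, H →L[ℂ] H))) =
      ⋂ x, ((fun p => (p.1, p.2 x)) ⁻¹' {q | IsLimit (V x) q.1 q.2} ∩
        (fun p => (star p.1, star (p.2 x))) ⁻¹' {q | IsLimit (V x) q.1 q.2}) := by
    ext p
    simp [mem_symbolGraph]
  rw [this]
  have hev : ∀ x : X, Continuous fun p : (K →L[ℂ] K) × C(X, H →L[ℂ] H) => p.2 x := fun x =>
    (continuous_eval_const x).comp continuous_snd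
  exact isClosed_iInter fun x => ((isClosed_isLimit (V x)).preimage
    (continuous_fst.prodMk (hev x))).inter
    ((isClosed_isLimit (V x)).preimage (continuous_fst.star.prodMk (hev x).star))

/-- Passing to the limit does not increase the norm. This is what makes the graph isometric to its
first projection. -/
theorem norm_snd_le {V : X → ℕ → H →ₗᵢ[ℂ] K} {p : (K →L[ℂ] K) × C(X, H →L[ℂ] H)}
    (hp : p ∈ symbolGraph V) : ‖p.2‖ ≤ ‖p.1‖ :=
  (ContinuousMap.norm_le _ (norm_nonneg _)).2 fun x => (hp x).1.norm_le

theorem symbolGraph_unique {V : X → ℕ → H →ₗᵢ[ℂ] K} {A : K →L[ℂ] K} {B B' : C(X, H →L[ℂ] H)}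
    (h : (A, B) ∈ symbolGraph V) (h' : (A, B') ∈ symbolGraph V) : B = B' :=
  ContinuousMap.ext fun x => (h x).1.unique (h' x).1

/-- The projection of the graph onto its first component. -/
noncomputable def graphFst (V : X → ℕ → H →ₗᵢ[ℂ] K) : symbolGraph V →⋆ₐ[ℂ] (K →L[ℂ] K) :=
  (StarAlgHom.fst ℂ _ _).comp (symbolGraph V).subtype

theorem isometry_graphFst (V : X → ℕ → H →ₗᵢ[ℂ] K) : Isometry (graphFst V) :=
  Isometry.of_dist_eq fun p q => by
    have h := norm_snd_le (sub_mem p.2 q.2)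
    simp only [Prod.snd_sub, Prod.fst_sub, ← dist_eq_norm] at h
    exact (max_eq_left h).symm

theorem injective_graphFst (V : X → ℕ → H →ₗᵢ[ℂ] K) : Function.Injective (graphFst V) :=
  (isometry_graphFst V).injective

theorem isClosed_range_graphFst (V : X → ℕ → H →ₗᵢ[ℂ] K) :
    IsClosed ((graphFst V).range : Set (K →L[ℂ] K)) := by
  have : CompleteSpace (symbolGraph V) := (isClosed_symbolGraph V).completeSpace_coe
  exact (isometry_graphFst V).isClosedEmbedding.isClosed_range

/-- If every generator of a C*-algebra has a continuous family of limit operators, the limits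
define a *-homomorphism on the whole algebra. -/
theorem exists_symbol (V : X → ℕ → H →ₗᵢ[ℂ] K) (s : Set (K →L[ℂ] K))
    (hs : ∀ A ∈ s, ∃ B, (A, B) ∈ symbolGraph V) :
    ∃ γ : (StarAlgebra.adjoin ℂ s).topologicalClosure →⋆ₐ[ℂ] C(X, H →L[ℂ] H),
      ∀ A : (StarAlgebra.adjoin ℂ s).topologicalClosure,
        ((A : K →L[ℂ] K), γ A) ∈ symbolGraph V := by
  have hle : (StarAlgebra.adjoin ℂ s).topologicalClosure ≤ (graphFst V).range := by
    refine StarSubalgebra.topologicalClosure_minimal (StarAlgebra.adjoin_le fun A hA => ?_)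
      (isClosed_range_graphFst V)
    obtain ⟨B, hB⟩ := hs A hA
    exact ⟨⟨(A, B), hB⟩, rfl⟩
  -- the isometric image of the complete graph is closed and contains the generators, hence the
  -- whole algebra
  let e := StarAlgEquiv.ofInjective (graphFst V) (injective_graphFst V)
  refine ⟨((StarAlgHom.snd ℂ _ _).comp (symbolGraph V).subtype).comp
    ((e.symm : (graphFst V).range →⋆ₐ[ℂ] symbolGraph V).comp (StarSubalgebra.inclusion hle)),
    fun A => ?_⟩
  have h1 : graphFst V (e.symm (StarSubalgebra.inclusion hle A)) = A :=
    congrArg Subtype.val (e.apply_symm_apply (StarSubalgebra.inclusion hle A))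
  have h2 := (e.symm (StarSubalgebra.inclusion hle A)).2
  have h3 : (e.symm (StarSubalgebra.inclusion hle A)).1 =
    ((A : K →L[ℂ] K), (e.symm (StarSubalgebra.inclusion hle A)).1.2) := Prod.ext h1 rfl
  rw [h3] at h2
  exact h2

end LimitOperator

end

section

open Filter Topology MeasureTheory CylinderAlgebra
open scoped FourierTransform SchwartzMap

/-! ### Elementary tensors in vector-valued `L²` spaces -/

namespace CylinderAlgebra

section Tensor

variable {X : Type*} [MeasurableSpace X] {μ : Measure X} {E : Type*} [NormedAddCommGroup E]
  [InnerProductSpace ℂ E]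

/-- The elementary tensor `x ↦ g(x) v` in `L²(X, E)`. -/
noncomputable def tens (g : Lp ℂ 2 μ) (v : E) : Lp E 2 μ :=
  (ContinuousLinearMap.toSpanSingleton ℂ v).compLp g

theorem tens_coeFn (g : Lp ℂ 2 μ) (v : E) : tens g v =ᵐ[μ] fun x => g x • v := by
  filter_upwards [(ContinuousLinearMap.toSpanSingleton ℂ v).coeFn_compLp g] with x hx
  exact hx

theorem inner_tens (g h : Lp ℂ 2 μ) (v w : E) :
    inner ℂ (tens g v) (tens h w) = inner ℂ g h * inner ℂ v w := by
  rw [L2.inner_def, L2.inner_def, ← integral_mul_const]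
  refine integral_congr_ae ?_
  filter_upwards [tens_coeFn g v, tens_coeFn h w] with x h1 h2
  rw [h1, h2, inner_smul_left, inner_smul_right]
  simp only [RCLike.inner_apply]
  ring

theorem norm_tens (g : Lp ℂ 2 μ) (v : E) : ‖tens g v‖ = ‖g‖ * ‖v‖ := by
  have h := inner_tens g g v v
  rw [inner_self_eq_norm_sq_to_K, inner_self_eq_norm_sq_to_K, inner_self_eq_norm_sq_to_K,
    ← mul_pow] at h
  have h' : ‖tens g v‖ ^ 2 = (‖g‖ * ‖v‖) ^ 2 := by exact_mod_cast h
  exact (sq_eq_sq₀ (norm_nonneg _) (by positivity)).1 h'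

theorem tens_add (g : Lp ℂ 2 μ) (v w : E) : tens g (v + w) = tens g v + tens g w := by
  refine Lp.ext ?_
  filter_upwards [tens_coeFn g (v + w), tens_coeFn g v, tens_coeFn g w,
    Lp.coeFn_add (tens g v) (tens g w)] with x h1 h2 h3 h4
  rw [h1, h4, Pi.add_apply, h2, h3, smul_add]

theorem tens_smul (g : Lp ℂ 2 μ) (c : ℂ) (v : E) : tens g (c • v) = c • tens g v := by
  refine Lp.ext ?_
  filter_upwards [tens_coeFn g (c • v), tens_coeFn g v, Lp.coeFn_smul c (tens g v)] with x h1 h2 h4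
  rw [h1, h4, Pi.smul_apply, h2, smul_comm]

theorem sub_tens (g h : Lp ℂ 2 μ) (v : E) : tens (g - h) v = tens g v - tens h v :=
  ((ContinuousLinearMap.toSpanSingleton ℂ v).compLpL 2 μ).map_sub g h

theorem smul_tens (c : ℂ) (g : Lp ℂ 2 μ) (v : E) : tens (c • g) v = c • tens g v :=
  ((ContinuousLinearMap.toSpanSingleton ℂ v).compLpL 2 μ).map_smul c g

theorem continuous_tens (v : E) : Continuous fun g : Lp ℂ 2 μ => tens g v :=
  ((ContinuousLinearMap.toSpanSingleton ℂ v).compLpL 2 μ).continuous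

theorem smulOp_tens {b : X → ℂ} (hb : MemLp b ⊤ μ) (g : Lp ℂ 2 μ) (v : E) :
    smulOp μ b hb (tens g v) = tens (smulOp μ b hb g) v := by
  refine Lp.ext ?_
  filter_upwards [smulOp_coeFn μ b hb (tens g v), tens_coeFn g v,
    tens_coeFn (smulOp μ b hb g) v, smulOp_coeFn μ b hb g] with x h1 h2 h3 h4
  rw [h1, h2, h3, h4, smul_assoc]

theorem compLpL_tens (T : E →L[ℂ] E) (g : Lp ℂ 2 μ) (v : E) :
    T.compLpL 2 μ (tens g v) = tens g (T v) := by
  refine Lp.ext ?_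
  filter_upwards [T.coeFn_compLpL (tens g v), tens_coeFn g v, tens_coeFn g (T v)] with x h1 h2 h3
  rw [h1, h2, h3, map_smul]

/-- The map `v ↦ g v` as an isometric embedding, for a unit vector `g`. -/
noncomputable def tensEmb (g : Lp ℂ 2 μ) (hg : ‖g‖ = 1) : E →ₗᵢ[ℂ] Lp E 2 μ where
  toFun := tens g
  map_add' := tens_add g
  map_smul' := tens_smul g
  norm_map' v := (norm_tens g v).trans (by rw [hg, one_mul])

theorem tensEmb_orthogonal {ι : Type*} {g : ι → Lp ℂ 2 μ} (hg : Orthonormal ℂ g) :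
    OrthogonalFamily ℂ (fun _ : ι => E) fun j => tensEmb (g j) (hg.1 j) := fun i j hij v w => by
  refine (inner_tens (g i) (g j) v w).trans ?_
  rw [hg.2 hij, zero_mul]

theorem mulOp_coeFn {B : X → E →L[ℂ] E} (hB : MemLp B ⊤ μ) (f : Lp E 2 μ) :
    mulOp μ B hB f =ᵐ[μ] fun x => B x (f x) := by
  refine (ContinuousLinearMap.coeFn_holder (r := 2) _ (hB.toLp B) f).trans ?_
  filter_upwards [hB.coeFn_toLp] with x hx
  simp [hx]

/-- An `L²` function bounded by `c` and supported in a set of measure at most `2`. -/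
theorem norm_le_of_support {f : Lp ℂ 2 μ} {S : Set X} (hS : MeasurableSet S) (hμ : μ S ≤ 2)
    {c : ℝ} (hc : 0 ≤ c) (h : ∀ᵐ x ∂μ, ‖f x‖ ≤ S.indicator (fun _ => c) x) : ‖f‖ ≤ 2 * c := by
  have hfin : μ S ≠ ⊤ := (hμ.trans_lt (by simp)).ne
  have h1 : ‖f‖ ≤ c * ‖indicatorConstLp 2 hS hfin (1 : ℂ)‖ := by
    refine Lp.norm_le_mul_norm_of_ae_le_mul ?_
    filter_upwards [h, indicatorConstLp_coeFn (p := 2) (hs := hS) (hμs := hfin) (c := (1 : ℂ))]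
      with x h1 h2
    rw [h2]
    by_cases hx : x ∈ S
    · simpa [hx] using h1
    · simpa [hx] using h1
  have h2 : ‖indicatorConstLp 2 hS hfin (1 : ℂ)‖ ≤ 2 := by
    rw [norm_indicatorConstLp (by simp) (by simp)]
    have h3 : μ.real S ≤ 2 := ENNReal.toReal_le_of_le_ofReal (by norm_num) (by simpa using hμ)
    have h4 : μ.real S ^ (1 / (2 : ENNReal).toReal) ≤ 2 ^ (1 : ℝ) :=
      (Real.rpow_le_rpow measureReal_nonneg h3 (by simp)).trans
        (Real.rpow_le_rpow_of_exponent_le (by norm_num) (by norm_num))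
    simpa using h4
  nlinarith

end Tensor

/-! ### The Fourier transform of elementary tensors -/

/-- The vector-valued Fourier transform acts on the scalar factor; checked on Schwartz functions
and extended by density. -/
theorem fourier_tens {E : Type*} [NormedAddCommGroup E] [InnerProductSpace ℂ E] [CompleteSpace E]
    (g : Lp ℂ 2 (volume : Measure ℝ)) (v : E) :
    𝓕 (tens g v) = tens (𝓕 g) v := by
  refine DenseRange.induction_on (p := fun g => 𝓕 (tens g v) = tens (𝓕 g) v)
    (SchwartzMap.denseRange_toLpCLM (F := ℂ) (E := ℝ) (μ := volume) (p := 2)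
      ENNReal.ofNat_ne_top) g ?_ ?_
  · exact isClosed_eq ((Lp.fourierTransformₗᵢ ℝ E).continuous.comp (continuous_tens v))
      ((continuous_tens v).comp (Lp.fourierTransformₗᵢ ℝ ℂ).continuous)
  · intro ψ
    let T : ℂ →L[ℂ] E := ContinuousLinearMap.toSpanSingleton ℂ v
    let ψv : 𝓢(ℝ, E) := SchwartzMap.postcompCLM (𝕜 := ℂ) T ψ
    have h1 : tens (ψ.toLp 2) v = ψv.toLp 2 := by
      refine Lp.ext ?_
      filter_upwards [tens_coeFn (ψ.toLp 2 (volume : Measure ℝ)) v, ψ.coeFn_toLp 2,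
        ψv.coeFn_toLp 2] with x h1 h2 h3
      rw [h1, h2, h3]
      rfl
    change 𝓕 (tens (ψ.toLp 2) v) = tens (𝓕 (ψ.toLp 2)) v
    have h0 : 𝓕 (ψv.toLp 2) = (𝓕 ψv).toLp 2 := SchwartzMap.toLp_fourier_eq ψv
    rw [h1, h0, SchwartzMap.toLp_fourier_eq]
    refine Lp.ext ?_
    filter_upwards [tens_coeFn ((𝓕 ψ).toLp 2 (volume : Measure ℝ)) v, (𝓕 ψ).coeFn_toLp 2,
      (𝓕 ψv).coeFn_toLp 2] with x h1 h2 h3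
    rw [h1, h2, h3, SchwartzMap.fourier_coe, SchwartzMap.fourier_coe, Real.fourier_eq,
      Real.fourier_eq, ← integral_smul_const]
    refine integral_congr_ae (ae_of_all _ fun t => ?_)
    simp only [smul_assoc]
    rfl

/-- The symbols are Lipschitz in the covariable `τ`, uniformly in the Fourier modes. -/
theorem norm_symbOp_sub_le (i : Fin 3) (τ σ : ℝ) : ‖symbOp i τ - symbOp i σ‖ ≤ 2 * |τ - σ| := by
  have h : symbOp i τ - symbOp i σ = circMult (symbSeq i τ - symbSeq i σ) := by
    unfold symbOp circMult
    rw [map_sub, map_sub]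
  rw [h]
  refine (norm_circMult_le _).trans (lp.norm_le_of_forall_le (by positivity) fun k => ?_)
  have : (symbSeq i τ - symbSeq i σ) k = ((symb i τ k - symb i σ k : ℝ) : ℂ) := by
    rw [Complex.ofReal_sub]
    rfl
  rw [this, Complex.norm_real]
  exact abs_symb_sub_le i τ σ k

theorem memLp_symbOp (i : Fin 3) :
    MemLp (fun ξ : ℝ => symbOp i (2 * Real.pi * ξ)) ⊤ (volume : Measure ℝ) :=
  memLp_top_of_bound ((continuous_symbOp i).comp (continuous_const_mul _)).aestronglyMeasurable 1
    (ae_of_all _ fun _ => norm_symbOp_le i _)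

theorem fourier_lamOp (i : Fin 3) (f : L2Cyl) : 𝓕 (lamOp i f) =
    mulOp volume (fun ξ : ℝ => symbOp i (2 * Real.pi * ξ)) (memLp_symbOp i) (𝓕 f) :=
  (Lp.fourierTransformₗᵢ ℝ L2S1).apply_symm_apply _

/-- The symbols being Lipschitz, `lamOp i` acts on a wave packet with frequencies near `τ` almost
as the operator `symbOp i τ`: the error is controlled by `(1/i) ψ' - τ ψ`. -/
theorem norm_lamOp_tens_sub_le (i : Fin 3) (τ : ℝ) (ψ : 𝓢(ℝ, ℂ)) (v : L2S1) :
    ‖lamOp i (tens (ψ.toLp 2 volume) v) - tens (ψ.toLp 2 volume) (symbOp i τ v)‖ ≤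
      2 * ‖v‖ * ‖((-Complex.I) • SchwartzMap.derivCLM ℂ ℂ ψ - (τ : ℂ) • ψ).toLp 2 volume‖ := by
  set χ : 𝓢(ℝ, ℂ) := (-Complex.I) • SchwartzMap.derivCLM ℂ ℂ ψ - (τ : ℂ) • ψ with hχ
  have hn : ‖χ.toLp 2 volume‖ = ‖(𝓕 χ).toLp 2 volume‖ := by
    rw [← SchwartzMap.toLp_fourier_eq, Lp.norm_fourier_eq]
  have hsub : ∀ f g : L2Cyl, 𝓕 (f - g) = 𝓕 f - 𝓕 g := (Lp.fourierTransformₗᵢ ℝ L2S1).map_sub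
  rw [← Lp.norm_fourier_eq (lamOp i _ - _), hsub, fourier_lamOp, fourier_tens, fourier_tens, hn,
    SchwartzMap.toLp_fourier_eq]
  refine Lp.norm_le_mul_norm_of_ae_le_mul ?_
  -- under the Fourier transform, the defect `χ` of `ψ` as an eigenfunction becomes the factor
  -- by which the symbol may change
  have key : ∀ ξ, (𝓕 χ) ξ = ((2 * Real.pi * ξ - τ : ℝ) : ℂ) * (𝓕 ψ) ξ := by
    intro ξ
    have h1 : 𝓕 χ = (-Complex.I) • 𝓕 (SchwartzMap.derivCLM ℂ ℂ ψ) - (τ : ℂ) • 𝓕 ψ := by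
      have hs : ∀ f g : 𝓢(ℝ, ℂ), 𝓕 (f - g) = 𝓕 f - 𝓕 g :=
        (FourierTransform.fourierCLM ℂ 𝓢(ℝ, ℂ)).map_sub
      rw [hχ, hs, FourierTransform.fourier_smul, FourierTransform.fourier_smul]
    have h2 : 𝓕 (SchwartzMap.derivCLM ℂ ℂ ψ) ξ = (2 * Real.pi * Complex.I * ξ) • (𝓕 ψ) ξ := by
      rw [SchwartzMap.fourier_coe, SchwartzMap.fourier_coe]
      exact congrFun (Real.fourier_deriv ψ.integrable ψ.differentiable
        (SchwartzMap.derivCLM ℂ ℂ ψ).integrable) ξ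
    rw [h1, _root_.sub_apply, _root_.smul_apply, _root_.smul_apply, h2]
    simp only [smul_eq_mul]
    push_cast
    linear_combination (-2 * Real.pi * ξ * (𝓕 ψ) ξ : ℂ) * Complex.I_sq
  filter_upwards [Lp.coeFn_sub (mulOp volume (fun ξ : ℝ => symbOp i (2 * Real.pi * ξ))
      (memLp_symbOp i) (tens ((𝓕 ψ).toLp 2) v))
      (tens ((𝓕 ψ).toLp 2) (symbOp i τ v)),
    mulOp_coeFn (memLp_symbOp i) (tens ((𝓕 ψ).toLp 2) v),
    tens_coeFn ((𝓕 ψ).toLp 2 (volume : Measure ℝ)) v,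
    tens_coeFn ((𝓕 ψ).toLp 2 (volume : Measure ℝ)) (symbOp i τ v), (𝓕 ψ).coeFn_toLp 2,
    (𝓕 χ).coeFn_toLp 2] with ξ h1 h2 h3 h4 h5 h6
  rw [h1, Pi.sub_apply, h2, h4, h6, h3, h5, key, map_smul, ← smul_sub, norm_smul, norm_mul,
    Complex.norm_real, Real.norm_eq_abs]
  have := (symbOp i (2 * Real.pi * ξ) - symbOp i τ).le_of_opNorm_le (norm_symbOp_sub_le i _ _) v
  calc ‖(𝓕 ψ) ξ‖ * ‖symbOp i (2 * Real.pi * ξ) v - symbOp i τ v‖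
      ≤ ‖(𝓕 ψ) ξ‖ * (2 * |2 * Real.pi * ξ - τ| * ‖v‖) :=
        mul_le_mul_of_nonneg_left this (norm_nonneg _)
    _ = 2 * ‖v‖ * (|2 * Real.pi * ξ - τ| * ‖(𝓕 ψ) ξ‖) := by ring

/-! ### Bloch wave packets -/

/-- The wave `e^{iτt}` cut off to the interval `(a, a + 2πN]` and normalised. -/
noncomputable def waveFun (a : ℝ) (N : ℕ) (τ : ℝ) : ℝ → ℂ :=
  (Set.Ioc a (a + 2 * Real.pi * N)).indicator fun t =>
    ((√(2 * Real.pi * N))⁻¹ : ℝ) * Complex.exp (Complex.I * τ * t)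

theorem norm_exp_wave (τ t : ℝ) : ‖Complex.exp (Complex.I * τ * t)‖ = 1 := by
  rw [Complex.norm_exp]
  simp

theorem memLp_waveFun (a : ℝ) (N : ℕ) (τ : ℝ) : MemLp (waveFun a N τ) 2 (volume : Measure ℝ) := by
  refine (memLp_indicator_iff_restrict measurableSet_Ioc).2 ?_
  refine MemLp.of_bound (by fun_prop) ((√(2 * Real.pi * N))⁻¹) (ae_of_all _ fun t => ?_)
  rw [norm_mul, norm_exp_wave, mul_one, Complex.norm_real, Real.norm_of_nonneg (by positivity)]

/-- The class of `waveFun a N τ` in `L²(ℝ)`. -/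
noncomputable def wave (a : ℝ) (N : ℕ) (τ : ℝ) : Lp ℂ 2 (volume : Measure ℝ) :=
  (memLp_waveFun a N τ).toLp _

theorem wave_coeFn (a : ℝ) (N : ℕ) (τ : ℝ) : wave a N τ =ᵐ[volume] waveFun a N τ :=
  MemLp.coeFn_toLp _

theorem integral_exp_period (a : ℝ) (N : ℕ) (m : ℤ) (hm : m ≠ 0) :
    ∫ t in a..(a + 2 * Real.pi * N), Complex.exp (Complex.I * m * t) = 0 := by
  rw [integral_exp_mul_complex (by simpa using hm)]
  have : Complex.exp (Complex.I * m * ((a + 2 * Real.pi * N : ℝ) : ℂ)) =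
      Complex.exp (Complex.I * m * a) := by
    rw [Complex.exp_eq_exp_iff_exists_int]
    exact ⟨m * N, by push_cast; ring⟩
  rw [this, sub_self, zero_div]

/-- The frequencies `j - φ` differ by integers and the interval has a length that is a multiple of
`2π`; hence the waves are orthonormal. -/
theorem inner_wave (a : ℝ) (N : ℕ) (hN : 0 < N) (φ : ℝ) (l m : ℤ) :
    inner ℂ (wave a N (l - φ)) (wave a N (m - φ)) = if l = m then 1 else 0 := by
  have hp : 0 < 2 * Real.pi * N := by positivity
  have h : ∀ᵐ t, inner ℂ (wave a N (l - φ) t) (wave a N (m - φ) t) =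
      (Set.Ioc a (a + 2 * Real.pi * N)).indicator
        (fun t : ℝ => ((2 * Real.pi * N)⁻¹ : ℂ) *
          Complex.exp (Complex.I * ((m - l : ℤ) : ℂ) * t)) t := by
    filter_upwards [wave_coeFn a N (l - φ), wave_coeFn a N (m - φ)] with t h1 h2
    rw [h1, h2, waveFun, waveFun]
    by_cases ht : t ∈ Set.Ioc a (a + 2 * Real.pi * N)
    · simp only [Set.indicator_of_mem ht, RCLike.inner_apply, map_mul, Complex.conj_ofReal,
        ← Complex.exp_conj]
      have hs : (((√(2 * Real.pi * N))⁻¹ : ℝ) : ℂ) * (((√(2 * Real.pi * N))⁻¹ : ℝ) : ℂ) =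
          ((2 * Real.pi * N)⁻¹ : ℂ) := by
        rw [← Complex.ofReal_mul, ← mul_inv, Real.mul_self_sqrt hp.le]
        push_cast
        rfl
      rw [← hs, mul_mul_mul_comm, ← Complex.exp_add]
      congr 2
      simp
      ring
    · simp [Set.indicator_of_notMem ht]
  rw [L2.inner_def, integral_congr_ae h, integral_indicator measurableSet_Ioc, integral_const_mul,
    ← intervalIntegral.integral_of_le (by linarith)]
  split_ifs with hlm
  · subst hlm
    simp only [sub_self, Int.cast_zero, mul_zero, zero_mul, Complex.exp_zero,
      intervalIntegral.integral_const, add_sub_cancel_left, Complex.real_smul, mul_one]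
    have : ((2 * Real.pi * N : ℝ) : ℂ) ≠ 0 := by exact_mod_cast hp.ne'
    push_cast at this ⊢
    exact inv_mul_cancel₀ this
  · rw [integral_exp_period a N (m - l) (by omega), mul_zero]

theorem orthonormal_wave (a : ℝ) (N : ℕ) (hN : 0 < N) (φ : ℝ) :
    Orthonormal ℂ fun j : ℤ => wave a N (j - φ) :=
  orthonormal_iff_ite.2 (inner_wave a N hN φ)

/-- The left end points of the intervals, of length `2π(n + 1)`, on which the wave packets live;
the intervals move to `+∞` or to `-∞` according to the sign. -/
noncomputable def leftEnd (s : ℤˣ) (n : ℕ) : ℝ :=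
  if s = 1 then n else -n - 2 * Real.pi * (n + 1 : ℕ)

/-- The isometric embedding of `L²(ℤ × S¹)` into `L²(Ω)` that sends `(u_j)_j` to
`χ_n(t) ∑_j e^{i(j-φ)t} u_j`, where `χ_n` is the normalised indicator function of an interval. -/
noncomputable def bloch (φ : ℝ) (s : ℤˣ) (n : ℕ) : L2ZS1 →ₗᵢ[ℂ] L2Cyl :=
  (tensEmb_orthogonal (E := L2S1)
    (orthonormal_wave (leftEnd s n) (n + 1) n.succ_pos φ)).linearIsometry

theorem bloch_single (φ : ℝ) (s : ℤˣ) (n : ℕ) (j : ℤ) (v : L2S1) :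
    bloch φ s n (lp.single 2 j v) = tens (wave (leftEnd s n) (n + 1) (j - φ)) v :=
  OrthogonalFamily.linearIsometry_apply_single _ _

/-- The vectors supported at one point of `ℤ` span a dense subspace. -/
theorem dense_single :
    Dense (Submodule.span ℂ {f : L2ZS1 | ∃ j v, f = lp.single 2 j v} : Set L2ZS1) := by
  intro f
  have h := lp.hasSum_single (p := 2) (by simp) f
  refine mem_closure_of_tendsto h (Eventually.of_forall fun s => ?_)
  exact Submodule.sum_mem _ fun j _ => Submodule.subset_span ⟨j, f j, rfl⟩

/-- On the support of the `n`-th wave packet one has `±t ≥ n`. -/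
theorem tendsto_of_mem_interval {s : ℤˣ} {n : ℕ} {t : ℝ}
    (ht : t ∈ Set.Ioc (leftEnd s n) (leftEnd s n + 2 * Real.pi * (n + 1 : ℕ))) :
    (n : ℝ) ≤ ((s : ℤ) : ℝ) * t := by
  rcases Int.units_eq_one_or s with rfl | rfl
  · simp [leftEnd] at ht ⊢
    linarith
  · have : (-1 : ℤˣ) ≠ 1 := by decide
    simp [leftEnd, this] at ht ⊢
    linarith

end CylinderAlgebra

end

section

open Filter Topology MeasureTheory CylinderAlgebra
open scoped FourierTransform SchwartzMap

namespace CylinderAlgebra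
open LimitOperator

/-! ### Limits of the generators along wave packets -/

/-- The wave packets along which the limits are taken. -/
noncomputable abbrev packet (φ : ℝ) (s : ℤˣ) (j : ℤ) (n : ℕ) : Lp ℂ 2 (volume : Measure ℝ) :=
  wave (leftEnd s n) (n + 1) (j - φ)

theorem norm_wave (a : ℝ) (N : ℕ) (hN : 0 < N) (τ : ℝ) : ‖wave a N τ‖ = 1 := by
  simpa using (orthonormal_wave a N hN (-τ)).1 0

theorem norm_waveFun_le (a : ℝ) (N : ℕ) (τ t : ℝ) :
    ‖waveFun a N τ t‖ ≤ (√(2 * Real.pi * N))⁻¹ := by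
  unfold waveFun
  by_cases ht : t ∈ Set.Ioc a (a + 2 * Real.pi * N)
  · rw [Set.indicator_of_mem ht, norm_mul, norm_exp_wave, mul_one, Complex.norm_real,
      Real.norm_of_nonneg (by positivity)]
  · rw [Set.indicator_of_notMem ht, norm_zero]
    positivity

theorem tendsto_normalisation :
    Tendsto (fun n : ℕ => (√(2 * Real.pi * (n + 1 : ℕ)))⁻¹) atTop (𝓝 0) := by
  refine tendsto_inv_atTop_zero.comp (Real.tendsto_sqrt_atTop.comp ?_)
  refine Tendsto.const_mul_atTop Real.two_pi_pos ?_
  exact tendsto_natCast_atTop_atTop.comp (tendsto_add_atTop_nat 1)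

/-- The amplitudes tend to zero, hence so do the inner products with Schwartz functions. -/
theorem tendsto_inner_wave (a τ : ℕ → ℝ) (h : Lp ℂ 2 (volume : Measure ℝ)) :
    Tendsto (fun n => inner ℂ (wave (a n) (n + 1) (τ n)) h) atTop (𝓝 0) := by
  refine tendsto_zero_of_dense (T := fun n => innerSL ℂ (wave (a n) (n + 1) (τ n))) (C := 1)
    (fun n => ?_) (s := Set.range (SchwartzMap.toLpCLM ℝ ℂ 2 (volume : Measure ℝ))) ?_ ?_ h
  · rw [innerSL_apply_norm, norm_wave _ _ n.succ_pos]
  · exact Dense.mono Submodule.subset_span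
      (SchwartzMap.denseRange_toLpCLM (F := ℂ) (E := ℝ) (μ := volume) (p := 2)
        ENNReal.ofNat_ne_top)
  · rintro _ ⟨ψ, rfl⟩
    have h0 := tendsto_normalisation.mul_const (∫ t, ‖ψ t‖)
    rw [zero_mul] at h0
    refine squeeze_zero_norm (fun n => ?_) h0
    rw [innerSL_apply_apply, L2.inner_def, ← integral_const_mul]
    refine norm_integral_le_of_norm_le (ψ.integrable.norm.const_mul _) ?_
    filter_upwards [wave_coeFn (a n) (n + 1) (τ n), ψ.coeFn_toLp 2] with t h1 h2
    rw [h1, SchwartzMap.toLpCLM_apply, h2]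
    refine (norm_inner_le_norm _ _).trans ?_
    exact mul_le_mul_of_nonneg_right (norm_waveFun_le _ _ _ _) (norm_nonneg _)

theorem inner_tens_left {E : Type*} [NormedAddCommGroup E] [InnerProductSpace ℂ E]
    (w : Lp ℂ 2 (volume : Measure ℝ)) (v : E) (g : Lp E 2 (volume : Measure ℝ)) :
    inner ℂ (tens w v) g = inner ℂ w ((innerSL ℂ v).compLp g) := by
  rw [L2.inner_def, L2.inner_def]
  refine integral_congr_ae ?_
  filter_upwards [tens_coeFn w v, (innerSL ℂ v).coeFn_compLp g] with t h1 h2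
  rw [h1, h2, inner_smul_left]
  simp [mul_comm]

/-- The wave packets converge weakly to zero. -/
theorem tendsto_inner_bloch (φ : ℝ) (s : ℤˣ) (f : L2ZS1) (g : L2Cyl) :
    Tendsto (fun n => inner ℂ (bloch φ s n f) g) atTop (𝓝 0) := by
  have h : Tendsto (fun n => inner ℂ g (bloch φ s n f)) atTop (𝓝 0) := by
    refine tendsto_zero_of_dense (C := ‖g‖)
      (T := fun n => (innerSL ℂ g).comp (bloch φ s n).toContinuousLinearMap) (fun n => ?_)
      dense_single ?_ f
    · refine ContinuousLinearMap.opNorm_le_bound _ (norm_nonneg _) fun f => ?_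
      exact (norm_inner_le_norm g (bloch φ s n f)).trans_eq
        (congrArg (‖g‖ * ·) ((bloch φ s n).norm_map f))
    · rintro _ ⟨j, v, rfl⟩
      have := (Complex.continuous_conj.tendsto 0).comp (tendsto_inner_wave (fun n => leftEnd s n)
        (fun _ => j - φ) ((innerSL ℂ v).compLp g))
      rw [map_zero] at this
      refine this.congr fun n => ?_
      change (starRingEnd ℂ) (inner ℂ (packet φ s j n) ((innerSL ℂ v).compLp g)) =
        inner ℂ g (bloch φ s n (lp.single 2 j v))
      rw [← inner_tens_left, inner_conj_symm, bloch_single]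
  have h2 := (Complex.continuous_conj.tendsto 0).comp h
  rw [map_zero] at h2
  exact h2.congr fun n => inner_conj_symm _ _

/-- The criterion for limits along `bloch`, in terms of elementary tensors. -/
theorem isLimit_bloch {φ : ℝ} {s : ℤˣ} {A : L2Cyl →L[ℂ] L2Cyl} {B : L2ZS1 →L[ℂ] L2ZS1}
    (h : ∀ j v, Tendsto (fun n => A (tens (packet φ s j n) v) - bloch φ s n (B (lp.single 2 j v)))
      atTop (𝓝 0)) : IsLimit (bloch φ s) A B := by
  refine isLimit_of_dense dense_single ?_
  rintro _ ⟨j, v, rfl⟩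
  simpa only [bloch_single] using h j v

theorem lp_ext_single {B B' : L2ZS1 →L[ℂ] L2ZS1}
    (h : ∀ j v, B (lp.single 2 j v) = B' (lp.single 2 j v)) : B = B' := by
  refine ContinuousLinearMap.ext_on dense_single ?_
  rintro _ ⟨j, v, rfl⟩
  exact h j v

theorem diagOp_apply (d : lp (fun _ : ℤ => L2S1 →L[ℂ] L2S1) ⊤) (f : L2ZS1) (j : ℤ) :
    diagOp d f j = d j (f j) := rfl

theorem diagOp_single (d : lp (fun _ : ℤ => L2S1 →L[ℂ] L2S1) ⊤) (j : ℤ) (v : L2S1) :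
    diagOp d (lp.single 2 j v) = lp.single 2 j (d j v) := by
  refine lp.ext (funext fun k => ?_)
  rw [diagOp_apply]
  by_cases hk : k = j
  · subst hk
    simp
  · simp [hk]

theorem isLimit_mulBeta (φ : ℝ) (s : ℤˣ) (a : C(Circ, ℂ)) :
    IsLimit (bloch φ s) (mulBeta a) (constDiag (circMul a)) := by
  refine isLimit_bloch fun j v => ?_
  simp only [constDiag, diagOp_single, bloch_single, mulBeta, compLpL_tens, sub_self]
  exact tendsto_const_nhds

/-- Far out in the direction `s`, a continuous function on `[-∞, +∞]` is close to its boundary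
value. -/
theorem tendsto_boundary (b : C(EReal, ℂ)) (s : ℤˣ) (ε : ℝ) (hε : 0 < ε) :
    ∃ R : ℕ, ∀ t : ℝ, (R : ℝ) ≤ ((s : ℤ) : ℝ) * t → ‖b t - b (if s = 1 then ⊤ else ⊥)‖ ≤ ε := by
  rcases Int.units_eq_one_or s with rfl | rfl
  · have h : Tendsto (fun t : ℝ => b t) atTop (𝓝 (b ⊤)) :=
      (b.continuous.tendsto ⊤).comp EReal.tendsto_coe_atTop
    obtain ⟨R, hR⟩ := (Metric.tendsto_atTop.1 h) ε hε
    obtain ⟨R', hR'⟩ := exists_nat_ge R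
    refine ⟨R', fun t ht => ?_⟩
    have := (hR t (by simp at ht; linarith)).le
    simpa [dist_eq_norm] using this
  · have h : Tendsto (fun t : ℝ => b (-t : ℝ)) atTop (𝓝 (b ⊥)) :=
      (b.continuous.tendsto ⊥).comp (EReal.tendsto_coe_atBot.comp tendsto_neg_atTop_atBot)
    obtain ⟨R, hR⟩ := (Metric.tendsto_atTop.1 h) ε hε
    obtain ⟨R', hR'⟩ := exists_nat_ge R
    refine ⟨R', fun t ht => ?_⟩
    have := (hR (-t) (by simp at ht; linarith)).le
    have h1 : (-1 : ℤˣ) ≠ 1 := by decide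
    simpa [dist_eq_norm, h1] using this

/-- The wave packets move to `±∞`, where `b` is nearly constant. -/
theorem isLimit_mulT (φ : ℝ) (s : ℤˣ) (b : C(EReal, ℂ)) :
    IsLimit (bloch φ s) (mulT b)
      (b (if s = 1 then ⊤ else ⊥) • ContinuousLinearMap.id ℂ L2ZS1) := by
  refine isLimit_bloch fun j v => ?_
  set c := b (if s = 1 then ⊤ else ⊥) with hc
  rw [Metric.tendsto_atTop]
  intro ε hε
  obtain ⟨R, hR⟩ := tendsto_boundary b s (ε / (‖v‖ + 1)) (by positivity)
  refine ⟨R, fun n hn => ?_⟩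
  rw [dist_zero_right, _root_.smul_apply, ContinuousLinearMap.id_apply, map_smul,
    bloch_single, ← smul_tens, mulT, smulOp_tens, ← sub_tens, norm_tens]
  have h1 : ‖smulOp volume (fun t : ℝ => b (t : EReal))
      (memLp_top_of_bound (b.continuous.comp continuous_coe_real_ereal).aestronglyMeasurable ‖b‖
      (ae_of_all _ fun t => b.norm_coe_le_norm t)) (packet φ s j n) - c • packet φ s j n‖ ≤
      ε / (‖v‖ + 1) * ‖packet φ s j n‖ := by
    refine Lp.norm_le_mul_norm_of_ae_le_mul ?_
    filter_upwards [Lp.coeFn_sub (smulOp volume (fun t : ℝ => b (t : EReal))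
      (memLp_top_of_bound (b.continuous.comp continuous_coe_real_ereal).aestronglyMeasurable ‖b‖
      (ae_of_all _ fun t => b.norm_coe_le_norm t)) (packet φ s j n)) (c • packet φ s j n),
      smulOp_coeFn volume (fun t : ℝ => b (t : EReal))
      (memLp_top_of_bound (b.continuous.comp continuous_coe_real_ereal).aestronglyMeasurable ‖b‖
      (ae_of_all _ fun t => b.norm_coe_le_norm t)) (packet φ s j n),
      Lp.coeFn_smul c (packet φ s j n), wave_coeFn (leftEnd s n) (n + 1) (j - φ)]
      with t h1 h2 h3 h4
    rw [h1, Pi.sub_apply, h2, h3, Pi.smul_apply, ← sub_smul, norm_smul]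
    by_cases ht : t ∈ Set.Ioc (leftEnd s n) (leftEnd s n + 2 * Real.pi * (n + 1 : ℕ))
    · refine mul_le_mul_of_nonneg_right (hR t ?_) (norm_nonneg _)
      exact le_trans (by exact_mod_cast hn) (tendsto_of_mem_interval ht)
    · rw [h4, waveFun, Set.indicator_of_notMem ht]
      simp
  rw [norm_wave _ _ n.succ_pos, mul_one] at h1
  calc _ ≤ ε / (‖v‖ + 1) * ‖v‖ := mul_le_mul_of_nonneg_right h1 (norm_nonneg _)
    _ < ε := by
      rw [div_mul_eq_mul_div, div_lt_iff₀ (by positivity)]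
      nlinarith

/-- Multiplication by `e^{imt}` raises the frequency of a wave by `m`. -/
theorem smulOp_exp_wave (m : ℤ) (a : ℝ) (N : ℕ) (τ : ℝ)
    (h : MemLp (fun t : ℝ => Complex.exp (Complex.I * m * t)) ⊤ volume) :
    smulOp volume _ h (wave a N τ) = wave a N (τ + m) := by
  refine Lp.ext ?_
  filter_upwards [smulOp_coeFn volume _ h (wave a N τ), wave_coeFn a N τ,
    wave_coeFn a N (τ + m)] with t h1 h2 h3
  rw [h1, h2, h3, waveFun, waveFun]
  by_cases ht : t ∈ Set.Ioc a (a + 2 * Real.pi * N)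
  · rw [Set.indicator_of_mem ht, Set.indicator_of_mem ht, smul_eq_mul, mul_left_comm,
      ← Complex.exp_add]
    congr 2
    push_cast
    ring
  · rw [Set.indicator_of_notMem ht, Set.indicator_of_notMem ht, smul_zero]

/-- Multiplication by `e^{imt}` has as limit the shift by `m`, for every `φ`. -/
theorem isLimit_mulExp (φ : ℝ) (s : ℤˣ) (m : ℤ) {B : L2ZS1 →L[ℂ] L2ZS1}
    (hB : ∀ j v, B (lp.single 2 j v) = lp.single 2 (j + m) v) :
    IsLimit (bloch φ s) (mulExp m) B := by
  refine isLimit_bloch fun j v => ?_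
  have h : ((j + m : ℤ) : ℝ) - φ = (j - φ) + m := by
    push_cast
    ring
  simp only [hB, bloch_single, mulExp, smulOp_tens, smulOp_exp_wave, h, sub_self]
  exact tendsto_const_nhds

end CylinderAlgebra

end

section

open Filter Topology MeasureTheory CylinderAlgebra
open scoped FourierTransform SchwartzMap

namespace CylinderAlgebra
open LimitOperator

/-! ### Smooth approximation of the wave packets -/

theorem deriv_smoothTransition_of_notMem {x : ℝ} (hx : x ∉ Set.Icc (0 : ℝ) 1) :
    deriv Real.smoothTransition x = 0 := by
  rw [Set.mem_Icc, not_and_or, not_le, not_le] at hx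
  rcases hx with hx | hx
  · have : Real.smoothTransition =ᶠ[𝓝 x] fun _ => 0 := by
      filter_upwards [eventually_lt_nhds hx] with y hy
      exact Real.smoothTransition.zero_of_nonpos hy.le
    rw [this.deriv_eq, deriv_const]
  · have : Real.smoothTransition =ᶠ[𝓝 x] fun _ => 1 := by
      filter_upwards [eventually_gt_nhds hx] with y hy
      exact Real.smoothTransition.one_of_one_le hy.le
    rw [this.deriv_eq, deriv_const]

theorem exists_bound_deriv_smoothTransition :
    ∃ C : ℝ, 0 ≤ C ∧ ∀ x, |deriv Real.smoothTransition x| ≤ C := by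
  have h1 : Continuous (deriv Real.smoothTransition) :=
    (Real.smoothTransition.contDiff (n := 1)).continuous_deriv (by simp)
  have h2 : HasCompactSupport (deriv Real.smoothTransition) :=
    HasCompactSupport.intro isCompact_Icc fun x hx => deriv_smoothTransition_of_notMem hx
  obtain ⟨C, hC⟩ := h2.exists_bound_of_continuous h1
  exact ⟨C, (norm_nonneg _).trans (hC 0), hC⟩

/-- A smooth cut-off function for the interval `[a, b]`. -/
noncomputable def cutoff (a b t : ℝ) : ℝ :=
  Real.smoothTransition (t - a) * Real.smoothTransition (b - t)

theorem contDiff_cutoff (a b : ℝ) : ContDiff ℝ (⊤ : ℕ∞) (cutoff a b) :=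
  (Real.smoothTransition.contDiff.comp (contDiff_id.sub contDiff_const)).mul
    (Real.smoothTransition.contDiff.comp (contDiff_const.sub contDiff_id))

theorem cutoff_eq_zero {a b t : ℝ} (ht : t ∉ Set.Ioc a b) : cutoff a b t = 0 := by
  rw [Set.mem_Ioc, not_and_or, not_lt, not_le] at ht
  rcases ht with ht | ht
  · rw [cutoff, Real.smoothTransition.zero_of_nonpos (by linarith), zero_mul]
  · rw [cutoff, Real.smoothTransition.zero_of_nonpos (x := b - t) (by linarith), mul_zero]

/-- The set where a cut-off function is not locally constant. -/
def ends (a b : ℝ) : Set ℝ := Set.Icc a (a + 1) ∪ Set.Icc (b - 1) b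

theorem measurableSet_ends (a b : ℝ) : MeasurableSet (ends a b) :=
  measurableSet_Icc.union measurableSet_Icc

theorem volume_ends_le (a b : ℝ) : volume (ends a b) ≤ 2 := by
  refine (measure_union_le _ _).trans ?_
  rw [Real.volume_Icc, Real.volume_Icc, add_sub_cancel_left, sub_sub_cancel]
  norm_num

theorem abs_cutoff_sub_le (a b t : ℝ) :
    |cutoff a b t - (Set.Ioc a b).indicator (fun _ => 1) t| ≤
      (ends a b).indicator (fun _ => 1) t := by
  have h1 := Real.smoothTransition.nonneg (t - a)
  have h2 := Real.smoothTransition.nonneg (b - t)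
  have h3 := Real.smoothTransition.le_one (t - a)
  have h4 := Real.smoothTransition.le_one (b - t)
  by_cases ht : t ∈ Set.Ioc a b
  · rw [Set.indicator_of_mem ht]
    by_cases he : t ∈ ends a b
    · rw [Set.indicator_of_mem he, abs_le, cutoff]
      constructor <;> nlinarith
    · have h5 : a + 1 < t := by
        by_contra h
        exact he (Or.inl ⟨ht.1.le, not_lt.1 h⟩)
      have h6 : t < b - 1 := by
        by_contra h
        exact he (Or.inr ⟨not_lt.1 h, ht.2⟩)
      rw [Set.indicator_of_notMem he, cutoff, Real.smoothTransition.one_of_one_le (by linarith),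
        Real.smoothTransition.one_of_one_le (by linarith)]
      simp
  · rw [cutoff_eq_zero ht, Set.indicator_of_notMem ht, sub_zero, abs_zero]
    exact Set.indicator_nonneg (fun _ _ => zero_le_one) _

theorem abs_deriv_cutoff_le {C : ℝ} (hC0 : 0 ≤ C)
    (hC : ∀ x, |deriv Real.smoothTransition x| ≤ C) (a b t : ℝ) :
    |deriv (cutoff a b) t| ≤ (ends a b).indicator (fun _ => 2 * C) t := by
  have hd : Differentiable ℝ Real.smoothTransition :=
    (Real.smoothTransition.contDiff (n := 1)).differentiable (by simp)
  have h : deriv (cutoff a b) t = deriv Real.smoothTransition (t - a) *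
      Real.smoothTransition (b - t) -
      Real.smoothTransition (t - a) * deriv Real.smoothTransition (b - t) := by
    have e1 : HasDerivAt (fun t => Real.smoothTransition (t - a))
        (deriv Real.smoothTransition (t - a)) t := by
      exact (hd (t - a)).hasDerivAt.comp_sub_const t a
    have e2 : HasDerivAt (fun t => Real.smoothTransition (b - t))
        (-deriv Real.smoothTransition (b - t)) t := by
      exact (hd (b - t)).hasDerivAt.comp_const_sub b t
    exact (e1.mul e2).deriv.trans (by ring)
  have h1 := Real.smoothTransition.nonneg (t - a)
  have h2 := Real.smoothTransition.nonneg (b - t)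
  have h3 := Real.smoothTransition.le_one (t - a)
  have h4 := Real.smoothTransition.le_one (b - t)
  by_cases he : t ∈ ends a b
  · rw [Set.indicator_of_mem he, h]
    refine (abs_sub _ _).trans ?_
    rw [abs_mul, abs_mul, abs_of_nonneg h1, abs_of_nonneg h2]
    nlinarith [hC (t - a), hC (b - t), abs_nonneg (deriv Real.smoothTransition (t - a)),
      abs_nonneg (deriv Real.smoothTransition (b - t))]
  · rw [Set.indicator_of_notMem he, h]
    have h5 : t - a ∉ Set.Icc (0 : ℝ) 1 := fun h =>
      he (Or.inl ⟨by linarith [h.1], by linarith [h.2]⟩)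
    have h6 : b - t ∉ Set.Icc (0 : ℝ) 1 := fun h =>
      he (Or.inr ⟨by linarith [h.2], by linarith [h.1]⟩)
    rw [deriv_smoothTransition_of_notMem h5, deriv_smoothTransition_of_notMem h6]
    simp

/-- The smooth approximation of `waveFun`. -/
noncomputable def smoothWave (a : ℝ) (N : ℕ) (τ t : ℝ) : ℂ :=
  (cutoff a (a + 2 * Real.pi * N) t : ℂ) *
    (((√(2 * Real.pi * N))⁻¹ : ℝ) * Complex.exp (Complex.I * τ * t))

theorem contDiff_smoothWave (a : ℝ) (N : ℕ) (τ : ℝ) :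
    ContDiff ℝ (⊤ : ℕ∞) (smoothWave a N τ) := by
  refine (Complex.ofRealCLM.contDiff.comp (contDiff_cutoff _ _)).mul (contDiff_const.mul ?_)
  exact ContDiff.cexp (contDiff_const.mul Complex.ofRealCLM.contDiff)

theorem hasCompactSupport_smoothWave (a : ℝ) (N : ℕ) (τ : ℝ) :
    HasCompactSupport (smoothWave a N τ) :=
  HasCompactSupport.intro (isCompact_Icc (a := a) (b := a + 2 * Real.pi * N)) fun t ht => by
    rw [smoothWave, cutoff_eq_zero fun h => ht ⟨h.1.le, h.2⟩, Complex.ofReal_zero, zero_mul]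

/-- The smooth wave packet as a Schwartz function. -/
noncomputable def schwartzWave (a : ℝ) (N : ℕ) (τ : ℝ) : 𝓢(ℝ, ℂ) :=
  (hasCompactSupport_smoothWave a N τ).toSchwartzMap (contDiff_smoothWave a N τ)

/-- A wave and its smooth approximation differ only on a set of measure at most two, where the
difference is bounded by the amplitude. -/
theorem norm_schwartzWave_sub_le (a : ℝ) (N : ℕ) (τ : ℝ) :
    ‖wave a N τ - (schwartzWave a N τ).toLp 2 volume‖ ≤ 2 * (√(2 * Real.pi * N))⁻¹ := by
  refine norm_le_of_support (measurableSet_ends a (a + 2 * Real.pi * N)) (volume_ends_le _ _)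
    (by positivity) ?_
  filter_upwards [Lp.coeFn_sub (wave a N τ) ((schwartzWave a N τ).toLp 2 volume),
    wave_coeFn a N τ, (schwartzWave a N τ).coeFn_toLp 2] with t h1 h2 h3
  have h4 : waveFun a N τ t - smoothWave a N τ t =
      ((-(cutoff a (a + 2 * Real.pi * N) t -
        (Set.Ioc a (a + 2 * Real.pi * N)).indicator (fun _ => 1) t) : ℝ) : ℂ) *
      (((√(2 * Real.pi * N))⁻¹ : ℝ) * Complex.exp (Complex.I * τ * t)) := by
    rw [waveFun, smoothWave]
    by_cases ht : t ∈ Set.Ioc a (a + 2 * Real.pi * N)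
    · rw [Set.indicator_of_mem ht, Set.indicator_of_mem ht]
      push_cast
      ring
    · rw [Set.indicator_of_notMem ht, Set.indicator_of_notMem ht]
      push_cast
      ring
  rw [h1, Pi.sub_apply, h2, h3]
  change ‖waveFun a N τ t - smoothWave a N τ t‖ ≤ _
  rw [h4, norm_mul, norm_mul, norm_exp_wave, mul_one, Complex.norm_real, Complex.norm_real,
    Real.norm_eq_abs, abs_neg, Real.norm_of_nonneg (r := (√(2 * Real.pi * N))⁻¹) (by positivity)]
  refine (mul_le_mul_of_nonneg_right (abs_cutoff_sub_le _ _ _) (by positivity)).trans_eq ?_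
  by_cases he : t ∈ ends a (a + 2 * Real.pi * N) <;> simp [he]

/-- Up to the derivative of the cut-off function, the smooth wave is an eigenfunction of
`(1/i) d/dt` with eigenvalue `τ`. -/
theorem norm_deriv_schwartzWave_le {C : ℝ} (hC0 : 0 ≤ C)
    (hC : ∀ x, |deriv Real.smoothTransition x| ≤ C) (a : ℝ) (N : ℕ) (τ : ℝ) :
    ‖((-Complex.I) • SchwartzMap.derivCLM ℂ ℂ (schwartzWave a N τ) -
      (τ : ℂ) • schwartzWave a N τ).toLp 2 volume‖ ≤ 2 * (2 * C * (√(2 * Real.pi * N))⁻¹) := by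
  refine norm_le_of_support (measurableSet_ends a (a + 2 * Real.pi * N)) (volume_ends_le _ _)
    (by positivity) ?_
  filter_upwards [((-Complex.I) • SchwartzMap.derivCLM ℂ ℂ (schwartzWave a N τ) -
      (τ : ℂ) • schwartzWave a N τ).coeFn_toLp 2 volume] with t h1
  rw [h1]
  have h2 : HasDerivAt (fun t : ℝ => Complex.exp (Complex.I * τ * t))
      (Complex.exp (Complex.I * τ * t) * (Complex.I * τ)) t := by
    have h3 : HasDerivAt (fun t : ℝ => Complex.I * τ * (t : ℂ)) (Complex.I * τ) t := by
      simpa using (Complex.ofRealCLM.hasDerivAt (x := t)).const_mul (Complex.I * τ)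
    exact h3.cexp
  have h3 : HasDerivAt (fun t => (cutoff a (a + 2 * Real.pi * N) t : ℂ))
      (deriv (cutoff a (a + 2 * Real.pi * N)) t : ℝ) t :=
    (((contDiff_cutoff _ _).differentiable (by simp)) t).hasDerivAt.ofReal_comp
  have h4 : HasDerivAt (smoothWave a N τ) _ t :=
    h3.mul (h2.const_mul (((√(2 * Real.pi * N))⁻¹ : ℝ) : ℂ))
  have h5 : ((-Complex.I) • SchwartzMap.derivCLM ℂ ℂ (schwartzWave a N τ) -
      (τ : ℂ) • schwartzWave a N τ) t =
      (-Complex.I) * ((deriv (cutoff a (a + 2 * Real.pi * N)) t : ℝ) *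
        (((√(2 * Real.pi * N))⁻¹ : ℝ) * Complex.exp (Complex.I * τ * t))) := by
    rw [_root_.sub_apply, _root_.smul_apply, _root_.smul_apply, SchwartzMap.derivCLM_apply]
    change (-Complex.I) * deriv (smoothWave a N τ) t - τ * smoothWave a N τ t = _
    rw [h4.deriv, smoothWave]
    linear_combination (-(τ : ℂ) * (cutoff a (a + 2 * Real.pi * N) t : ℂ) *
    (((√(2 * Real.pi * N))⁻¹ : ℝ) * Complex.exp (Complex.I * τ * t))) * Complex.I_sq
  rw [h5, norm_mul, norm_mul, norm_mul, norm_exp_wave, norm_neg, Complex.norm_I, one_mul, mul_one,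
    Complex.norm_real, Complex.norm_real, Real.norm_eq_abs,
    Real.norm_of_nonneg (r := (√(2 * Real.pi * N))⁻¹) (by positivity)]
  refine (mul_le_mul_of_nonneg_right (abs_deriv_cutoff_le hC0 hC _ _ t) (by positivity)).trans_eq ?_
  by_cases he : t ∈ ends a (a + 2 * Real.pi * N) <;> simp [he]

theorem shiftedSymbOp_single (i : Fin 3) (φ : ℝ) (j : ℤ) (v : L2S1) :
    shiftedSymbOp i φ (lp.single 2 j v) = lp.single 2 j (symbOp i (j - φ) v) :=
  diagOp_single _ _ _

/-- On a wave packet of frequency `j - φ`, the operator `lamOp i` acts as `symbOp i (j - φ)` up to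
an error of the order of the amplitude `(2π(n + 1))^{-1/2}`. -/
theorem isLimit_lamOp (φ : ℝ) (s : ℤˣ) (i : Fin 3) :
    IsLimit (bloch φ s) (lamOp i) (shiftedSymbOp i φ) := by
  obtain ⟨C, hC0, hC⟩ := exists_bound_deriv_smoothTransition
  refine isLimit_bloch fun j v => ?_
  have h0 := tendsto_normalisation.mul_const
    (‖lamOp i‖ * (2 * ‖v‖) + 2 * ‖v‖ * (2 * (2 * C)) + 2 * ‖symbOp i (j - φ) v‖)
  rw [zero_mul] at h0
  refine squeeze_zero_norm (fun n => ?_) h0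
  rw [shiftedSymbOp_single, bloch_single]
  set a := leftEnd s n
  set c := (√(2 * Real.pi * (n + 1 : ℕ)))⁻¹
  set w := wave a (n + 1) (j - φ)
  set ψ := schwartzWave a (n + 1) (j - φ)
  have h1 : ‖w - ψ.toLp 2 volume‖ ≤ 2 * c := norm_schwartzWave_sub_le a (n + 1) (j - φ)
  have h2 := norm_lamOp_tens_sub_le i (j - φ) ψ v
  have h3 : ‖((-Complex.I) • SchwartzMap.derivCLM ℂ ℂ ψ -
      ((j - φ : ℝ) : ℂ) • ψ).toLp 2 volume‖ ≤ 2 * (2 * C * c) :=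
    norm_deriv_schwartzWave_le hC0 hC a (n + 1) (j - φ)
  have h4 : lamOp i (tens w v) - tens w (symbOp i (j - φ) v) =
      lamOp i (tens (w - ψ.toLp 2 volume) v) +
      (lamOp i (tens (ψ.toLp 2 volume) v) - tens (ψ.toLp 2 volume) (symbOp i (j - φ) v)) -
      tens (w - ψ.toLp 2 volume) (symbOp i (j - φ) v) := by
    rw [sub_tens, sub_tens, map_sub]
    abel
  change ‖lamOp i (tens w v) - tens w (symbOp i (j - φ) v)‖ ≤ _
  rw [h4]
  refine (norm_sub_le _ _).trans ((add_le_add_left (norm_add_le _ _) _).trans ?_)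
  have h5 : ‖lamOp i (tens (w - ψ.toLp 2 volume) v)‖ ≤ ‖lamOp i‖ * (2 * c * ‖v‖) := by
    refine ((lamOp i).le_opNorm _).trans (mul_le_mul_of_nonneg_left ?_ (norm_nonneg _))
    rw [norm_tens]
    exact mul_le_mul_of_nonneg_right h1 (norm_nonneg _)
  have h6 : ‖tens (w - ψ.toLp 2 volume) (symbOp i (j - φ) v)‖ ≤ 2 * c * ‖symbOp i (j - φ) v‖ := by
    rw [norm_tens]
    exact mul_le_mul_of_nonneg_right h1 (norm_nonneg _)
  have h7 := h2.trans (mul_le_mul_of_nonneg_left h3 (by positivity))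
  linarith

/-! ### Adjoints of the generators -/

section Adjoint

variable {X : Type*} [MeasurableSpace X] {μ : Measure X} {E : Type*} [NormedAddCommGroup E]
  [InnerProductSpace ℂ E] [CompleteSpace E]

theorem star_mulOp {B B' : X → E →L[ℂ] E} (hB : MemLp B ⊤ μ) (hB' : MemLp B' ⊤ μ)
    (h : ∀ x, B' x = star (B x)) : star (mulOp μ B hB) = mulOp μ B' hB' := by
  rw [ContinuousLinearMap.star_eq_adjoint]
  refine ((ContinuousLinearMap.eq_adjoint_iff _ _).2 fun f g => ?_).symm
  rw [L2.inner_def, L2.inner_def]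
  refine integral_congr_ae ?_
  filter_upwards [mulOp_coeFn hB g, mulOp_coeFn hB' f] with x h1 h2
  rw [h1, h2, h, ContinuousLinearMap.star_eq_adjoint, ContinuousLinearMap.adjoint_inner_left]

theorem star_smulOp {b b' : X → ℂ} (hb : MemLp b ⊤ μ) (hb' : MemLp b' ⊤ μ)
    (h : ∀ x, b' x = star (b x)) :
    star (smulOp μ b hb : Lp E 2 μ →L[ℂ] Lp E 2 μ) = smulOp μ b' hb' := by
  rw [ContinuousLinearMap.star_eq_adjoint]
  refine ((ContinuousLinearMap.eq_adjoint_iff _ _).2 fun f g => ?_).symm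
  rw [L2.inner_def, L2.inner_def]
  refine integral_congr_ae ?_
  filter_upwards [smulOp_coeFn μ b hb g, smulOp_coeFn μ b' hb' f] with x h1 h2
  rw [h1, h2, h, inner_smul_left, inner_smul_right]
  simp

theorem star_compLpL (T : E →L[ℂ] E) :
    star (T.compLpL 2 μ : Lp E 2 μ →L[ℂ] Lp E 2 μ) = (star T).compLpL 2 μ := by
  rw [ContinuousLinearMap.star_eq_adjoint]
  refine ((ContinuousLinearMap.eq_adjoint_iff _ _).2 fun f g => ?_).symm
  rw [L2.inner_def, L2.inner_def]
  refine integral_congr_ae ?_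
  filter_upwards [T.coeFn_compLpL g, (star T).coeFn_compLpL f] with x h1 h2
  rw [h1, h2, ContinuousLinearMap.star_eq_adjoint, ContinuousLinearMap.adjoint_inner_left]

/-- Conjugation by a unitary map commutes with taking adjoints. -/
theorem star_conj {E F : Type*} [NormedAddCommGroup E] [InnerProductSpace ℂ E] [CompleteSpace E]
    [NormedAddCommGroup F] [InnerProductSpace ℂ F] [CompleteSpace F] (e : E ≃ₗᵢ[ℂ] F)
    (T : E →L[ℂ] E) : star (e.toContinuousLinearEquiv.conjContinuousAlgEquiv T) =
      e.toContinuousLinearEquiv.conjContinuousAlgEquiv (star T) := by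
  rw [ContinuousLinearMap.star_eq_adjoint]
  refine ((ContinuousLinearMap.eq_adjoint_iff _ _).2 fun f g => ?_).symm
  change inner ℂ (e (star T (e.symm f))) g = inner ℂ f (e (T (e.symm g)))
  rw [← e.symm.inner_map_map, ← e.symm.inner_map_map f, e.symm_apply_apply, e.symm_apply_apply,
    ContinuousLinearMap.star_eq_adjoint, ContinuousLinearMap.adjoint_inner_left]

end Adjoint

theorem star_circMul (a : C(Circ, ℂ)) : star (circMul a) = circMul (star a) :=
  star_smulOp _ _ fun _ => rfl

theorem star_mulBeta (a : C(Circ, ℂ)) : star (mulBeta a) = mulBeta (star a) := by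
  rw [mulBeta, star_compLpL, star_circMul, mulBeta]

theorem star_mulT (b : C(EReal, ℂ)) : star (mulT b) = mulT (star b) :=
  star_smulOp _ _ fun _ => rfl

theorem star_mulExp (j : ℤ) : star (mulExp j) = mulExp (-j) :=
  star_smulOp _ _ fun t => by
    simp only [← starRingEnd_apply]
    rw [← Complex.exp_conj]
    simp

/-- The operator `circMult d` multiplies the `k`-th Fourier coefficient by `d k`. -/
theorem circMult_repr (d : lp (fun _ : ℤ => ℂ) ⊤) (f : L2S1) (k : ℤ) :
    (fourierBasis (T := 2 * Real.pi)).repr (circMult d f) k =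
      d k * (fourierBasis (T := 2 * Real.pi)).repr f k := by
  have : (fourierBasis (T := 2 * Real.pi)).repr (circMult d f) =
      lp.holderL 2 (fun _ : ℤ => ContinuousLinearMap.mul ℂ ℂ) (K := 1) (fun _ => by simp) d
        ((fourierBasis (T := 2 * Real.pi)).repr f) :=
    (fourierBasis (T := 2 * Real.pi)).repr.apply_symm_apply _
  rw [this]
  rfl

/-- The symbols are real, so the corresponding Fourier multipliers are self-adjoint. -/
theorem star_symbOp (i : Fin 3) (τ : ℝ) : star (symbOp i τ) = symbOp i τ := by
  rw [ContinuousLinearMap.star_eq_adjoint]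
  refine ((ContinuousLinearMap.eq_adjoint_iff _ _).2 fun f g => ?_).symm
  rw [← (fourierBasis (T := 2 * Real.pi)).repr.inner_map_map,
    ← (fourierBasis (T := 2 * Real.pi)).repr.inner_map_map f, lp.inner_eq_tsum, lp.inner_eq_tsum]
  refine tsum_congr fun k => ?_
  rw [symbOp, circMult_repr, circMult_repr]
  have : (symbSeq i τ) k = ((symb i τ k : ℝ) : ℂ) := rfl
  rw [this]
  simp only [RCLike.inner_apply, map_mul, Complex.conj_ofReal]
  ring

theorem star_lamOp (i : Fin 3) : star (lamOp i) = lamOp i := by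
  rw [lamOp, star_conj, star_mulOp _ (memLp_symbOp i) fun ξ => (star_symbOp i _).symm]

end CylinderAlgebra

end

section

open Filter Topology MeasureTheory CylinderAlgebra

namespace CylinderAlgebra
open LimitOperator

/-! ### The unitary operators `Y_φ` -/

theorem op_mul_apply {H : Type*} [NormedAddCommGroup H] [NormedSpace ℂ H] (S T : H →L[ℂ] H)
    (f : H) : (S * T) f = S (T f) := rfl

theorem fourierLp_coeFn (l : ℤ) :
    fourierLp (T := 2 * Real.pi) 2 l =ᵐ[circMeas] fun θ => fourier l θ :=
  coeFn_fourierLp 2 l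

theorem expMap_eq_tens (l : ℤ) (v : L2S1) :
    expMap l v = tens (fourierLp (T := 2 * Real.pi) 2 l) v := by
  refine Lp.ext ?_
  refine (smulOp_coeFn _ _ _ _).trans ?_
  filter_upwards [Lp.coeFn_const 2 circMeas v, tens_coeFn (fourierLp (T := 2 * Real.pi) 2 l) v,
    fourierLp_coeFn l] with θ h1 h2 h3
  rw [h2, h3]
  change fourier l θ • (Lp.const 2 circMeas v) θ = _
  rw [h1]
  rfl

theorem synth_single (l : ℤ) (v : L2S1) :
    synth (lp.single 2 l v) = tens (fourierLp (T := 2 * Real.pi) 2 l) v :=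
  (OrthogonalFamily.linearIsometry_apply_single expEmb_orthogonal v).trans (expMap_eq_tens l v)

/-- A closed subspace of `L²(X, E)` that contains all elementary tensors is everything. -/
theorem eq_top_of_tens_mem {X : Type*} [MeasurableSpace X] {μ : Measure X} {E : Type*}
    [NormedAddCommGroup E] [InnerProductSpace ℂ E] (S : Submodule ℂ (Lp E 2 μ))
    (hS : IsClosed (S : Set (Lp E 2 μ))) (h : ∀ g v, tens g v ∈ S) : S = ⊤ := by
  refine eq_top_iff.2 fun f _ => ?_
  refine Lp.induction (by simp) (motive := fun f : Lp E 2 μ => f ∈ S) ?_ ?_ hS f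
  · intro c s hs hμs
    have : (Lp.simpleFunc.indicatorConst 2 hs hμs.ne c : Lp E 2 μ) =
        tens (indicatorConstLp 2 hs hμs.ne (1 : ℂ)) c := by
      rw [Lp.simpleFunc.coe_indicatorConst]
      refine Lp.ext ?_
      filter_upwards [tens_coeFn (indicatorConstLp 2 hs hμs.ne (1 : ℂ)) c,
        indicatorConstLp_coeFn (p := 2) (hs := hs) (hμs := hμs.ne) (c := (1 : ℂ)),
        indicatorConstLp_coeFn (p := 2) (hs := hs) (hμs := hμs.ne) (c := c)] with x h1 h2 h3
      rw [h1, h2, h3]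
      by_cases hx : x ∈ s <;> simp [hx]
    rw [this]
    exact h _ _
  · intro f g hf hg _ h1 h2
    exact S.add_mem h1 h2

/-- The Fourier series of a vector-valued function on the circle recovers the function: the range
of the synthesis map contains every elementary tensor. -/
theorem synth_surjective : Function.Surjective synth := by
  let S : Submodule ℂ (Lp L2S1 2 circMeas) :=
    LinearMap.range expEmb_orthogonal.linearIsometry.toLinearMap
  have hS : IsClosed (S : Set (Lp L2S1 2 circMeas)) :=
    expEmb_orthogonal.linearIsometry.isometry.isClosedEmbedding.isClosed_range
  have h : S = ⊤ := by
    refine eq_top_of_tens_mem S hS fun g v => ?_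
    let T := ((ContinuousLinearMap.toSpanSingleton ℂ v).compLpL 2 circMeas)
    have h1 : (Submodule.span ℂ (Set.range (fourierLp (T := 2 * Real.pi) 2))).topologicalClosure ≤
        S.comap (T : Lp ℂ 2 circMeas →ₗ[ℂ] Lp L2S1 2 circMeas) := by
      refine Submodule.topologicalClosure_minimal _ (Submodule.span_le.2 ?_)
        (hS.preimage T.continuous)
      rintro _ ⟨l, rfl⟩
      exact ⟨lp.single 2 l v, synth_single l v⟩
    rw [span_fourierLp_closure_eq_top (by simp)] at h1
    exact h1 (Submodule.mem_top (x := g))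
  intro f
  have : f ∈ S := h ▸ Submodule.mem_top
  exact this

/-- The synthesis map as a unitary map. -/
noncomputable def synthEquiv : L2ZS1 ≃ₗᵢ[ℂ] Lp L2S1 2 circMeas :=
  LinearIsometryEquiv.ofSurjective expEmb_orthogonal.linearIsometry synth_surjective

theorem yOp_apply (φ : ℝ) (f : L2ZS1) :
    yOp φ f = synthEquiv.symm (smulOp circMeas (negPow φ) (negPow_memLp φ) (synthEquiv f)) := by
  have h : ContinuousLinearMap.adjoint synth = (synthEquiv.symm : _ →L[ℂ] L2ZS1) := by
    refine ((ContinuousLinearMap.eq_adjoint_iff _ _).2 fun f g => ?_).symm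
    change inner ℂ (synthEquiv.symm f) g = inner ℂ f (synthEquiv g)
    rw [← synthEquiv.inner_map_map, synthEquiv.apply_symm_apply]
  rw [yOp, h]
  rfl

theorem negPow_add (φ ψ : ℝ) (θ : Circ) : negPow (φ + ψ) θ = negPow φ θ * negPow ψ θ := by
  rw [negPow, negPow, negPow, ← Complex.exp_add]
  congr 1
  push_cast
  ring

theorem yOp_add (φ ψ : ℝ) : yOp (φ + ψ) = yOp φ * yOp ψ := by
  refine ContinuousLinearMap.ext fun f => ?_
  rw [op_mul_apply, yOp_apply, yOp_apply, yOp_apply, synthEquiv.apply_symm_apply]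
  congr 1
  refine Lp.ext ?_
  filter_upwards [smulOp_coeFn _ _ (negPow_memLp (φ + ψ)) (synthEquiv f),
    smulOp_coeFn _ _ (negPow_memLp φ) (smulOp _ _ (negPow_memLp ψ) (synthEquiv f)),
    smulOp_coeFn _ _ (negPow_memLp ψ) (synthEquiv f)] with θ h1 h2 h3
  rw [h1, h2, h3, negPow_add, mul_smul]

theorem yOp_zero : yOp 0 = 1 := by
  refine ContinuousLinearMap.ext fun f => ?_
  rw [yOp_apply]
  have : smulOp circMeas (negPow 0) (negPow_memLp 0) (synthEquiv f) = synthEquiv f := by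
    refine Lp.ext ?_
    filter_upwards [smulOp_coeFn _ _ (negPow_memLp 0) (synthEquiv f)] with θ h1
    rw [h1]
    simp [negPow]
  rw [this, synthEquiv.symm_apply_apply]
  rfl

theorem yOp_mul_neg (φ : ℝ) : yOp φ * yOp (-φ) = 1 := by
  rw [← yOp_add, add_neg_cancel, yOp_zero]

theorem yOp_neg_mul (φ : ℝ) : yOp (-φ) * yOp φ = 1 := by
  rw [← yOp_add, neg_add_cancel, yOp_zero]

theorem yOp_comm (φ ψ : ℝ) : yOp φ * yOp ψ = yOp ψ * yOp φ := by
  rw [← yOp_add, ← yOp_add, add_comm]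

theorem norm_negPow (φ : ℝ) (θ : Circ) : ‖negPow φ θ‖ = 1 := by
  rw [negPow, Complex.norm_exp]
  simp

theorem norm_yOp_apply (φ : ℝ) (f : L2ZS1) : ‖yOp φ f‖ = ‖f‖ := by
  have hle : ∀ (φ : ℝ) (f : L2ZS1), ‖yOp φ f‖ ≤ ‖f‖ := fun φ f => by
    rw [yOp_apply, LinearIsometryEquiv.norm_map, ← synthEquiv.norm_map f,
      ← one_mul ‖synthEquiv f‖]
    refine Lp.norm_le_mul_norm_of_ae_le_mul ?_
    filter_upwards [smulOp_coeFn _ _ (negPow_memLp φ) (synthEquiv f)] with θ h1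
    rw [h1, norm_smul, norm_negPow]
  refine le_antisymm (hle φ f) ?_
  have := hle (-φ) (yOp φ f)
  rwa [← op_mul_apply (yOp (-φ)), yOp_neg_mul] at this

/-- The operator `Y_φ` as a linear isometry. -/
noncomputable def yIso (φ : ℝ) : L2ZS1 →ₗᵢ[ℂ] L2ZS1 :=
  ⟨(yOp φ : L2ZS1 →ₗ[ℂ] L2ZS1), norm_yOp_apply φ⟩

/-- For integral exponents the choice of the branch of `θ` does not matter. -/
theorem negPow_neg_int (m : ℤ) (θ : Circ) : negPow (-m) θ = fourier m θ := by
  set x := AddCircle.measurableEquivIoc (2 * Real.pi) (-Real.pi) θ with hx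
  have h : ((x : ℝ) : Circ) = θ :=
    (AddCircle.measurableEquivIoc (2 * Real.pi) (-Real.pi)).symm_apply_apply θ
  conv_rhs => rw [← h]
  rw [fourier_coe_apply, negPow, ← hx]
  congr 1
  have : (Real.pi : ℂ) ≠ 0 := by exact_mod_cast Real.pi_ne_zero
  push_cast
  field_simp

/-- For integers `m`, the operator `Y_{-m}` is the shift by `m`. -/
theorem yOp_neg_int_single (m j : ℤ) (v : L2S1) :
    yOp (-m) (lp.single 2 j v) = lp.single 2 (j + m) v := by
  rw [yOp_apply, LinearIsometryEquiv.symm_apply_eq]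
  change smulOp _ _ _ (synth _) = synth _
  rw [synth_single, synth_single, smulOp_tens]
  congr 1
  refine Lp.ext ?_
  filter_upwards [smulOp_coeFn _ _ (negPow_memLp (-m)) (fourierLp (T := 2 * Real.pi) 2 j),
    fourierLp_coeFn j, fourierLp_coeFn (j + m)] with θ h1 h2 h3
  rw [h1, h2, h3, negPow_neg_int, fourier_add, smul_eq_mul, mul_comm]

/-- The operators `Y_φ` act on the variable `θ` dual to `ℤ`, and so commute with operators on
`L²(S¹)`. -/
theorem yOp_mul_constDiag (φ : ℝ) (T : L2S1 →L[ℂ] L2S1) :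
    yOp φ * constDiag T = constDiag T * yOp φ := by
  have h : ∀ f, synthEquiv (constDiag T f) = T.compLpL 2 circMeas (synthEquiv f) := by
    have : synth ∘L constDiag T = T.compLpL 2 circMeas ∘L synth := by
      refine ContinuousLinearMap.ext_on dense_single ?_
      rintro _ ⟨j, v, rfl⟩
      rw [ContinuousLinearMap.comp_apply, ContinuousLinearMap.comp_apply, constDiag, diagOp_single,
        synth_single, synth_single, compLpL_tens]
    exact fun f => DFunLike.congr_fun this f
  refine ContinuousLinearMap.ext fun f => ?_
  rw [op_mul_apply, op_mul_apply,
    ← synthEquiv.injective.eq_iff, h, yOp_apply, yOp_apply, synthEquiv.apply_symm_apply,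
    synthEquiv.apply_symm_apply, h]
  refine Lp.ext ?_
  filter_upwards [smulOp_coeFn _ _ (negPow_memLp φ) (T.compLpL 2 circMeas (synthEquiv f)),
    T.coeFn_compLpL (synthEquiv f),
    T.coeFn_compLpL (smulOp _ _ (negPow_memLp φ) (synthEquiv f)),
    smulOp_coeFn _ _ (negPow_memLp φ) (synthEquiv f)] with θ h1 h2 h3 h4
  rw [h1, h2, h3, h4, map_smul]

/-- On the branch `-π < θ ≤ π` one has `|e^{-iφθ} - e^{-iψθ}| ≤ π |φ - ψ|`. -/
theorem norm_yOp_sub_le (φ ψ : ℝ) : ‖yOp φ - yOp ψ‖ ≤ Real.pi * |φ - ψ| := by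
  refine ContinuousLinearMap.opNorm_le_bound _ (by positivity) fun f => ?_
  rw [_root_.sub_apply, yOp_apply, yOp_apply, ← map_sub, LinearIsometryEquiv.norm_map,
    ← synthEquiv.norm_map f]
  refine Lp.norm_le_mul_norm_of_ae_le_mul ?_
  filter_upwards [Lp.coeFn_sub (smulOp _ _ (negPow_memLp φ) (synthEquiv f))
    (smulOp _ _ (negPow_memLp ψ) (synthEquiv f)),
    smulOp_coeFn _ _ (negPow_memLp φ) (synthEquiv f),
    smulOp_coeFn _ _ (negPow_memLp ψ) (synthEquiv f)] with θ h1 h2 h3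
  rw [h1, Pi.sub_apply, h2, h3, ← sub_smul, norm_smul]
  refine mul_le_mul_of_nonneg_right ?_ (norm_nonneg _)
  set x := AddCircle.measurableEquivIoc (2 * Real.pi) (-Real.pi) θ with hx
  have hx1 : |(x : ℝ)| ≤ Real.pi := abs_le.2 ⟨x.2.1.le, x.2.2.trans (by linarith)⟩
  have h4 : negPow φ θ - negPow ψ θ =
      negPow ψ θ * (Complex.exp (Complex.I * ((-((φ - ψ) * x) : ℝ) : ℂ)) - 1) := by
    rw [mul_sub, mul_one, negPow, negPow, ← hx, ← Complex.exp_add]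
    congr 2
    push_cast
    ring
  rw [h4, norm_mul, norm_negPow, one_mul]
  refine (Real.norm_exp_I_mul_ofReal_sub_one_le).trans ?_
  rw [Real.norm_eq_abs, abs_neg, abs_mul, mul_comm]
  exact mul_le_mul_of_nonneg_right hx1 (abs_nonneg _)

theorem continuous_yOp : Continuous yOp := by
  refine (LipschitzWith.of_dist_le_mul (K := ⟨Real.pi, Real.pi_pos.le⟩) fun φ ψ => ?_).continuous
  rw [dist_eq_norm, Real.dist_eq]
  exact norm_yOp_sub_le φ ψ

theorem continuous_diagOp : Continuous diagOp := ContinuousLinearMap.continuous _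

theorem continuous_shiftedSymbOp (i : Fin 3) : Continuous (shiftedSymbOp i) := by
  refine continuous_diagOp.comp (LipschitzWith.of_dist_le_mul (K := 2) fun φ ψ => ?_).continuous
  rw [dist_eq_norm, Real.dist_eq]
  refine lp.norm_le_of_forall_le (by positivity) fun j => ?_
  refine (norm_symbOp_sub_le i (j - φ) (j - ψ)).trans_eq ?_
  rw [sub_sub_sub_cancel_left, abs_sub_comm]
  rfl

/-- The boundary symbol of `lamOp i` at `e^{2πiφ}`. -/
noncomputable def lamSymb (i : Fin 3) (φ : ℝ) : L2ZS1 →L[ℂ] L2ZS1 :=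
  (yOp φ).comp ((shiftedSymbOp i φ).comp (yOp (-φ)))

theorem lamSymb_eq (i : Fin 3) (φ : ℝ) :
    lamSymb i φ = yOp φ * (shiftedSymbOp i φ * yOp (-φ)) := rfl

theorem continuous_lamSymb (i : Fin 3) : Continuous (lamSymb i) :=
  continuous_yOp.mul ((continuous_shiftedSymbOp i).mul (continuous_yOp.comp continuous_neg))

/-- The operator `Y₁` is a shift, which compensates for the change of `φ` to `φ + 1` in the
diagonal operator. -/
theorem lamSymb_periodic (i : Fin 3) : Function.Periodic (lamSymb i) 1 := fun φ => by
  have h : yOp 1 * (shiftedSymbOp i (φ + 1) * yOp (-1)) = shiftedSymbOp i φ := by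
    refine lp_ext_single fun j v => ?_
    have h1 : yOp (-1) (lp.single 2 j v) = lp.single 2 (j + 1) v := by
      simpa using yOp_neg_int_single 1 j v
    have h2 : ∀ w, yOp 1 (lp.single 2 (j + 1) w) = lp.single 2 j w := fun w => by
      simpa using yOp_neg_int_single (-1) (j + 1) w
    rw [op_mul_apply, op_mul_apply, h1, shiftedSymbOp_single,
      h2, shiftedSymbOp_single]
    congr 3
    push_cast
    ring
  rw [lamSymb_eq, lamSymb_eq, yOp_add, neg_add_rev, yOp_add, ← h]
  simp only [mul_assoc]

/-- The angle `φ` of a point `z = e^{2πiφ}` of the circle. -/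
noncomputable def angle (z : Circle) : ℝ := Complex.arg z / (2 * Real.pi)

/-- A function of period one does not see the choice of the angle. -/
theorem periodic_angle {α : Type*} {f : ℝ → α} (hf : Function.Periodic f 1) (φ : ℝ) :
    f (angle (Circle.exp (2 * Real.pi * φ))) = f φ := by
  have h := Circle.exp_arg (Circle.exp (2 * Real.pi * φ))
  obtain ⟨m, hm⟩ := Circle.exp_eq_exp.1 h
  have h2 : angle (Circle.exp (2 * Real.pi * φ)) = φ + m * 1 := by
    rw [angle, hm]
    field_simp
  rw [h2]
  exact (hf.int_mul m) φ

/-- Although the angle is discontinuous, its composition with a continuous periodic function is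
continuous, because `φ ↦ e^{2πiφ}` is a quotient map. -/
theorem continuous_comp_angle {α : Type*} [TopologicalSpace α] {f : ℝ → α} (hf : Continuous f)
    (hp : Function.Periodic f 1) : Continuous fun z => f (angle z) := by
  have hq : IsQuotientMap Circle.exp := isLocalHomeomorph_circleExp.isOpenMap.isQuotientMap
    Circle.exp.continuous fun z => ⟨_, Circle.exp_arg z⟩
  refine hq.continuous_iff.2 ?_
  have : (fun z => f (angle z)) ∘ Circle.exp = fun t => f (t / (2 * Real.pi)) := by
    funext t
    have := periodic_angle hp (t / (2 * Real.pi))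
    rwa [mul_div_cancel₀ _ Real.two_pi_pos.ne'] at this
  rw [this]
  fun_prop

/-! ### The boundary symbol -/

/-- The wave packets for a boundary point `(z, ±1)`; the factor `Y_{-φ}` makes the limit operators
depend on `z = e^{2πiφ}` only. -/
noncomputable def boundaryPacket (x : Bd) (n : ℕ) : L2ZS1 →ₗᵢ[ℂ] L2Cyl :=
  (bloch (angle x.1) x.2 n).comp (yIso (-angle x.1))

/-- Composing the wave packets with a unitary operator conjugates the limit operator. -/
theorem isLimit_conj {φ : ℝ} {s : ℤˣ} {A : L2Cyl →L[ℂ] L2Cyl} {B : L2ZS1 →L[ℂ] L2ZS1}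
    (h : IsLimit (bloch φ s) A B) :
    IsLimit (fun n => (bloch φ s n).comp (yIso (-φ))) A (yOp φ * (B * yOp (-φ))) := fun f => by
  refine (h (yOp (-φ) f)).congr fun n => ?_
  have h1 : yOp (-φ) (yOp φ (B (yOp (-φ) f))) = B (yOp (-φ) f) := by
    rw [← op_mul_apply (yOp (-φ)), yOp_neg_mul]
    rfl
  change _ = A (bloch φ s n (yOp (-φ) f)) - bloch φ s n (yOp (-φ) (yOp φ (B (yOp (-φ) f))))
  rw [h1]

/-- A criterion for `B` to be the boundary symbol of `A`. -/
theorem mem_boundaryGraph {A : L2Cyl →L[ℂ] L2Cyl} {B : C(Bd, L2ZS1 →L[ℂ] L2ZS1)}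
    {D D' : ℝ → ℤˣ → (L2ZS1 →L[ℂ] L2ZS1)} (h : ∀ φ s, IsLimit (bloch φ s) A (D φ s))
    (h' : ∀ φ s, IsLimit (bloch φ s) (star A) (D' φ s))
    (hB : ∀ z s, B (z, s) = yOp (angle z) * (D (angle z) s * yOp (-angle z))) :
    (A, B) ∈ symbolGraph boundaryPacket := by
  rintro ⟨z, s⟩
  have h1 : IsLimit (boundaryPacket (z, s)) A (B (z, s)) := by
    rw [hB]
    exact isLimit_conj (h (angle z) s)
  have h2 : IsLimit (boundaryPacket (z, s)) (star A) _ := isLimit_conj (h' (angle z) s)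
  exact ⟨h1, h1.star_eq h2 ▸ h2⟩

theorem mulBeta_mem_graph (a : C(Circ, ℂ)) :
    (mulBeta a, ContinuousMap.const Bd (constDiag (circMul a))) ∈ symbolGraph boundaryPacket :=
  mem_boundaryGraph (fun φ s => isLimit_mulBeta φ s a)
    (fun φ s => by
      rw [star_mulBeta]
      exact isLimit_mulBeta φ s _)
    fun z s => by
      rw [← mul_assoc, yOp_mul_constDiag, mul_assoc, yOp_mul_neg, mul_one]
      rfl

/-- The boundary values of `b ∈ C([-∞, +∞])`. -/
noncomputable def boundaryValue (b : C(EReal, ℂ)) (s : ℤˣ) : ℂ := b (if s = 1 then ⊤ else ⊥)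

theorem mulT_mem_graph (b : C(EReal, ℂ)) :
    (mulT b, (⟨fun x => boundaryValue b x.2 • ContinuousLinearMap.id ℂ L2ZS1,
      ((continuous_of_discreteTopology (f := boundaryValue b)).comp continuous_snd).smul
        continuous_const⟩ : C(Bd, L2ZS1 →L[ℂ] L2ZS1))) ∈ symbolGraph boundaryPacket :=
  mem_boundaryGraph (fun φ s => isLimit_mulT φ s b)
    (fun φ s => by
      rw [star_mulT]
      exact isLimit_mulT φ s _)
    fun z s => by
      change _ = yOp (angle z) * ((boundaryValue b s • (1 : L2ZS1 →L[ℂ] L2ZS1)) * yOp (-angle z))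
      rw [smul_mul_assoc, one_mul, mul_smul_comm, yOp_mul_neg]
      rfl

theorem mulExp_mem_graph (m : ℤ) :
    (mulExp m, ContinuousMap.const Bd (yOp (-m))) ∈ symbolGraph boundaryPacket :=
  mem_boundaryGraph (fun φ s => isLimit_mulExp φ s m (yOp_neg_int_single m))
    (fun φ s => by
      rw [star_mulExp]
      exact isLimit_mulExp φ s _ (yOp_neg_int_single (-m)))
    fun z s => by
      rw [← mul_assoc, yOp_comm, mul_assoc, yOp_mul_neg, mul_one]
      rfl

/-- The boundary symbol of `lamOp i` as a function on `S¹ × {-1, +1}`. -/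
noncomputable def lamSymbFun (i : Fin 3) : C(Bd, L2ZS1 →L[ℂ] L2ZS1) :=
  ⟨fun x => lamSymb i (angle x.1),
    (continuous_comp_angle (continuous_lamSymb i) (lamSymb_periodic i)).comp continuous_fst⟩

theorem lamOp_mem_graph (i : Fin 3) : (lamOp i, lamSymbFun i) ∈ symbolGraph boundaryPacket :=
  mem_boundaryGraph (fun φ s => isLimit_lamOp φ s i)
    (fun φ s => by
      rw [star_lamOp]
      exact isLimit_lamOp φ s i)
    fun _ _ => rfl

/-- The family of limit operators defines the homomorphism `γ`. -/
theorem exists_boundarySymbol : ∃ γ : cylAlg →⋆ₐ[ℂ] C(Bd, L2ZS1 →L[ℂ] L2ZS1),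
    ∀ A : cylAlg, ((A : L2Cyl →L[ℂ] L2Cyl), γ A) ∈ symbolGraph boundaryPacket := by
  refine exists_symbol boundaryPacket generators fun A hA => ?_
  rcases hA with ((⟨a, -, rfl⟩ | ⟨b, rfl⟩) | ⟨m, rfl⟩) | ⟨i, rfl⟩
  · exact ⟨_, mulBeta_mem_graph a⟩
  · exact ⟨_, mulT_mem_graph b⟩
  · exact ⟨_, mulExp_mem_graph m⟩
  · exact ⟨_, lamOp_mem_graph i⟩

/-- Limits being unique, the homomorphism has the prescribed values on the generators. -/
theorem isBoundarySymbol_of_graph {γ : cylAlg →⋆ₐ[ℂ] C(Bd, L2ZS1 →L[ℂ] L2ZS1)}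
    (hγ : ∀ A : cylAlg, ((A : L2Cyl →L[ℂ] L2Cyl), γ A) ∈ symbolGraph boundaryPacket) :
    IsBoundarySymbol γ where
  mulBeta a A _ hA z s := by
    have h := hγ A
    rw [hA] at h
    rw [symbolGraph_unique h (mulBeta_mem_graph a)]
    rfl
  mulT_pos b A hA z := by
    have h := hγ A
    rw [hA] at h
    rw [symbolGraph_unique h (mulT_mem_graph b)]
    rfl
  mulT_neg b A hA z := by
    have h := hγ A
    rw [hA] at h
    rw [symbolGraph_unique h (mulT_mem_graph b)]
    rfl
  mulExp j A hA z s := by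
    have h := hγ A
    rw [hA] at h
    rw [symbolGraph_unique h (mulExp_mem_graph j)]
    rfl
  lamOp i A hA φ s := by
    have h := hγ A
    rw [hA] at h
    rw [symbolGraph_unique h (lamOp_mem_graph i)]
    exact periodic_angle (lamSymb_periodic i) φ

/-- The boundary symbol of a compact operator vanishes. -/
theorem boundarySymbol_compact {γ : cylAlg →⋆ₐ[ℂ] C(Bd, L2ZS1 →L[ℂ] L2ZS1)}
    (hγ : ∀ A : cylAlg, ((A : L2Cyl →L[ℂ] L2Cyl), γ A) ∈ symbolGraph boundaryPacket)
    {A : cylAlg} (hA : A ∈ compactIdeal) : γ A = 0 :=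
  ContinuousMap.ext fun x => (hγ A x).1.eq_zero_of_isCompactOperator hA fun f g =>
    tendsto_inner_bloch (angle x.1) x.2 (yOp (-angle x.1) f) g

end CylinderAlgebra

end

section

open Filter Topology MeasureTheory CylinderAlgebra

namespace CylinderAlgebra
open LimitOperator

/-! ### Compactness of weighted shifts -/

section WeightedShift

variable {H ι : Type*} [NormedAddCommGroup H] [InnerProductSpace ℂ H]

/-- An operator that sends an orthonormal basis to multiples of an orthonormal family is bounded
by the supremum of the factors. -/
theorem norm_le_of_weighted (b : HilbertBasis ι ℂ H) {b' : ι → H} (hb' : Orthonormal ℂ b')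
    {c : ι → ℂ} {ε : ℝ} (hε : 0 ≤ ε) (hc : ∀ i, ‖c i‖ ≤ ε) {T : H →L[ℂ] H}
    (hT : ∀ i, T (b i) = c i • b' i) : ‖T‖ ≤ ε := by
  refine T.opNorm_le_bound hε fun f => ?_
  have h1 := b.hasSum_repr f
  have h2 : Tendsto (fun s : Finset ι => ‖T (∑ i ∈ s, b.repr f i • b i)‖) atTop (𝓝 ‖T f‖) :=
    ((T.continuous.tendsto f).comp h1).norm
  have h3 : Tendsto (fun s : Finset ι => ε * ‖∑ i ∈ s, b.repr f i • b i‖) atTop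
      (𝓝 (ε * ‖f‖)) := h1.norm.const_mul ε
  refine le_of_tendsto_of_tendsto' h2 h3 fun s => ?_
  have hn : ∀ {e : ι → H} (_ : Orthonormal ℂ e) (a : ι → ℂ),
      ‖∑ i ∈ s, a i • e i‖ ^ 2 = ∑ i ∈ s, ‖a i‖ ^ 2 := fun {e} he a => by
    have := he.inner_sum a a s
    rw [inner_self_eq_norm_sq_to_K] at this
    have h4 : ∀ i, (starRingEnd ℂ) (a i) * a i = ((‖a i‖ ^ 2 : ℝ) : ℂ) := fun i => by
      rw [RCLike.conj_mul]
      norm_cast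
    simp only [h4] at this
    refine Complex.ofReal_injective ?_
    rw [Complex.ofReal_sum, ← this]
    simp
  refine le_of_sq_le_sq ?_ (by positivity)
  rw [map_sum]
  simp only [map_smul, hT, smul_smul]
  rw [mul_pow, hn hb', hn b.orthonormal, Finset.mul_sum]
  refine Finset.sum_le_sum fun i _ => ?_
  rw [norm_mul, mul_pow, mul_comm]
  gcongr
  exact hc i

theorem isCompactOperator_of_finiteDimensional_range {E F : Type*} [NormedAddCommGroup E]
    [NormedSpace ℂ E] [NormedAddCommGroup F] [NormedSpace ℂ F] (T : E →L[ℂ] F)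
    (h : FiniteDimensional ℂ (T : E →ₗ[ℂ] F).range) : IsCompactOperator T := by
  let T' : E →L[ℂ] (T : E →ₗ[ℂ] F).range := T.codRestrict _ fun x => ⟨x, rfl⟩
  have : IsCompactOperator T' := by
    have := FiniteDimensional.proper ℂ (T : E →ₗ[ℂ] F).range
    exact (isCompactOperator_id_iff_locallyCompactSpace.2 inferInstance).comp_clm T'
  exact this.clm_comp (T : E →ₗ[ℂ] F).range.subtypeL

/-- A weighted shift with weights tending to zero is compact, as the norm limit of its
finite-rank truncations. -/
theorem isCompactOperator_of_weighted [CompleteSpace H] (b : HilbertBasis ι ℂ H) {b' : ι → H}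
    (hb' : Orthonormal ℂ b') {c : ι → ℂ} (hc : Tendsto c cofinite (𝓝 0)) {T : H →L[ℂ] H}
    (hT : ∀ i, T (b i) = c i • b' i) : IsCompactOperator T := by
  classical
  let R : Finset ι → H →L[ℂ] H := fun s =>
    ∑ i ∈ s, (innerSL ℂ (b i)).smulRight (c i • b' i)
  have hR : ∀ s, IsCompactOperator (R s) := fun s => by
    refine isCompactOperator_of_finiteDimensional_range _ ?_
    have : FiniteDimensional ℂ (Submodule.span ℂ ((s.image fun i => c i • b' i : Finset H) :
      Set H)) := FiniteDimensional.span_finset ℂ _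
    refine Submodule.finiteDimensional_of_le (S₂ := Submodule.span ℂ
      ((s.image fun i => c i • b' i : Finset H) : Set H)) ?_
    rintro _ ⟨f, rfl⟩
    simp only [R, ContinuousLinearMap.coe_coe, _root_.sum_apply]
    refine Submodule.sum_mem _ fun i hi => Submodule.smul_mem _ _ (Submodule.subset_span ?_)
    exact Finset.mem_coe.2 (Finset.mem_image_of_mem _ hi)
  refine isCompactOperator_of_tendsto (l := atTop) (F := R) ?_ (Eventually.of_forall hR)
  rw [Metric.tendsto_nhds]
  intro ε hε
  have hfin : {i | ¬ ‖c i‖ < ε / 2}.Finite := by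
    have := (tendsto_zero_iff_norm_tendsto_zero.1 hc).eventually (gt_mem_nhds (half_pos hε))
    exact this
  filter_upwards [eventually_ge_atTop hfin.toFinset] with s hs
  rw [dist_comm, dist_eq_norm]
  refine lt_of_le_of_lt ?_ (half_lt_self hε)
  refine norm_le_of_weighted b hb' (c := fun i => if i ∈ s then 0 else c i) (half_pos hε).le
    (fun i => ?_) fun i => ?_
  · by_cases hi : i ∈ s
    · simpa [hi] using (half_pos hε).le
    · simp only [hi, if_false]
      by_contra hlt
      exact hi (hs (hfin.mem_toFinset.2 fun h => hlt h.le))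
  · have hin : ∀ j, inner ℂ (b j) (b i) = if j = i then (1 : ℂ) else 0 :=
      fun j => orthonormal_iff_ite.1 b.orthonormal j i
    simp only [R, _root_.sub_apply, hT, _root_.sum_apply,
      ContinuousLinearMap.smulRight_apply, innerSL_apply_apply, hin, ite_smul, one_smul, zero_smul,
      Finset.sum_ite_eq']
    by_cases hi : i ∈ s <;> simp [hi]

/-- The commutator of a diagonal operator with a shift is compact if the symbol of the diagonal
operator varies slowly at infinity. -/
theorem isCompactOperator_commutator [CompleteSpace H] {ι : Type*} [AddGroup ι]
    (b : HilbertBasis ι ℂ H) (q : ι) {σ : ι → ℂ}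
    (hσ : Tendsto (fun p => σ (p + q) - σ p) cofinite (𝓝 0)) {S U : H →L[ℂ] H}
    (hS : ∀ p, S (b p) = σ p • b p) (hU : ∀ p, U (b p) = b (p + q)) :
    IsCompactOperator (S * U - U * S) := by
  refine isCompactOperator_of_weighted b (b' := fun p => b (p + q))
    (b.orthonormal.comp _ (add_left_injective q)) hσ fun p => ?_
  rw [_root_.sub_apply, op_mul_apply, op_mul_apply, hU, hS, hS, map_smul, hU, sub_smul]

end WeightedShift

/-! ### Commutators of the boundary values of the generators -/

theorem rad_sub_rad_le (τ σ : ℝ) (k l : ℤ) :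
    |√(1 + τ ^ 2 + (k : ℝ) ^ 2) - √(1 + σ ^ 2 + (l : ℝ) ^ 2)| ≤ |τ - σ| + |(k : ℝ) - l| := by
  have h1 := one_le_rad τ k
  have h2 := one_le_rad σ l
  have h3 := le_rad 1 τ k
  have h4 := le_rad 1 σ l
  have h5 := le_rad 2 τ k
  have h6 := le_rad 2 σ l
  simp only [Matrix.cons_val_one, Matrix.cons_val_zero, Matrix.cons_val] at h3 h4 h5 h6
  set r := √(1 + τ ^ 2 + (k : ℝ) ^ 2) with hr
  set s := √(1 + σ ^ 2 + (l : ℝ) ^ 2) with hs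
  have hr2 : r ^ 2 = 1 + τ ^ 2 + (k : ℝ) ^ 2 := Real.sq_sqrt (by positivity)
  have hs2 : s ^ 2 = 1 + σ ^ 2 + (l : ℝ) ^ 2 := Real.sq_sqrt (by positivity)
  have key : |r - s| * (r + s) = |(τ - σ) * (τ + σ) + ((k : ℝ) - l) * (k + l)| := by
    rw [show r + s = |r + s| from (abs_of_pos (by linarith)).symm, ← abs_mul]
    congr 1
    linear_combination hr2 - hs2
  have h7 : |τ + σ| ≤ r + s := (abs_add_le _ _).trans (add_le_add h3 h4)
  have h8 : |(k : ℝ) + l| ≤ r + s := (abs_add_le _ _).trans (add_le_add h5 h6)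
  refine le_of_mul_le_mul_right ?_ (show 0 < r + s by linarith)
  rw [key, add_mul]
  refine (abs_add_le _ _).trans ?_
  rw [abs_mul, abs_mul]
  gcongr

/-- The symbols vary slowly at infinity: their increments decay like the inverse of
`√(1 + τ² + k²)`. -/
theorem abs_symb_sub_symb_le (i : Fin 3) (τ σ : ℝ) (k l : ℤ) :
    |symb i τ k - symb i σ l| ≤
      2 * (|τ - σ| + |(k : ℝ) - l|) * (√(1 + τ ^ 2 + (k : ℝ) ^ 2))⁻¹ := by
  have h1 := one_le_rad τ k
  have h2 := one_le_rad σ l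
  have h3 := le_rad i σ l
  have h4 := rad_sub_rad_le σ τ l k
  rw [abs_sub_comm σ τ, abs_sub_comm (l : ℝ) k] at h4
  have h7 : |![1, τ, (k : ℝ)] i - ![1, σ, (l : ℝ)] i| ≤ |τ - σ| + |(k : ℝ) - l| := by
    fin_cases i
    · simpa using add_nonneg (abs_nonneg (τ - σ)) (abs_nonneg ((k : ℝ) - l))
    · simp
    · simp
  simp only [symb]
  set r := √(1 + τ ^ 2 + (k : ℝ) ^ 2) with hr
  set s := √(1 + σ ^ 2 + (l : ℝ) ^ 2) with hs
  generalize ![1, τ, (k : ℝ)] i = a at *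
  generalize ![1, σ, (l : ℝ)] i = b at *
  have hr0 : 0 < r := by linarith
  have hs0 : 0 < s := by linarith
  have e : a / r - b / s = ((a - b) + (b / s) * (s - r)) * r⁻¹ := by
    field_simp
    ring
  have hb : |b / s| ≤ 1 := by
    rw [abs_div, abs_of_pos hs0, div_le_one hs0]
    exact h3
  rw [e, abs_mul, abs_of_pos (inv_pos.2 hr0)]
  refine mul_le_mul_of_nonneg_right ?_ (inv_pos.2 hr0).le
  refine (abs_add_le _ _).trans ?_
  rw [abs_mul]
  nlinarith [abs_nonneg (s - r), abs_nonneg (b / s)]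

theorem tendsto_inv_rad (φ : ℝ) :
    Tendsto (fun p : ℤ × ℤ => (√(1 + (p.1 - φ) ^ 2 + (p.2 : ℝ) ^ 2))⁻¹) cofinite (𝓝 0) := by
  refine tendsto_inv_atTop_zero.comp (tendsto_atTop.2 fun C => ?_)
  refine ((Set.finite_Icc ⌊φ - C⌋ ⌈φ + C⌉).prod (Set.finite_Icc ⌊-C⌋ ⌈C⌉)).subset fun p hp => ?_
  have hp' : √(1 + (p.1 - φ) ^ 2 + (p.2 : ℝ) ^ 2) ≤ C :=
    (not_le.1 (show ¬ C ≤ √(1 + (p.1 - φ) ^ 2 + (p.2 : ℝ) ^ 2) from hp)).le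
  have h1 := abs_le.1 ((le_rad 1 (p.1 - φ) p.2).trans hp')
  have h2 := abs_le.1 ((le_rad 2 (p.1 - φ) p.2).trans hp')
  simp only [Matrix.cons_val_one, Matrix.cons_val_zero, Matrix.cons_val] at h1 h2
  refine ⟨⟨?_, ?_⟩, ?_, ?_⟩
  · exact_mod_cast (Int.floor_le _).trans (by linarith : φ - C ≤ p.1)
  · exact_mod_cast (by linarith : (p.1 : ℝ) ≤ φ + C).trans (Int.le_ceil _)
  · exact_mod_cast (Int.floor_le _).trans h2.1
  · exact_mod_cast h2.2.trans (Int.le_ceil _)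

/-- The increments of the symbol by a fixed vector `q` of the lattice tend to zero at infinity. -/
theorem tendsto_symb_sub (i : Fin 3) (φ : ℝ) (q : ℤ × ℤ) :
    Tendsto (fun p : ℤ × ℤ => (symb i ((p + q).1 - φ) (p + q).2 : ℂ) - (symb i (p.1 - φ) p.2 : ℂ))
      cofinite (𝓝 0) := by
  have h := (tendsto_inv_rad φ).const_mul (2 * (|(q.1 : ℝ)| + |(q.2 : ℝ)|))
  rw [mul_zero] at h
  refine squeeze_zero_norm (fun p => ?_) h
  rw [← Complex.ofReal_sub, Complex.norm_real, norm_sub_rev]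
  have := abs_symb_sub_symb_le i (p.1 - φ) ((p + q).1 - φ) p.2 (p + q).2
  have h1 : (p.1 - φ) - (((p + q).1 : ℤ) - φ) = -(q.1 : ℝ) := by
    rw [Prod.fst_add]
    push_cast
    ring
  have h2 : (p.2 : ℝ) - ((p + q).2 : ℤ) = -(q.2 : ℝ) := by
    rw [Prod.snd_add]
    push_cast
    ring
  rw [h1, h2, abs_neg, abs_neg] at this
  exact this

theorem orthonormal_single : Orthonormal ℂ fun p : ℤ × ℤ =>
    (lp.single 2 p.1 (fourierBasis (T := 2 * Real.pi) p.2) : L2ZS1) := by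
  rw [orthonormal_iff_ite]
  rintro ⟨j, k⟩ ⟨j', k'⟩
  rw [lp.inner_single_left]
  by_cases h : j = j'
  · subst h
    simp only [lp.single_apply_self]
    rw [orthonormal_iff_ite.1 (fourierBasis (T := 2 * Real.pi)).orthonormal]
    simp
  · rw [lp.single_apply_ne _ _ _ h, inner_zero_right, if_neg]
    simp [h]

/-- The Hilbert basis `(j, k) ↦ δ_j ⊗ e^{ikβ}` of `L²(ℤ × S¹)`. -/
noncomputable def zsBasis : HilbertBasis (ℤ × ℤ) ℂ L2ZS1 :=
  HilbertBasis.mk orthonormal_single (by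
    rw [← Submodule.dense_iff_topologicalClosure_eq_top.1 dense_single]
    refine Submodule.topologicalClosure_minimal _ (Submodule.span_le.2 ?_)
      (Submodule.isClosed_topologicalClosure _)
    rintro _ ⟨j, v, rfl⟩
    have hv : v ∈
        (Submodule.span ℂ (Set.range (fourierBasis (T := 2 * Real.pi)))).topologicalClosure := by
      rw [(fourierBasis (T := 2 * Real.pi)).dense_span]
      trivial
    have hc : Continuous fun v : L2S1 => (lp.single 2 j v : L2ZS1) :=
      (lp.singleContinuousLinearMap ℂ (fun _ : ℤ => L2S1) 2 j).continuous
    refine map_mem_closure hc hv fun w hw => ?_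
    refine Submodule.span_induction ?_ ?_ ?_ ?_ hw
    · rintro _ ⟨k, rfl⟩
      exact Submodule.subset_span ⟨(j, k), rfl⟩
    · rw [lp.single_zero]
      exact Submodule.zero_mem _
    · intro x y _ _ hx hy
      rw [lp.single_add]
      exact Submodule.add_mem _ hx hy
    · intro c x _ hx
      rw [lp.single_smul]
      exact Submodule.smul_mem _ c hx)

theorem zsBasis_apply (p : ℤ × ℤ) :
    zsBasis p = lp.single 2 p.1 (fourierBasis (T := 2 * Real.pi) p.2) := by
  rw [zsBasis, HilbertBasis.coe_mk]

theorem symbOp_fourierBasis (i : Fin 3) (τ : ℝ) (k : ℤ) :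
    symbOp i τ (fourierBasis k) = (symb i τ k : ℂ) • fourierBasis (T := 2 * Real.pi) k := by
  refine (fourierBasis (T := 2 * Real.pi)).repr.injective (lp.ext (funext fun l => ?_))
  rw [symbOp, circMult_repr, map_smul, HilbertBasis.repr_self]
  by_cases h : l = k
  · subst h
    rfl
  · have h1 : (lp.single 2 k (1 : ℂ) : lp (fun _ : ℤ => ℂ) 2) l = 0 :=
      lp.single_apply_ne _ _ _ h
    change _ * _ = (symb i τ k : ℂ) * (lp.single 2 k (1 : ℂ) : lp (fun _ : ℤ => ℂ) 2) l
    rw [h1, mul_zero, mul_zero]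

theorem circMul_fourier_basis (l k : ℤ) :
    circMul (fourier l) (fourierBasis (T := 2 * Real.pi) k) = fourierBasis (k + l) := by
  rw [coe_fourierBasis]
  refine Lp.ext ?_
  refine (smulOp_coeFn _ _ _ _).trans ?_
  filter_upwards [fourierLp_coeFn k, fourierLp_coeFn (k + l)] with θ h1 h2
  rw [h1, h2, fourier_add, smul_eq_mul, mul_comm]

theorem shiftedSymbOp_basis (i : Fin 3) (φ : ℝ) (p : ℤ × ℤ) :
    shiftedSymbOp i φ (zsBasis p) = (symb i (p.1 - φ) p.2 : ℂ) • zsBasis p := by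
  rw [zsBasis_apply, shiftedSymbOp, diagOp_single, ← lp.single_smul]
  congr 1
  exact symbOp_fourierBasis i _ _

/-- Multiplication by `e^{ilβ}` is a shift of the lattice `ℤ × ℤ`. -/
theorem constDiag_fourier_basis (l : ℤ) (p : ℤ × ℤ) :
    constDiag (circMul (fourier l)) (zsBasis p) = zsBasis (p + (0, l)) := by
  rw [zsBasis_apply, zsBasis_apply, constDiag, diagOp_single]
  simp only [Prod.fst_add, Prod.snd_add, add_zero]
  congr 1
  exact circMul_fourier_basis l _

/-- The operator `Y_{-m}` is a shift of the lattice `ℤ × ℤ`. -/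
theorem yOp_basis (m : ℤ) (p : ℤ × ℤ) : yOp (-m) (zsBasis p) = zsBasis (p + (m, 0)) := by
  rw [zsBasis_apply, zsBasis_apply, yOp_neg_int_single]
  simp only [Prod.fst_add, Prod.snd_add, add_zero]

/-- The map `a ↦ a(β)` to the multiplication operators on `L²(S¹)`, as a continuous linear map. -/
noncomputable def circMulL : C(Circ, ℂ) →L[ℂ] L2S1 →L[ℂ] L2S1 :=
  ((ContinuousLinearMap.lsmul ℂ ℂ : ℂ →L[ℂ] ℂ →L[ℂ] ℂ).holderL circMeas ⊤ 2 2).comp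
    (ContinuousMap.toLp ⊤ circMeas ℂ)

theorem circMulL_apply (a : C(Circ, ℂ)) : circMulL a = circMul a := by
  refine ContinuousLinearMap.ext fun f => Lp.ext ?_
  have h1 := ContinuousLinearMap.coeFn_holder (r := 2)
    (ContinuousLinearMap.lsmul ℂ ℂ : ℂ →L[ℂ] ℂ →L[ℂ] ℂ) (ContinuousMap.toLp ⊤ circMeas ℂ a) f
  refine h1.trans (EventuallyEq.trans ?_ (smulOp_coeFn _ _ _ _).symm)
  filter_upwards [ContinuousMap.coeFn_toLp (p := ⊤) (𝕜 := ℂ) circMeas a] with x hx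
  rw [hx]
  rfl

theorem constDiag_single (A : L2S1 →L[ℂ] L2S1) (j : ℤ) (v : L2S1) :
    constDiag A (lp.single 2 j v) = lp.single 2 j (A v) :=
  diagOp_single _ _ _

theorem continuous_constDiag : Continuous constDiag := by
  refine continuous_diagOp.comp (LipschitzWith.of_dist_le_mul (K := 1) fun A B => ?_).continuous
  rw [dist_eq_norm, dist_eq_norm, NNReal.coe_one, one_mul]
  exact lp.norm_le_of_forall_le (norm_nonneg _) fun _ => le_rfl

/-- The map `a ↦ a(β)` to the multiplication operators on `L²(ℤ × S¹)`, as a linear map. -/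
noncomputable def constDiagCircMul : C(Circ, ℂ) →ₗ[ℂ] L2ZS1 →L[ℂ] L2ZS1 where
  toFun a := constDiag (circMulL a)
  map_add' a b := by
    refine lp_ext_single fun j v => ?_
    rw [add_apply, constDiag_single, constDiag_single, constDiag_single, map_add, add_apply,
      lp.single_add]
  map_smul' c a := by
    refine lp_ext_single fun j v => ?_
    rw [_root_.smul_apply, constDiag_single, constDiag_single, map_smul, _root_.smul_apply,
      lp.single_smul]
    rfl

theorem constDiagCircMul_apply (a : C(Circ, ℂ)) :
    constDiagCircMul a = constDiag (circMul a) := by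
  rw [← circMulL_apply]
  rfl

theorem continuous_constDiagCircMul : Continuous constDiagCircMul :=
  continuous_constDiag.comp circMulL.continuous

/-- Two operators that commute up to a compact operator. -/
def EssCommute {H : Type*} [NormedAddCommGroup H] [NormedSpace ℂ H] (S T : H →L[ℂ] H) : Prop :=
  IsCompactOperator (S * T - T * S)

section EssCommute

variable {H : Type*} [NormedAddCommGroup H] [NormedSpace ℂ H] {S T T' U V : H →L[ℂ] H}

theorem EssCommute.symm (h : EssCommute S T) : EssCommute T S := by
  unfold EssCommute
  rw [← neg_sub]
  exact IsCompactOperator.neg h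

theorem Commute.essCommute (h : S * T = T * S) : EssCommute S T := by
  unfold EssCommute
  rw [h, sub_self]
  exact isCompactOperator_zero

theorem EssCommute.add (h : EssCommute S T) (h' : EssCommute S T') : EssCommute S (T + T') := by
  unfold EssCommute
  rw [mul_add, add_mul, add_sub_add_comm]
  exact IsCompactOperator.add h h'

theorem EssCommute.mul (h : EssCommute S T) (h' : EssCommute S T') : EssCommute S (T * T') := by
  have e : S * (T * T') - T * T' * S = (S * T - T * S) * T' + T * (S * T' - T' * S) := by
    noncomm_ring
  unfold EssCommute
  rw [e]
  exact IsCompactOperator.add (IsCompactOperator.comp_clm h T') (IsCompactOperator.clm_comp h' T)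

theorem EssCommute.smul (c : ℂ) (h : EssCommute S T) : EssCommute S (c • T) := by
  unfold EssCommute
  rw [mul_smul_comm, smul_mul_assoc, ← smul_sub]
  exact IsCompactOperator.smul h c

theorem EssCommute.conj (h : EssCommute S U) (h1 : V * U = U * V) (h2 : T * U = U * T) :
    EssCommute (V * (S * T)) U := by
  have e : V * (S * T) * U - U * (V * (S * T)) = V * ((S * U - U * S) * T) := by
    rw [mul_assoc V, mul_assoc S, h2, ← mul_assoc U, ← h1, sub_mul, mul_sub]
    simp only [mul_assoc]
  unfold EssCommute
  rw [e]
  exact IsCompactOperator.clm_comp (IsCompactOperator.comp_clm h T) V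

theorem isClosed_essCommute [CompleteSpace H] (S : H →L[ℂ] H) :
    IsClosed {T | EssCommute S T} :=
  isClosed_setOfPred_isCompactOperator.preimage
    ((continuous_const.mul continuous_id).sub (continuous_id.mul continuous_const))

end EssCommute

/-- The diagonal operators with slowly varying symbol essentially commute with every shift of the
lattice `ℤ × ℤ`. -/
theorem essCommute_shifted_of_shift {φ : ℝ} (i : Fin 3) {U : L2ZS1 →L[ℂ] L2ZS1} (q : ℤ × ℤ)
    (hU : ∀ p, U (zsBasis p) = zsBasis (p + q)) : EssCommute (shiftedSymbOp i φ) U :=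
  isCompactOperator_commutator zsBasis q (σ := fun p : ℤ × ℤ => (symb i (p.1 - φ) p.2 : ℂ))
    (tendsto_symb_sub i φ q) (shiftedSymbOp_basis i φ) hU

/-- Multiplication by `e^{ilβ}` is a shift of the lattice; the case of a continuous function
follows, as trigonometric polynomials are dense. -/
theorem essCommute_shifted_constDiag (i : Fin 3) (φ : ℝ) (a : C(Circ, ℂ)) :
    EssCommute (shiftedSymbOp i φ) (constDiag (circMul a)) := by
  let M : Submodule ℂ C(Circ, ℂ) :=
    { carrier := {a | EssCommute (shiftedSymbOp i φ) (constDiagCircMul a)}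
      add_mem' := fun {a b} ha hb => by
        change EssCommute _ (constDiagCircMul (a + b))
        rw [map_add]
        exact EssCommute.add ha hb
      zero_mem' := by
        change EssCommute _ (constDiagCircMul 0)
        rw [map_zero]
        exact Commute.essCommute (by rw [mul_zero, zero_mul])
      smul_mem' := fun c a ha => by
        change EssCommute _ (constDiagCircMul (c • a))
        rw [map_smul]
        exact EssCommute.smul c ha }
  have hM : IsClosed (M : Set C(Circ, ℂ)) :=
    (isClosed_essCommute (shiftedSymbOp i φ)).preimage continuous_constDiagCircMul
  have h : (Submodule.span ℂ (Set.range (fourier (T := 2 * Real.pi)))).topologicalClosure ≤ M := by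
    refine Submodule.topologicalClosure_minimal _ (Submodule.span_le.2 ?_) hM
    rintro _ ⟨l, rfl⟩
    change EssCommute _ (constDiagCircMul (fourier l))
    rw [constDiagCircMul_apply]
    exact essCommute_shifted_of_shift i (0, l) (constDiag_fourier_basis l)
  rw [span_fourier_closure_eq_top] at h
  rw [← constDiagCircMul_apply]
  exact h (Submodule.mem_top (x := a))

theorem essCommute_shifted_yOp (i : Fin 3) (φ : ℝ) (m : ℤ) :
    EssCommute (shiftedSymbOp i φ) (yOp (-m)) :=
  essCommute_shifted_of_shift i (m, 0) (yOp_basis m)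

theorem shiftedSymbOp_comm (i i' : Fin 3) (φ : ℝ) :
    shiftedSymbOp i φ * shiftedSymbOp i' φ = shiftedSymbOp i' φ * shiftedSymbOp i φ := by
  refine ContinuousLinearMap.ext_on (s := Set.range zsBasis) ?_ ?_
  · rw [Submodule.dense_iff_topologicalClosure_eq_top]
    exact zsBasis.dense_span
  · rintro _ ⟨p, rfl⟩
    rw [op_mul_apply, op_mul_apply, shiftedSymbOp_basis, shiftedSymbOp_basis, map_smul, map_smul,
      shiftedSymbOp_basis, shiftedSymbOp_basis, smul_comm]

/-- The possible values of `γ_A(e^{2πiφ}, ±1)` for a generator `A`. -/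
def boundaryGenerators (φ : ℝ) : Set (L2ZS1 →L[ℂ] L2ZS1) :=
  {T | (∃ a, T = constDiag (circMul a)) ∨ (∃ c : ℂ, T = c • 1) ∨ (∃ m : ℤ, T = yOp (-m)) ∨
    ∃ i, T = lamSymb i φ}

theorem circMul_comm (a b : C(Circ, ℂ)) : circMul a * circMul b = circMul b * circMul a := by
  have h : ∀ (a : C(Circ, ℂ)) (f : L2S1), circMul a f =ᵐ[circMeas] fun x => a x • f x :=
    fun a f => smulOp_coeFn _ _ _ f
  refine ContinuousLinearMap.ext fun f => Lp.ext ?_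
  rw [op_mul_apply, op_mul_apply]
  filter_upwards [h a (circMul b f), h b (circMul a f), h a f, h b f] with x h1 h2 h3 h4
  rw [h1, h2, h3, h4, smul_comm]

theorem constDiag_comm (a b : C(Circ, ℂ)) : constDiag (circMul a) * constDiag (circMul b) =
    constDiag (circMul b) * constDiag (circMul a) := by
  refine lp_ext_single fun j v => ?_
  rw [op_mul_apply, op_mul_apply]
  simp only [constDiag, diagOp_single]
  congr 1
  exact DFunLike.congr_fun (circMul_comm a b) v

theorem lamSymb_comm (i i' : Fin 3) (φ : ℝ) :
    lamSymb i φ * lamSymb i' φ = lamSymb i' φ * lamSymb i φ := by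
  have h : ∀ i i', lamSymb i φ * lamSymb i' φ =
      yOp φ * ((shiftedSymbOp i φ * shiftedSymbOp i' φ) * yOp (-φ)) := fun i i' => by
    rw [lamSymb_eq, lamSymb_eq]
    calc _ = yOp φ *
          (shiftedSymbOp i φ * (yOp (-φ) * yOp φ) * (shiftedSymbOp i' φ * yOp (-φ))) := by
          simp only [mul_assoc]
      _ = _ := by rw [yOp_neg_mul, mul_one, mul_assoc (shiftedSymbOp i φ)]
  rw [h, h, shiftedSymbOp_comm]

/-- The values of `γ` on the generators commute modulo compact operators. -/
theorem essCommute_boundaryGenerators {φ : ℝ} {S T : L2ZS1 →L[ℂ] L2ZS1}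
    (hS : S ∈ boundaryGenerators φ) (hT : T ∈ boundaryGenerators φ) : EssCommute S T := by
  have hc : ∀ (c : ℂ) (T : L2ZS1 →L[ℂ] L2ZS1), EssCommute (c • 1) T := fun c T =>
    Commute.essCommute (by rw [smul_mul_assoc, mul_smul_comm, one_mul, mul_one])
  have ha : ∀ (i : Fin 3) a, EssCommute (lamSymb i φ) (constDiag (circMul a)) := fun i a =>
    (essCommute_shifted_constDiag i φ a).conj (yOp_mul_constDiag φ _) (yOp_mul_constDiag (-φ) _)
  have hm : ∀ (i : Fin 3) (m : ℤ), EssCommute (lamSymb i φ) (yOp (-m)) := fun i m =>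
    (essCommute_shifted_yOp i φ m).conj (yOp_comm _ _) (yOp_comm _ _)
  rcases hS with ⟨a, rfl⟩ | ⟨c, rfl⟩ | ⟨m, rfl⟩ | ⟨i, rfl⟩
  · rcases hT with ⟨a', rfl⟩ | ⟨c', rfl⟩ | ⟨m', rfl⟩ | ⟨i', rfl⟩
    · exact Commute.essCommute (constDiag_comm a a')
    · exact (hc c' _).symm
    · exact Commute.essCommute (yOp_mul_constDiag _ _).symm
    · exact (ha i' a).symm
  · exact hc c T
  · rcases hT with ⟨a', rfl⟩ | ⟨c', rfl⟩ | ⟨m', rfl⟩ | ⟨i', rfl⟩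
    · exact Commute.essCommute (yOp_mul_constDiag _ _)
    · exact (hc c' _).symm
    · exact Commute.essCommute (yOp_comm _ _)
    · exact (hm i' m).symm
  · rcases hT with ⟨a', rfl⟩ | ⟨c', rfl⟩ | ⟨m', rfl⟩ | ⟨i', rfl⟩
    · exact ha i a'
    · exact (hc c' _).symm
    · exact hm i m'
    · exact Commute.essCommute (lamSymb_comm i i' φ)

/-! ### The values of the boundary symbol on the commutator ideal -/

theorem isClosed_cylAlg : IsClosed (cylAlg : Set (L2Cyl →L[ℂ] L2Cyl)) :=
  StarSubalgebra.isClosed_topologicalClosure _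

theorem generator_mem {A : L2Cyl →L[ℂ] L2Cyl} (hA : A ∈ generators) : A ∈ cylAlg :=
  StarSubalgebra.le_topologicalClosure _ (StarAlgebra.subset_adjoin ℂ generators hA)

/-- A closed *-subalgebra of `𝒜` that contains the generators is all of `𝒜`. -/
theorem mem_of_generators_mem (D : StarSubalgebra ℂ cylAlg) (hD : IsClosed (D : Set cylAlg))
    (h : ∀ A : cylAlg, (A : L2Cyl →L[ℂ] L2Cyl) ∈ generators → A ∈ D) (A : cylAlg) : A ∈ D := by
  have hcl : IsClosed (D.map cylAlg.subtype : Set (L2Cyl →L[ℂ] L2Cyl)) :=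
    isClosed_cylAlg.isClosedEmbedding_subtypeVal.isClosedMap _ hD
  have hle : cylAlg ≤ D.map cylAlg.subtype := by
    refine StarSubalgebra.topologicalClosure_minimal (StarAlgebra.adjoin_le fun B hB => ?_) hcl
    exact ⟨⟨B, generator_mem hB⟩, h _ hB, rfl⟩
  obtain ⟨B, hB, hBA⟩ := hle A.2
  rwa [← Subtype.ext (a1 := B) (a2 := A) hBA]

theorem star_mem_generators {A : L2Cyl →L[ℂ] L2Cyl} (hA : A ∈ generators) :
    star A ∈ generators := by
  rcases hA with ((⟨a, ha, rfl⟩ | ⟨b, rfl⟩) | ⟨m, rfl⟩) | ⟨i, rfl⟩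
  · refine Or.inl (Or.inl (Or.inl ⟨star a, ?_, star_mulBeta a⟩))
    exact Complex.conjCLE.contDiff.comp ha
  · exact Or.inl (Or.inl (Or.inr ⟨star b, (star_mulT b).symm⟩))
  · exact Or.inl (Or.inr ⟨-m, (star_mulExp m).symm⟩)
  · exact Or.inr ⟨i, (star_lamOp i).symm⟩

section Symbol

variable {φ : ℝ} {σ : cylAlg →⋆ₐ[ℂ] (L2ZS1 →L[ℂ] L2ZS1)}

/-- The operators that essentially commute with `T` form a closed algebra, so that it suffices to
test the generators. -/
theorem essCommute_of_generators (hσ : Continuous σ) (T : L2ZS1 →L[ℂ] L2ZS1)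
    (h : ∀ A : cylAlg, (A : L2Cyl →L[ℂ] L2Cyl) ∈ generators → EssCommute T (σ A))
    (A : cylAlg) : EssCommute T (σ A) := by
  -- the condition is imposed on the adjoint as well to obtain a star-closed set
  let D : StarSubalgebra ℂ cylAlg :=
    { carrier := {A | EssCommute T (σ A) ∧ EssCommute T (σ (star A))}
      add_mem' := fun {A B} hA hB => by
        refine ⟨?_, ?_⟩
        · rw [map_add]
          exact hA.1.add hB.1
        · rw [star_add, map_add]
          exact hA.2.add hB.2
      mul_mem' := fun {A B} hA hB => by
        refine ⟨?_, ?_⟩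
        · rw [map_mul]
          exact hA.1.mul hB.1
        · rw [star_mul, map_mul]
          exact hB.2.mul hA.2
      algebraMap_mem' := fun c => by
        have : ∀ c : ℂ, EssCommute T (σ (algebraMap ℂ cylAlg c)) := fun c => by
          rw [AlgHomClass.commutes]
          exact Commute.essCommute (Algebra.commutes' c T).symm
        refine ⟨this c, ?_⟩
        rw [← algebraMap_star_comm]
        exact this _
      star_mem' := fun {A} hA => ⟨hA.2, by rw [star_star]; exact hA.1⟩ }
  have hD : IsClosed (D : Set cylAlg) :=
    ((isClosed_essCommute T).preimage hσ).inter
      ((isClosed_essCommute T).preimage (hσ.comp continuous_star))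
  refine (mem_of_generators_mem D hD (fun A hA => ⟨h A hA, h (star A) ?_⟩) A).1
  exact star_mem_generators hA

theorem essCommute_symbol (hσ : Continuous σ)
    (h : ∀ A : cylAlg, (A : L2Cyl →L[ℂ] L2Cyl) ∈ generators → σ A ∈ boundaryGenerators φ)
    (A B : cylAlg) : EssCommute (σ A) (σ B) :=
  essCommute_of_generators hσ _ (fun _ hG => (essCommute_of_generators hσ _
    (fun _ hG' => essCommute_boundaryGenerators (h _ hG) (h _ hG')) A).symm) B

/-- A representation that maps the generators to essentially commuting operators maps the
commutator ideal to compact operators. -/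
theorem isCompactOperator_symbol (hσ : Continuous σ)
    (h : ∀ A : cylAlg, (A : L2Cyl →L[ℂ] L2Cyl) ∈ generators → σ A ∈ boundaryGenerators φ)
    {A : cylAlg} (hA : A ∈ commIdeal) : IsCompactOperator (σ A) := by
  let I : Ideal cylAlg :=
    { carrier := {A | IsCompactOperator (σ A)}
      add_mem' := fun {A B} hA hB => by
        change IsCompactOperator (σ (A + B))
        rw [map_add]
        exact IsCompactOperator.add hA hB
      zero_mem' := by
        change IsCompactOperator (σ 0)
        rw [map_zero]
        exact isCompactOperator_zero
      smul_mem' := fun B A hA => by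
        change IsCompactOperator (σ (B * A))
        rw [map_mul]
        exact IsCompactOperator.clm_comp (show IsCompactOperator (σ A) from hA) (σ B) }
  refine (Submodule.mem_sInf.1 hA) I ⟨⟨fun {A} B hA => ?_⟩, ?_, fun B C => ?_⟩
  · change IsCompactOperator (σ (A * B))
    rw [map_mul]
    exact IsCompactOperator.comp_clm (show IsCompactOperator (σ A) from hA) (σ B)
  · exact isClosed_setOfPred_isCompactOperator.preimage hσ
  · change IsCompactOperator (σ (B * C - C * B))
    rw [map_sub, map_mul, map_mul]
    exact essCommute_symbol hσ h B C

end Symbol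

/-- The value of a symbol at a point, as a representation of `𝒜`. -/
noncomputable def symbolAt (γ : cylAlg →⋆ₐ[ℂ] C(Bd, L2ZS1 →L[ℂ] L2ZS1)) (x : Bd) :
    cylAlg →⋆ₐ[ℂ] (L2ZS1 →L[ℂ] L2ZS1) :=
  { toFun := fun A => γ A x
    map_one' := DFunLike.congr_fun (γ.map_one') x
    map_mul' := fun A B => DFunLike.congr_fun (γ.map_mul' A B) x
    map_zero' := DFunLike.congr_fun (γ.map_zero') x
    map_add' := fun A B => DFunLike.congr_fun (γ.map_add' A B) x
    commutes' := fun c => DFunLike.congr_fun (γ.commutes' c) x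
    map_star' := fun A => DFunLike.congr_fun (γ.map_star' A) x }

theorem symbolAt_apply (γ : cylAlg →⋆ₐ[ℂ] C(Bd, L2ZS1 →L[ℂ] L2ZS1)) (x : Bd) (A : cylAlg) :
    symbolAt γ x A = γ A x := rfl

section Symbol

variable {γ : cylAlg →⋆ₐ[ℂ] C(Bd, L2ZS1 →L[ℂ] L2ZS1)}

theorem symbolAt_mem_boundaryGenerators (h : IsBoundarySymbol γ) (x : Bd) (A : cylAlg)
    (hA : (A : L2Cyl →L[ℂ] L2Cyl) ∈ generators) :
    symbolAt γ x A ∈ boundaryGenerators (angle x.1) := by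
  obtain ⟨z, s⟩ := x
  rw [symbolAt_apply]
  rcases hA with ((⟨a, ha, hA⟩ | ⟨b, hA⟩) | ⟨m, hA⟩) | ⟨i, hA⟩
  · exact Or.inl ⟨a, h.mulBeta a A ha hA z s⟩
  · rcases Int.units_eq_one_or s with rfl | rfl
    · exact Or.inr (Or.inl ⟨_, h.mulT_pos b A hA.symm z⟩)
    · exact Or.inr (Or.inl ⟨_, h.mulT_neg b A hA.symm z⟩)
  · exact Or.inr (Or.inr (Or.inl ⟨m, h.mulExp m A hA.symm z s⟩))
  · refine Or.inr (Or.inr (Or.inr ⟨i, ?_⟩))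
    have h1 := h.lamOp i A hA.symm (angle z) s
    have h2 : Circle.exp (2 * Real.pi * angle z) = z := by
      rw [angle, mul_div_cancel₀ _ Real.two_pi_pos.ne', Circle.exp_arg]
    rw [h2] at h1
    exact h1

theorem continuous_symbolAt
    (hγ : ∀ A : cylAlg, ((A : L2Cyl →L[ℂ] L2Cyl), γ A) ∈ symbolGraph boundaryPacket) (x : Bd) :
    Continuous (symbolAt γ x) :=
  AddMonoidHomClass.continuous_of_bound (symbolAt γ x) 1 fun A => by
    rw [one_mul]
    exact (hγ A x).1.norm_le

/-- The boundary symbol maps the commutator ideal to compact operators. -/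
theorem boundarySymbol_isCompactOperator
    (hγ : ∀ A : cylAlg, ((A : L2Cyl →L[ℂ] L2Cyl), γ A) ∈ symbolGraph boundaryPacket)
    {A : cylAlg} (hA : A ∈ commIdeal) (x : Bd) : IsCompactOperator (γ A x) :=
  isCompactOperator_symbol (continuous_symbolAt hγ x)
    (symbolAt_mem_boundaryGenerators (isBoundarySymbol_of_graph hγ) x) hA

end Symbol

end CylinderAlgebra

end

section

open Filter Topology MeasureTheory CylinderAlgebra

namespace CylinderAlgebra

/-! ### Fredholm operators -/

section Fredholm

variable {H : Type*} [NormedAddCommGroup H] [InnerProductSpace ℂ H]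

/-- Compact operators on an inner product space are norm limits of operators of finite rank: one
projects to the span of an `ε`-net of the image of the unit ball. -/
theorem exists_finiteDimensional_norm_sub_le {K : H →L[ℂ] H} (hK : IsCompactOperator K) {ε : ℝ}
    (hε : 0 < ε) : ∃ F : H →L[ℂ] H, FiniteDimensional ℂ (F : H →ₗ[ℂ] H).range ∧ ‖K - F‖ ≤ ε := by
  have hc := hK.isCompact_closure_image_closedBall (𝕜₁ := ℂ) (f := (K : H →ₗ[ℂ] H)) 1
  obtain ⟨t, ht, hcover⟩ := Metric.totallyBounded_iff.1 hc.totallyBounded ε hε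
  have := FiniteDimensional.span_of_finite ℂ ht
  let M : Submodule ℂ H := Submodule.span ℂ t
  refine ⟨M.starProjection ∘L K, ?_, ?_⟩
  · refine Submodule.finiteDimensional_of_le (S₂ := M) ?_
    rintro _ ⟨x, rfl⟩
    exact M.starProjection_apply_mem (K x)
  · refine ContinuousLinearMap.opNorm_le_of_unit_norm hε.le fun x hx => ?_
    obtain ⟨y, hy, hxy⟩ := Set.mem_iUnion₂.1 (hcover (subset_closure ⟨x, by simp [hx], rfl⟩))
    have h2 := M.starProjection_minimal (K x)
    change ‖K x - M.starProjection (K x)‖ ≤ ε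
    rw [h2]
    refine (ciInf_le ⟨0, ?_⟩ (⟨y, Submodule.subset_span hy⟩ : M)).trans ?_
    · rintro _ ⟨z, rfl⟩
      exact norm_nonneg _
    · rw [← dist_eq_norm]
      exact (Metric.mem_ball.1 hxy).le

/-- Atkinson's theorem: an operator that is invertible modulo compact operators is Fredholm. -/
theorem isFredholm_of_isCompactOperator [CompleteSpace H] {T S : H →L[ℂ] H}
    (h1 : IsCompactOperator (S * T - 1 : H →L[ℂ] H))
    (h2 : IsCompactOperator (T * S - 1 : H →L[ℂ] H)) : T.IsFredholm := by
  have unit : ∀ {A : H →L[ℂ] H}, IsCompactOperator (A - 1 : H →L[ℂ] H) → ∃ G : (H →L[ℂ] H)ˣ,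
      ((A - G : H →L[ℂ] H) : H →ₗ[ℂ] H).HasNoetherianRange := fun {A} hA => by
    obtain ⟨F, hF, hn⟩ := exists_finiteDimensional_norm_sub_le hA (ε := 1 / 2) (by norm_num)
    refine ⟨Units.oneSub (F - (A - 1)) ?_, ?_⟩
    · rw [norm_sub_rev]
      exact hn.trans_lt (by norm_num)
    · rw [Units.val_oneSub, show A - (1 - (F - (A - 1))) = F by abel]
      exact (inferInstance : IsNoetherian ℂ (F : H →ₗ[ℂ] H).range)
  obtain ⟨G, hG⟩ := unit h1
  obtain ⟨G', hG'⟩ := unit h2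
  -- `a` is a left inverse and `b` a right inverse of `T` modulo operators of finite rank
  set a : H →L[ℂ] H := (↑G⁻¹ : H →L[ℂ] H) * S with ha
  set b : H →L[ℂ] H := S * (↑G'⁻¹ : H →L[ℂ] H) with hb
  have hl : ((a * T - 1 : H →L[ℂ] H) : H →ₗ[ℂ] H).HasNoetherianRange := by
    have e : a * T - 1 = ↑G⁻¹ * (S * T - G) := by
      rw [mul_sub, Units.inv_mul, mul_assoc]
    rw [e]
    exact hG.comp_left _
  have hr : ((T * b - 1 : H →L[ℂ] H) : H →ₗ[ℂ] H).HasNoetherianRange := by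
    have e : T * b - 1 = (T * S - G') * ↑G'⁻¹ := by
      rw [sub_mul, Units.mul_inv, mul_assoc]
    rw [e]
    exact hG'.comp_right _
  -- a left and a right inverse modulo operators of finite rank agree modulo such operators
  have hr' : ((T * a - 1 : H →L[ℂ] H) : H →ₗ[ℂ] H).HasNoetherianRange := by
    have e : T * a - 1 = (T * b - 1) + (T * ((a * T - 1) * b)) - (T * a) * (T * b - 1) := by
      noncomm_ring
    rw [e]
    exact (hr.add ((hl.comp_right _).comp_left _)).sub (hr.comp_left _)
  refine ContinuousLinearMap.IsFredholm.of_isQuasiInverse (v := a) ⟨?_, ?_⟩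
  · exact LinearMap.FiniteRangeSetoid.equiv_iff_hasNoetherianRange.2 hl
  · exact LinearMap.FiniteRangeSetoid.equiv_iff_hasNoetherianRange.2 hr'

end Fredholm

/-- A Fredholm operator has a generalised inverse `S`, and the ranges of the idempotents
`1 - ST` and `1 - TS` have the dimensions of its kernel and of its cokernel. -/
theorem exists_generalised_inverse {H : Type*} [NormedAddCommGroup H] [NormedSpace ℂ H]
    {T : H →L[ℂ] H} (hT : T.IsFredholm) :
    ∃ S : H →L[ℂ] H, T * S * T = T ∧ S * T * S = S ∧
      FiniteDimensional ℂ ((1 - S * T : H →L[ℂ] H) : H →ₗ[ℂ] H).range ∧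
      FiniteDimensional ℂ ((1 - T * S : H →L[ℂ] H) : H →ₗ[ℂ] H).range ∧
      Module.finrank ℂ ((1 - S * T : H →L[ℂ] H) : H →ₗ[ℂ] H).range =
        Module.finrank ℂ (T : H →ₗ[ℂ] H).ker ∧
      Module.finrank ℂ ((1 - T * S : H →L[ℂ] H) : H →ₗ[ℂ] H).range =
        Module.finrank ℂ (H ⧸ (T : H →ₗ[ℂ] H).range) := by
  obtain ⟨pkg⟩ := hT.nonempty_fredholmPackage
  have hS : ∀ y, pkg.quasiInverse y = pkg.equiv.symm (pkg.decCodom.proj y) := fun _ => rfl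
  have hT' : ∀ x, T x = pkg.equiv (pkg.decDom.proj x) := fun x => DFunLike.congr_fun pkg.eq_equiv x
  have p1 : ∀ x : pkg.decDom.X₁, pkg.decDom.proj x = x := fun x => by simp
  have p2 : ∀ x : pkg.decCodom.X₁, pkg.decCodom.proj x = x := fun x => by simp
  set S := pkg.quasiInverse
  have e1 : ∀ x, T (S (T x)) = T x := fun x => by
    rw [hT' x, hS, p2, pkg.equiv.symm_apply_apply, hT', p1]
  have e2 : ∀ x, S (T (S x)) = S x := fun x => by
    rw [hS x, hT', p1, pkg.equiv.apply_symm_apply, hS, p2]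
  have hker : ((1 - S * T : H →L[ℂ] H) : H →ₗ[ℂ] H).range = (T : H →ₗ[ℂ] H).ker := by
    ext x
    constructor
    · rintro ⟨y, rfl⟩
      change T (y - S (T y)) = 0
      rw [map_sub, e1, sub_self]
    · intro hx
      refine ⟨x, ?_⟩
      change x - S (T x) = x
      rw [show T x = 0 from hx, map_zero, sub_zero]
  have hran : ((1 - T * S : H →L[ℂ] H) : H →ₗ[ℂ] H).ker = (T : H →ₗ[ℂ] H).range := by
    ext x
    constructor
    · intro hx
      exact ⟨S x, (sub_eq_zero.1 (show x - T (S x) = 0 from hx)).symm⟩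
    · rintro ⟨y, rfl⟩
      change T y - T (S (T y)) = 0
      rw [e1, sub_self]
  let eq := (Submodule.quotEquivOfEq _ _ hran).symm.trans
    ((1 - T * S : H →L[ℂ] H) : H →ₗ[ℂ] H).quotKerEquivRange
  have := hT.finite_ker
  have hfin : Module.Finite ℂ (H ⧸ (T : H →ₗ[ℂ] H).range) := hT.finite_coker
  refine ⟨S, ContinuousLinearMap.ext e1, ContinuousLinearMap.ext e2, ?_,
    Module.Finite.equiv eq, ?_, eq.finrank_eq.symm⟩
  · rw [hker]
    exact hT.finite_ker
  · rw [hker]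

end CylinderAlgebra

end

section

namespace OpKTheory

open Matrix

/-! ### Idempotents over an algebra with adjoined unit -/

section Lift

variable {R : Type*} [Ring R] [Algebra ℂ R] {J : NonUnitalSubalgebra ℂ R}
  {ι κ l : Type*}

/-- The matrix `e` over `J⁺` has the scalar part `Q` and the image `M` in the matrices over `R`. -/
def IsLift (e : Matrix ι κ (Unitization ℂ J)) (Q : Matrix ι κ ℂ) (M : Matrix ι κ R) : Prop :=
  e.map (Unitization.fstHom ℂ J) = Q ∧ e.map (NonUnitalSubalgebra.unitization J) = M

/-- An element of `J⁺` is determined by its scalar part and its image in `R`. The image alone does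
not suffice if `J` contains the unit of `R`. -/
theorem unitization_ext {a b : Unitization ℂ J} (h : a.fst = b.fst)
    (h' : NonUnitalSubalgebra.unitization J a = NonUnitalSubalgebra.unitization J b) : a = b := by
  refine Unitization.ext h (Subtype.ext ?_)
  have h2 : algebraMap ℂ R a.fst + (a.snd : R) = algebraMap ℂ R b.fst + (b.snd : R) := h'
  rw [h] at h2
  exact add_left_cancel h2

theorem IsLift.ext {e e' : Matrix ι κ (Unitization ℂ J)} {Q : Matrix ι κ ℂ} {M : Matrix ι κ R}
    (h : IsLift e Q M) (h' : IsLift e' Q M) : e = e' := by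
  ext1 i j
  refine unitization_ext ?_ ?_
  · exact congrFun (congrFun (h.1.trans h'.1.symm) i) j
  · exact congrFun (congrFun (h.2.trans h'.2.symm) i) j

theorem IsLift.mul [Fintype κ]
    {e : Matrix ι κ (Unitization ℂ J)} {Q : Matrix ι κ ℂ} {M : Matrix ι κ R}
    {e' : Matrix κ l (Unitization ℂ J)} {Q' : Matrix κ l ℂ} {M' : Matrix κ l R}
    (h : IsLift e Q M) (h' : IsLift e' Q' M') : IsLift (e * e') (Q * Q') (M * M') := by
  constructor
  · rw [Matrix.map_mul, h.1, h'.1]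
  · rw [Matrix.map_mul, h.2, h'.2]

/-- A matrix over `R` that is congruent to a scalar matrix modulo `J` comes from `J⁺`. -/
theorem exists_isLift {Q : Matrix ι κ ℂ} {M : Matrix ι κ R}
    (h : ∀ i j, M i j - algebraMap ℂ R (Q i j) ∈ J) :
    ∃ e : Matrix ι κ (Unitization ℂ J), IsLift e Q M := by
  refine ⟨fun i j => Unitization.inl (Q i j) + ((⟨_, h i j⟩ : J) : Unitization ℂ J), ?_, ?_⟩
  · ext i j
    change (Unitization.inl (Q i j) + ((⟨_, h i j⟩ : J) : Unitization ℂ J)).fst = Q i j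
    simp
  · ext i j
    change algebraMap ℂ R (Unitization.inl (Q i j) + ((⟨_, h i j⟩ : J) : Unitization ℂ J)).fst +
      ((Unitization.inl (Q i j) + ((⟨_, h i j⟩ : J) : Unitization ℂ J)).snd : R) = M i j
    simp

theorem IsLift.sub_mem {e : Matrix ι κ (Unitization ℂ J)} {Q : Matrix ι κ ℂ} {M : Matrix ι κ R}
    (h : IsLift e Q M) (i : ι) (j : κ) : M i j - algebraMap ℂ R (Q i j) ∈ J := by
  rw [← h.1, ← h.2]
  change algebraMap ℂ R (e i j).fst + ((e i j).snd : R) - algebraMap ℂ R (e i j).fst ∈ J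
  rw [add_sub_cancel_left]
  exact (e i j).snd.2

/-- The equivalence of idempotents over `J⁺` may be checked separately on the scalar parts and in
the matrices over `R`. -/
theorem IsLift.mvN [Fintype ι] [Fintype κ]
    {e : Matrix ι ι (Unitization ℂ J)} {Q : Matrix ι ι ℂ} {M : Matrix ι ι R}
    {f : Matrix κ κ (Unitization ℂ J)} {Q' : Matrix κ κ ℂ} {M' : Matrix κ κ R}
    (he : IsLift e Q M) (hf : IsLift f Q' M') {a : Matrix ι κ ℂ} {b : Matrix κ ι ℂ}
    {x : Matrix ι κ R} {y : Matrix κ ι R} (hab : a * b = Q) (hba : b * a = Q') (hxy : x * y = M)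
    (hyx : y * x = M') (hx : ∀ i j, x i j - algebraMap ℂ R (a i j) ∈ J)
    (hy : ∀ i j, y i j - algebraMap ℂ R (b i j) ∈ J) : MvN e f := by
  obtain ⟨x', hx'⟩ := exists_isLift hx
  obtain ⟨y', hy'⟩ := exists_isLift hy
  refine ⟨x', y', ?_, ?_⟩
  · have := hx'.mul hy'
    rw [hab, hxy] at this
    exact this.ext he
  · have := hy'.mul hx'
    rw [hba, hyx] at this
    exact this.ext hf

theorem IsLift.idem [Fintype ι]
    {e : Matrix ι ι (Unitization ℂ J)} {Q : Matrix ι ι ℂ} {M : Matrix ι ι R}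
    (h : IsLift e Q M) (hQ : Q * Q = Q) (hM : M * M = M) : e * e = e := by
  have := h.mul h
  rw [hQ, hM] at this
  exact this.ext h

theorem IsLift.fromBlocks {ι' κ' : Type*}
    {e : Matrix ι κ (Unitization ℂ J)} {Q : Matrix ι κ ℂ} {M : Matrix ι κ R}
    {e' : Matrix ι' κ' (Unitization ℂ J)} {Q' : Matrix ι' κ' ℂ} {M' : Matrix ι' κ' R}
    (h : IsLift e Q M) (h' : IsLift e' Q' M') :
    IsLift (fromBlocks e 0 0 e') (fromBlocks Q 0 0 Q') (fromBlocks M 0 0 M') := by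
  constructor
  · rw [fromBlocks_map, h.1, h'.1, Matrix.map_zero _ (map_zero _), Matrix.map_zero _ (map_zero _)]
  · rw [fromBlocks_map, h.2, h'.2, Matrix.map_zero _ (map_zero _), Matrix.map_zero _ (map_zero _)]

theorem isLift_zero : IsLift (J := J) (0 : Matrix ι κ _) 0 0 :=
  ⟨Matrix.map_zero _ (map_zero _), Matrix.map_zero _ (map_zero _)⟩

theorem isLift_one [DecidableEq ι] : IsLift (J := J) (1 : Matrix ι ι _) 1 1 :=
  ⟨Matrix.map_one _ (map_zero _) (map_one _), Matrix.map_one _ (map_zero _) (map_one _)⟩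

theorem IsLift.reindex {ι' κ' : Type*}
    {e : Matrix ι κ (Unitization ℂ J)} {Q : Matrix ι κ ℂ} {M : Matrix ι κ R} (h : IsLift e Q M)
    (σ : ι ≃ ι') (τ : κ ≃ κ') :
    IsLift (Matrix.reindex σ τ e) (Matrix.reindex σ τ Q) (Matrix.reindex σ τ M) := by
  rw [← h.1, ← h.2]
  exact ⟨rfl, rfl⟩

/-- Two invertible matrices that agree modulo `J` conjugate a scalar idempotent to equivalent
idempotents over `J⁺`. -/
theorem mvN_of_conj [Fintype ι] [DecidableEq ι] (hr : ∀ (r a : R), a ∈ J → a * r ∈ J)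
    {Q : Matrix ι ι ℂ} (hQ : Q * Q = Q) {W W' : (Matrix ι ι R)ˣ}
    (h : ∀ i j, (W : Matrix ι ι R) i j - (W' : Matrix ι ι R) i j ∈ J)
    {e e' : Matrix ι ι (Unitization ℂ J)}
    (he : IsLift e Q (W * Q.map (algebraMap ℂ R) * (↑W⁻¹ : Matrix ι ι R)))
    (he' : IsLift e' Q (W' * Q.map (algebraMap ℂ R) * (↑W'⁻¹ : Matrix ι ι R))) : MvN e e' := by
  set P : Matrix ι ι R := Q.map (algebraMap ℂ R)
  have hP : P * P = P := by rw [← Matrix.map_mul, hQ]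
  have key : ∀ (V V' : (Matrix ι ι R)ˣ), V * P * (↑V'⁻¹ : Matrix ι ι R) *
      (V' * P * (↑V⁻¹ : Matrix ι ι R)) = V * P * (↑V⁻¹ : Matrix ι ι R) := fun V V' => by
    calc _ = V * (P * ((↑V'⁻¹ : Matrix ι ι R) * V') * P) * (↑V⁻¹ : Matrix ι ι R) := by
          simp only [mul_assoc]
      _ = _ := by rw [Units.inv_mul, mul_one, hP]
  have mem : ∀ (D M : Matrix ι ι R), (∀ i j, D i j ∈ J) → ∀ i j, (D * M) i j ∈ J :=
    fun D M hD i j => by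
      rw [Matrix.mul_apply]
      exact sum_mem fun k _ => hr _ _ (hD i k)
  have key2 : ∀ {V V' : (Matrix ι ι R)ˣ}, (∀ i j, (V : Matrix ι ι R) i j - V'.1 i j ∈ J) →
      (∀ i j, (V' * P * (↑V'⁻¹ : Matrix ι ι R)) i j - algebraMap ℂ R (Q i j) ∈ J) →
      ∀ i j, (V * P * (↑V'⁻¹ : Matrix ι ι R)) i j - algebraMap ℂ R (Q i j) ∈ J :=
    fun {V V'} hV hV' i j => by
      have e1 : (V * P * (↑V'⁻¹ : Matrix ι ι R)) =
          ((V : Matrix ι ι R) - V') * (P * (↑V'⁻¹ : Matrix ι ι R)) +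
            V' * P * (↑V'⁻¹ : Matrix ι ι R) := by
        rw [sub_mul, ← mul_assoc, ← mul_assoc, sub_add_cancel]
      rw [e1, Matrix.add_apply, add_sub_assoc]
      exact add_mem (mem _ _ hV i j) (hV' i j)
  refine he.mvN he' hQ hQ (key W W') (key W' W) (key2 h he'.sub_mem) (key2 (fun i j => ?_)
    he.sub_mem)
  rw [← neg_sub]
  exact neg_mem (h i j)

end Lift

section Classes

variable {B : Type*} [Ring B] {ι κ : Type*} [Fintype ι] [Fintype κ]

theorem k0cls_eq {e : Matrix ι ι B} {f : Matrix κ κ B} (he : e * e = e) (hf : f * f = f)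
    (h : MvN e f) : k0cls e he = k0cls f hf :=
  congrArg _ (vcls_eq he hf h)

theorem k0cls_fromBlocks {e : Matrix ι ι B} {f : Matrix κ κ B} (he : e * e = e) (hf : f * f = f) :
    k0cls (fromBlocks e 0 0 f) (idem_fromBlocks he hf) = k0cls e he + k0cls f hf := by
  unfold k0cls
  rw [← map_add, vcls_add]

theorem k0cls_zero : k0cls (0 : Matrix ι ι B) idem_zero = 0 := by
  have h : vcls (0 : Matrix ι ι B) idem_zero = 0 :=
    vcls_eq _ _ ⟨(0 : Matrix ι (Fin 0) B), 0, by ext; simp, by ext i; exact i.elim0⟩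
  unfold k0cls
  rw [h, map_zero]

theorem idem_one_sub [DecidableEq ι] {e : Matrix ι ι B} (he : e * e = e) :
    (1 - e) * (1 - e) = 1 - e := by
  rw [sub_mul, mul_sub, mul_sub, he]
  simp

theorem k0cls_one_sub [DecidableEq ι] {e : Matrix ι ι B} (he : e * e = e) :
    k0cls (1 - e) (idem_one_sub he) = k0cls (1 : Matrix ι ι B) (mul_one 1) - k0cls e he := by
  rw [eq_sub_iff_add_eq, ← k0cls_fromBlocks]
  refine k0cls_eq _ _ ⟨fromRows (1 - e) e, fromCols (1 - e) e, ?_, ?_⟩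
  · rw [fromRows_mul_fromCols, idem_one_sub he, he, sub_mul, mul_sub, he]
    simp
  · rw [fromCols_mul_fromRows, idem_one_sub he, he]
    simp

theorem k0cls_reindex {e : Matrix ι ι B} (he : e * e = e) (σ : ι ≃ κ) :
    k0cls (Matrix.reindex σ σ e) (idem_reindex he σ) = k0cls e he :=
  (k0cls_eq _ _ (MvN.reindex he σ)).symm

end Classes

section IndexClass

/-- The idempotent `diag(1, 0)`. -/
abbrev upperBlock (κ B : Type*) [DecidableEq κ] [Ring B] : Matrix (κ ⊕ κ) (κ ⊕ κ) B :=
  fromBlocks 1 0 0 0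

variable {R : Type*} [Ring R] {I : Ideal R} [I.IsTwoSided]

theorem reindex_mul {B : Type*} [Ring B] {ι κ : Type*} [Fintype ι] [Fintype κ] (σ : ι ≃ κ)
    (M N : Matrix ι ι B) :
    Matrix.reindex σ σ (M * N) = Matrix.reindex σ σ M * Matrix.reindex σ σ N := by
  simp only [Matrix.reindex_apply]
  rw [Matrix.submatrix_mul_equiv]

theorem map_mk_eq_iff {ι κ : Type*} {M N : Matrix ι κ R} :
    M.map (Ideal.Quotient.mk I) = N.map (Ideal.Quotient.mk I) ↔ ∀ i j, M i j - N i j ∈ I := by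
  rw [← Matrix.ext_iff]
  exact forall₂_congr fun i j => Ideal.Quotient.eq

variable {κ : Type*} [Fintype κ] [DecidableEq κ]

/-- The explicit invertible lift of `diag(t, t⁻¹)` built from a generalised inverse `S` of a
matrix `T`. It conjugates `diag(1, 0)` to `diag(TS, 1 - ST)`. -/
theorem exists_unit_of_generalised_inverse {T S : Matrix κ κ R} (h : T * S * T = T)
    (h' : S * T * S = S) : ∃ V : (Matrix (κ ⊕ κ) (κ ⊕ κ) R)ˣ,
      (V : Matrix (κ ⊕ κ) (κ ⊕ κ) R) = fromBlocks T (1 - T * S) (1 - S * T) S ∧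
      (V : Matrix (κ ⊕ κ) (κ ⊕ κ) R) * upperBlock κ R * (↑V⁻¹ : Matrix (κ ⊕ κ) (κ ⊕ κ) R) =
        fromBlocks (T * S) 0 0 (1 - S * T) := by
  have a1 : T * S * (T * S) = T * S := by rw [← mul_assoc, h]
  have a2 : S * T * (S * T) = S * T := by rw [← mul_assoc, h']
  have b1 : T * (S * T) = T := by rw [← mul_assoc, h]
  have b2 : S * (T * S) = S := by rw [← mul_assoc, h']
  refine ⟨⟨fromBlocks T (1 - T * S) (1 - S * T) S, fromBlocks S (1 - S * T) (1 - T * S) T,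
    ?_, ?_⟩, rfl, ?_⟩
  · rw [fromBlocks_multiply, ← fromBlocks_one]
    congr 1 <;> simp [mul_sub, sub_mul, a1, a2, b1, b2, h, h']
  · rw [fromBlocks_multiply, ← fromBlocks_one]
    congr 1 <;> simp [mul_sub, sub_mul, a1, a2, b1, b2, h, h']
  · change fromBlocks T (1 - T * S) (1 - S * T) S * fromBlocks 1 0 0 0 *
      fromBlocks S (1 - S * T) (1 - T * S) T = _
    rw [fromBlocks_multiply, fromBlocks_multiply]
    congr 1 <;> simp [mul_sub, sub_mul, a2, b1, h']

theorem idem_of_generalised_inverse {T S : Matrix κ κ R} (h : T * S * T = T) :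
    (1 - T * S) * (1 - T * S) = 1 - T * S :=
  idem_one_sub (by rw [← mul_assoc, h])

variable [Algebra ℂ R] {J : NonUnitalSubalgebra ℂ R}

/-- The index class of an invertible lift of `diag(t, t⁻¹)` in terms of a generalised inverse. -/
theorem index_class_of_generalised_inverse (hJ : ∀ r, r ∈ J ↔ r ∈ I) {T S : Matrix κ κ R}
    (h : T * S * T = T) (h' : S * T * S = S)
    {f f' : Matrix κ κ (Unitization ℂ J)} {e p : Matrix (κ ⊕ κ) (κ ⊕ κ) (Unitization ℂ J)}
    (hf : IsLift f 0 (1 - T * S))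
    (hf' : IsLift f' 0 (1 - S * T)) {W : (Matrix (κ ⊕ κ) (κ ⊕ κ) R)ˣ}
    (hW : (W : Matrix _ _ R).map (Ideal.Quotient.mk I) =
      fromBlocks (T.map (Ideal.Quotient.mk I)) 0 0 (S.map (Ideal.Quotient.mk I)))
    (he : IsLift e (upperBlock κ ℂ)
      (W * upperBlock κ R * (↑W⁻¹ : Matrix (κ ⊕ κ) (κ ⊕ κ) R)))
    (he2 : e * e = e) (hp : p = upperBlock κ _) (hp2 : p * p = p) (hf2 : f * f = f)
    (hf2' : f' * f' = f') :
    k0cls e he2 - k0cls p hp2 = k0cls f' hf2' - k0cls f hf2 := by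
  obtain ⟨V, hV, hV'⟩ := exists_unit_of_generalised_inverse h h'
  subst hp
  have hQ : upperBlock κ ℂ * upperBlock κ ℂ = upperBlock κ ℂ := by simp [fromBlocks_multiply]
  have hQR : (upperBlock κ ℂ).map (algebraMap ℂ R) = upperBlock κ R := by
    rw [fromBlocks_map, Matrix.map_one _ (map_zero _) (map_one _), Matrix.map_zero _ (map_zero _)]
  have h1f : IsLift (1 - f) (1 : Matrix κ κ ℂ) (T * S) := by
    constructor
    · rw [Matrix.map_sub _ (map_sub _), hf.1, isLift_one.1, sub_zero]
    · rw [Matrix.map_sub _ (map_sub _), hf.2, isLift_one.2, sub_sub_cancel]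
  have hmem : ∀ i j, (W : Matrix (κ ⊕ κ) (κ ⊕ κ) R) i j - V.1 i j ∈ J := fun i j => by
    rw [hJ]
    revert i j
    rw [← map_mk_eq_iff, hW, hV, fromBlocks_map]
    have hz : ∀ {M : Matrix κ κ R} {g : Matrix κ κ (Unitization ℂ J)}, IsLift g 0 M →
        M.map (Ideal.Quotient.mk I) = 0 := fun {M g} hg => by
      rw [← Matrix.map_zero (m := κ) (n := κ) (Ideal.Quotient.mk I) (map_zero _), map_mk_eq_iff]
      intro i j
      rw [← hJ]
      simpa using hg.sub_mem i j
    rw [hz hf, hz hf']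
  have hm : MvN e (fromBlocks (1 - f) 0 0 f') := by
    refine mvN_of_conj (fun r a ha => ?_) hQ hmem (by rwa [hQR]) ?_
    · rw [hJ] at ha ⊢
      exact I.mul_mem_right r ha
    · rw [hQR, hV']
      exact h1f.fromBlocks hf'
  rw [k0cls_eq he2 (idem_fromBlocks (idem_one_sub hf2) hf2') hm,
    k0cls_fromBlocks (idem_one_sub hf2) hf2', k0cls_one_sub hf2]
  have hp' := k0cls_fromBlocks (B := Unitization ℂ J) (mul_one (1 : Matrix κ κ (Unitization ℂ J)))
    (idem_zero (ι := κ))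
  rw [k0cls_zero, add_zero] at hp'
  rw [hp']
  abel

theorem isLift_single (f : J) : IsLift (Matrix.of fun _ _ : Fin 1 => (f : Unitization ℂ J)) 0
    (Matrix.of fun _ _ : Fin 1 => (f : R)) := by
  constructor
  · ext i j
    change (f : Unitization ℂ J).fst = 0
    simp
  · ext i j
    change algebraMap ℂ R (f : Unitization ℂ J).fst + ((f : Unitization ℂ J).snd : R) = f
    simp

theorem reindex_upperBlock (ι κ : Type*) [DecidableEq ι] [DecidableEq κ] {B : Type*} [Ring B] :
    Matrix.reindex (Equiv.sumSumSumComm ι ι κ κ) (Equiv.sumSumSumComm ι ι κ κ)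
      (fromBlocks (upperBlock ι B) 0 0 (upperBlock κ B)) = upperBlock (ι ⊕ κ) B := by
  ext i j
  rcases i with (i | i) | (i | i) <;> rcases j with (j | j) | (j | j) <;>
    simp [Matrix.one_apply]

/-- The index class of a unit `U` that agrees, up to a liftable factor `G`, with the class of
`diag(t, 1)`, in terms of a generalised inverse `s` of `t`. -/
theorem index_class_eq (hJ : ∀ r, r ∈ J ↔ r ∈ I) {n N : ℕ} (hn : n ≤ N) (h1 : 1 ≤ N)
    {U : (Matrix (Fin n) (Fin n) (R ⧸ I))ˣ} {W : (Matrix (Fin n ⊕ Fin n) (Fin n ⊕ Fin n) R)ˣ}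
    (hW : (W : Matrix _ _ R).map (Ideal.Quotient.mk I) =
      fromBlocks (U : Matrix (Fin n) (Fin n) (R ⧸ I)) 0 0
        (↑U⁻¹ : Matrix (Fin n) (Fin n) (R ⧸ I)))
    {e p : Matrix (Fin n ⊕ Fin n) (Fin n ⊕ Fin n) (Unitization ℂ J)}
    (he : IsLift e (upperBlock (Fin n) ℂ)
      (W * upperBlock (Fin n) R * (↑W⁻¹ : Matrix (Fin n ⊕ Fin n) (Fin n ⊕ Fin n) R)))
    (he2 : e * e = e) (hp : p = upperBlock (Fin n) _) (hp2 : p * p = p)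
    {t s : R} (hts : t * s * t = t) (hst : s * t * s = s) {f f' : J} (hf : (f : R) = 1 - t * s)
    (hf' : (f' : R) = 1 - s * t) (hf2 : f * f = f) (hf2' : f' * f' = f')
    (G : (Matrix (Fin N) (Fin N) R)ˣ)
    (hG : (stab hn U : Matrix (Fin N) (Fin N) (R ⧸ I)) =
      (G : Matrix (Fin N) (Fin N) R).map (Ideal.Quotient.mk I) *
        stabMat h1 (Matrix.of fun _ _ : Fin 1 => Ideal.Quotient.mk I t)) :
    k0cls e he2 - k0cls p hp2 =
      k0cls (Matrix.of fun _ _ : Fin 1 => (f' : Unitization ℂ J)) (idem_single hf2') -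
        k0cls (Matrix.of fun _ _ : Fin 1 => (f : Unitization ℂ J)) (idem_single hf2) := by
  let τ : Fin n ⊕ Fin (N - n) ≃ Fin N := finSumFinEquiv.trans (finCongr (Nat.add_sub_of_le hn))
  let τ₁ : Fin 1 ⊕ Fin (N - 1) ≃ Fin N := finSumFinEquiv.trans (finCongr (Nat.add_sub_of_le h1))
  let σ : Fin 1 ⊕ Fin (N - 1) ≃ Fin n ⊕ Fin (N - n) := τ₁.trans τ.symm
  have mm : ∀ {ι : Type} [Fintype ι] (c d : Matrix ι ι R), (c * d).map (Ideal.Quotient.mk I) =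
    c.map (Ideal.Quotient.mk I) * d.map (Ideal.Quotient.mk I) := fun c d => Matrix.map_mul
  have hr1 : ∀ {ι κ : Type} [Fintype ι] [Fintype κ] [DecidableEq ι] [DecidableEq κ] (ρ : ι ≃ κ),
      Matrix.reindex ρ ρ (1 : Matrix ι ι R) = 1 := fun ρ => Matrix.submatrix_one_equiv _
  -- the matrix `G` and the diagonal matrices on the index set `n + (N - n)`
  let K : (Matrix (Fin n ⊕ Fin (N - n)) (Fin n ⊕ Fin (N - n)) R)ˣ :=
    ⟨Matrix.reindex τ.symm τ.symm G, Matrix.reindex τ.symm τ.symm (↑G⁻¹ : Matrix _ _ R), by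
      rw [← reindex_mul, Units.mul_inv, hr1], by rw [← reindex_mul, Units.inv_mul, hr1]⟩
  let D : R → Matrix (Fin n ⊕ Fin (N - n)) (Fin n ⊕ Fin (N - n)) R := fun r =>
    Matrix.reindex σ σ (fromBlocks (Matrix.of fun _ _ => r) 0 0 1)
  let D₀ : R → Matrix (Fin n ⊕ Fin (N - n)) (Fin n ⊕ Fin (N - n)) R := fun r =>
    Matrix.reindex σ σ (fromBlocks (Matrix.of fun _ _ => r) 0 0 0)
  have hof : ∀ a b : R, (Matrix.of fun _ _ : Fin 1 => a) * (Matrix.of fun _ _ : Fin 1 => b) =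
      Matrix.of fun _ _ : Fin 1 => a * b := fun a b => by
    ext i j
    simp [Matrix.mul_apply]
  have hD : ∀ a b, D a * D b = D (a * b) := fun a b => by
    simp only [D, ← reindex_mul, fromBlocks_multiply, hof]
    simp
  have hD₀ : ∀ a b, D₀ a * D₀ b = D₀ (a * b) := fun a b => by
    simp only [D₀, ← reindex_mul, fromBlocks_multiply, hof]
    simp
  have hDsub : ∀ a, 1 - D a = D₀ (1 - a) := fun a => by
    rw [← hr1 σ]
    ext i j
    obtain ⟨i, rfl⟩ := σ.surjective i
    obtain ⟨j, rfl⟩ := σ.surjective j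
    rcases i with i | i <;> rcases j with j | j
    · obtain rfl := Subsingleton.elim i j
      simp [D, D₀]
    all_goals simp [D, D₀, Matrix.one_apply]
  let T := K.1 * D t
  let S := D s * K⁻¹.1
  have hTS : T * S = K.1 * D (t * s) * K⁻¹.1 := by
    rw [← hD]
    simp only [T, S, mul_assoc]
  have hST : S * T = D (s * t) := by
    rw [← hD]
    simp only [T, S, mul_assoc, Units.inv_mul_cancel_left]
  have h : T * S * T = T := by
    rw [mul_assoc, hST]
    simp only [T]
    rw [mul_assoc, hD, ← mul_assoc t, hts]
  have h' : S * T * S = S := by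
    rw [hST]
    simp only [S]
    rw [← mul_assoc, hD, hst]
  have hTS1 : 1 - T * S = K.1 * D₀ (1 - t * s) * K⁻¹.1 := by
    rw [hTS, ← hDsub, mul_sub, sub_mul, mul_one, Units.mul_inv]
  have hST1 : 1 - S * T = D₀ (1 - s * t) := by rw [hST, hDsub]
  have hD₀mem : ∀ g : J, ∀ i j, D₀ g i j ∈ J := fun g i j => by
    obtain ⟨i, rfl⟩ := σ.surjective i
    obtain ⟨j, rfl⟩ := σ.surjective j
    rcases i with i | i <;> rcases j with j | j <;> simp [D₀]
  have hmr : ∀ A B : Matrix (Fin n ⊕ Fin (N - n)) (Fin n ⊕ Fin (N - n)) R, (∀ i j, A i j ∈ J) →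
      ∀ i j, (A * B) i j ∈ J := fun A B hA i j => by
    rw [Matrix.mul_apply]
    refine sum_mem fun k _ => ?_
    rw [hJ]
    exact I.mul_mem_right _ ((hJ _).1 (hA i k))
  have hml : ∀ A B : Matrix (Fin n ⊕ Fin (N - n)) (Fin n ⊕ Fin (N - n)) R, (∀ i j, B i j ∈ J) →
      ∀ i j, (A * B) i j ∈ J := fun A B hB i j => by
    rw [Matrix.mul_apply]
    refine sum_mem fun k _ => ?_
    rw [hJ]
    exact I.mul_mem_left _ ((hJ _).1 (hB k j))
  -- the lifts of `1 - TS` and `1 - ST`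
  let E₀ : J → Matrix (Fin n ⊕ Fin (N - n)) (Fin n ⊕ Fin (N - n)) (Unitization ℂ J) := fun g =>
    Matrix.reindex σ σ (fromBlocks (Matrix.of fun _ _ => (g : Unitization ℂ J)) 0 0 0)
  have hE₀ : ∀ g : J, IsLift (E₀ g) 0 (D₀ g) := fun g => by
    have := ((isLift_single g).fromBlocks (isLift_zero (ι := Fin (N - 1))
      (κ := Fin (N - 1)))).reindex σ σ
    rw [fromBlocks_zero] at this
    exact this
  have hE₀2 : ∀ (g : J) (hg : g * g = g), E₀ g * E₀ g = E₀ g := fun g hg =>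
    idem_reindex (idem_fromBlocks (idem_single hg) idem_zero) σ
  have hE₀c : ∀ (g : J) (hg : g * g = g), k0cls (E₀ g) (hE₀2 g hg) =
      k0cls (Matrix.of fun _ _ : Fin 1 => (g : Unitization ℂ J)) (idem_single hg) := fun g hg => by
    rw [k0cls_reindex (idem_fromBlocks (idem_single hg) idem_zero) σ,
      k0cls_fromBlocks (idem_single hg) idem_zero, k0cls_zero, add_zero]
  have hl' : IsLift (E₀ f') 0 (1 - S * T) := by
    rw [hST1, ← hf']
    exact hE₀ f'
  obtain ⟨F, hF⟩ := exists_isLift (J := J) (Q := 0) (M := 1 - T * S) fun i j => by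
    rw [Matrix.zero_apply, map_zero, sub_zero, hTS1, ← hf]
    exact hmr _ _ (hml _ _ (hD₀mem f)) i j
  have hF2 : F * F = F := hF.idem (mul_zero 0) (idem_of_generalised_inverse h)
  have hff : (f : R) * f = f := congrArg Subtype.val hf2
  have hFc : k0cls F hF2 = k0cls (Matrix.of fun _ _ : Fin 1 => (f : Unitization ℂ J))
      (idem_single hf2) := by
    rw [← hE₀c f hf2]
    refine k0cls_eq _ _ (hF.mvN (hE₀ f) (a := 0) (b := 0) (x := K.1 * D₀ f) (y := D₀ f * K⁻¹.1)
      (mul_zero _) (mul_zero _) ?_ ?_ ?_ ?_)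
    · rw [hTS1, ← hf, ← mul_assoc, mul_assoc K.1, hD₀, hff]
    · rw [mul_assoc, Units.inv_mul_cancel_left, hD₀, hff]
    · intro i j
      simpa using hml _ _ (hD₀mem f) i j
    · intro i j
      simpa using hmr _ _ (hD₀mem f) i j
  -- the stabilisation of `W`
  let Θ : (Fin n ⊕ Fin n) ⊕ (Fin (N - n) ⊕ Fin (N - n)) ≃
      (Fin n ⊕ Fin (N - n)) ⊕ (Fin n ⊕ Fin (N - n)) := Equiv.sumSumSumComm _ _ _ _
  let W' : (Matrix ((Fin n ⊕ Fin (N - n)) ⊕ (Fin n ⊕ Fin (N - n)))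
      ((Fin n ⊕ Fin (N - n)) ⊕ (Fin n ⊕ Fin (N - n))) R)ˣ :=
    ⟨Matrix.reindex Θ Θ (fromBlocks W.1 0 0 1), Matrix.reindex Θ Θ (fromBlocks W⁻¹.1 0 0 1), by
      rw [← reindex_mul, fromBlocks_multiply]
      simp only [Units.mul_inv, Matrix.mul_zero, Matrix.zero_mul, add_zero, zero_add, mul_one,
        fromBlocks_one, hr1], by
      rw [← reindex_mul, fromBlocks_multiply]
      simp only [Units.inv_mul, Matrix.mul_zero, Matrix.zero_mul, add_zero, zero_add, mul_one,
        fromBlocks_one, hr1]⟩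
  have hW' : W'.1 * upperBlock (Fin n ⊕ Fin (N - n)) R * W'⁻¹.1 =
      Matrix.reindex Θ Θ (fromBlocks (W.1 * upperBlock (Fin n) R * W⁻¹.1) 0 0
        (upperBlock (Fin (N - n)) R)) := by
    rw [← reindex_upperBlock]
    change Matrix.reindex Θ Θ _ * Matrix.reindex Θ Θ _ * Matrix.reindex Θ Θ _ = _
    rw [← reindex_mul, ← reindex_mul, fromBlocks_multiply, fromBlocks_multiply]
    simp only [Matrix.mul_zero, Matrix.zero_mul, add_zero, zero_add, mul_one, one_mul]
  have hub : upperBlock (Fin (N - n)) (Unitization ℂ J) * upperBlock (Fin (N - n)) _ =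
      upperBlock (Fin (N - n)) _ := idem_fromBlocks (mul_one _) idem_zero
  have hlW : IsLift (Matrix.reindex Θ Θ (fromBlocks e 0 0 (upperBlock (Fin (N - n)) _)))
      (upperBlock (Fin n ⊕ Fin (N - n)) ℂ)
      (W'.1 * upperBlock (Fin n ⊕ Fin (N - n)) R * W'⁻¹.1) := by
    rw [hW', ← reindex_upperBlock]
    exact (he.fromBlocks (isLift_one.fromBlocks isLift_zero)).reindex Θ Θ
  have hUT : T.map (Ideal.Quotient.mk I) =
      fromBlocks (U : Matrix (Fin n) (Fin n) (R ⧸ I)) 0 0 1 := by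
    have hDt : (D t).map (Ideal.Quotient.mk I) = Matrix.reindex τ.symm τ.symm
        (stabMat h1 (Matrix.of fun _ _ : Fin 1 => Ideal.Quotient.mk I t)) := by
      change Matrix.reindex σ σ ((fromBlocks (Matrix.of fun _ _ : Fin 1 => t) 0 0 1).map
        (Ideal.Quotient.mk I)) = _
      rw [fromBlocks_map, Matrix.map_zero _ (map_zero _), Matrix.map_zero _ (map_zero _),
        Matrix.map_one _ (map_zero _) (map_one _)]
      rfl
    have hU : fromBlocks (U : Matrix (Fin n) (Fin n) (R ⧸ I)) 0 0 1 =
        Matrix.reindex τ.symm τ.symm (stab hn U : Matrix (Fin N) (Fin N) (R ⧸ I)) :=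
      ((Matrix.reindex τ τ).symm_apply_apply _).symm
    rw [hU, hG, reindex_mul, ← hDt]
    exact mm _ _
  have hUS : S.map (Ideal.Quotient.mk I) =
      fromBlocks (↑U⁻¹ : Matrix (Fin n) (Fin n) (R ⧸ I)) 0 0 1 := by
    have e1 : S.map (Ideal.Quotient.mk I) * T.map (Ideal.Quotient.mk I) = 1 := by
      rw [← mm, ← Matrix.map_one (Ideal.Quotient.mk I) (map_zero _) (map_one _), map_mk_eq_iff]
      intro i j
      have := hl'.sub_mem i j
      rw [Matrix.zero_apply, map_zero, sub_zero, hJ] at this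
      rw [← neg_sub]
      exact I.neg_mem this
    have e2 : T.map (Ideal.Quotient.mk I) *
        fromBlocks (↑U⁻¹ : Matrix (Fin n) (Fin n) (R ⧸ I)) 0 0 1 = 1 := by
      rw [hUT, fromBlocks_multiply]
      simp only [Units.mul_inv, Matrix.mul_zero, Matrix.zero_mul, add_zero, zero_add, mul_one,
        fromBlocks_one]
    exact left_inv_eq_right_inv e1 e2
  have hWc : W'.1.map (Ideal.Quotient.mk I) =
      fromBlocks (T.map (Ideal.Quotient.mk I)) 0 0 (S.map (Ideal.Quotient.mk I)) := by
    rw [hUT, hUS]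
    change Matrix.reindex Θ Θ ((fromBlocks W.1 0 0 1).map (Ideal.Quotient.mk I)) = _
    rw [fromBlocks_map, hW, Matrix.map_zero _ (map_zero _), Matrix.map_zero _ (map_zero _),
      Matrix.map_one _ (map_zero _) (map_one _)]
    ext i j
    rcases i with (i | i) | (i | i) <;> rcases j with (j | j) | (j | j) <;>
      simp [Θ, Matrix.one_apply]
  have key := index_class_of_generalised_inverse (p := upperBlock (Fin n ⊕ Fin (N - n)) _) hJ h h'
    hF hl' hWc hlW (idem_reindex (idem_fromBlocks he2 hub) Θ) rfl
    (idem_fromBlocks (mul_one _) idem_zero) hF2 (hE₀2 f' hf2')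
  rw [hE₀c f' hf2', hFc] at key
  rw [← key, k0cls_reindex (idem_fromBlocks he2 hub) Θ, k0cls_fromBlocks he2 hub]
  have hpc : k0cls (upperBlock (Fin n ⊕ Fin (N - n)) (Unitization ℂ J))
      (idem_fromBlocks (mul_one _) idem_zero) = k0cls p hp2 + k0cls _ hub := by
    subst hp
    rw [← k0cls_fromBlocks hp2 hub, ← k0cls_reindex (idem_fromBlocks hp2 hub) Θ]
    congr 1
    exact (reindex_upperBlock _ _).symm
  rw [hpc]
  abel

end IndexClass

end OpKTheory

end

section

open Filter Topology

namespace OpKTheory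

open Matrix

/-! ### Lifting homotopies of invertible matrices -/

section Homotopy

/-- Matrices over a complete normed ring that are close to the identity are invertible, by the
Neumann series. It is estimated entry by entry, as the matrices carry no norm here. -/
theorem isUnit_mem_nhds_one {A : Type*} [NormedRing A] [CompleteSpace A] (N : ℕ) :
    {M : Matrix (Fin N) (Fin N) A | IsUnit M} ∈ 𝓝 (1 : Matrix (Fin N) (Fin N) A) := by
  have hc : ∀ i j : Fin N, Continuous fun M : Matrix (Fin N) (Fin N) A => (1 - M) i j :=
    fun i j => (continuous_const.sub continuous_id).matrix_elem i j
  have hev : ∀ᶠ M : Matrix (Fin N) (Fin N) A in 𝓝 1,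
      ∀ i j, ‖(1 - M) i j‖ < (2 * (N + 1 : ℝ))⁻¹ := by
    refine eventually_all.2 fun i => eventually_all.2 fun j => ?_
    have h0 : Tendsto (fun M : Matrix (Fin N) (Fin N) A => ‖(1 - M) i j‖) (𝓝 1) (𝓝 0) := by
      have := ((hc i j).tendsto 1).norm
      simpa using this
    exact h0.eventually (gt_mem_nhds (by positivity))
  filter_upwards [hev] with M hM
  set x := 1 - M with hx
  have hb : ∀ (k : ℕ) (i j), ‖(x ^ k) i j‖ ≤ ‖(1 : A)‖ * (1 / 2) ^ k := by
    intro k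
    induction k with
    | zero =>
      intro i j
      rw [pow_zero, pow_zero, mul_one, Matrix.one_apply]
      split_ifs
      · exact le_rfl
      · rw [norm_zero]
        exact norm_nonneg _
    | succ k ih =>
      intro i j
      rw [pow_succ, Matrix.mul_apply]
      refine (norm_sum_le _ _).trans ?_
      have h1 : ∀ l ∈ Finset.univ, ‖(x ^ k) i l * x l j‖ ≤
          ‖(1 : A)‖ * (1 / 2) ^ k * (2 * (N + 1 : ℝ))⁻¹ := fun l _ =>
        (norm_mul_le _ _).trans (mul_le_mul (ih i l) (hM l j).le (norm_nonneg _) (by positivity))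
      refine (Finset.sum_le_sum h1).trans ?_
      rw [Finset.sum_const, Finset.card_univ, Fintype.card_fin, nsmul_eq_mul, pow_succ]
      have h2 : (N : ℝ) * (2 * (N + 1 : ℝ))⁻¹ ≤ 1 / 2 := by
        rw [← div_eq_mul_inv, div_le_iff₀ (by positivity)]
        linarith
      calc _ = ‖(1 : A)‖ * (1 / 2) ^ k * ((N : ℝ) * (2 * (N + 1 : ℝ))⁻¹) := by ring
        _ ≤ ‖(1 : A)‖ * (1 / 2) ^ k * (1 / 2) := by gcongr
        _ = _ := by ring
  have hs : Summable fun k : ℕ => x ^ k := by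
    refine Pi.summable.2 fun i => Pi.summable.2 fun j => ?_
    exact Summable.of_norm_bounded
      ((summable_geometric_of_lt_one (by norm_num) (by norm_num)).mul_left _) fun k => hb k i j
  have h1 := hs.one_sub_mul_tsum_pow
  have h2 := hs.tsum_pow_mul_one_sub
  rw [hx, sub_sub_cancel] at h1 h2
  exact ⟨⟨M, _, h1, h2⟩, rfl⟩

theorem stab_stab {Q : Type*} [Ring Q] {n m k : ℕ} (h : n ≤ m) (h' : m ≤ k)
    (u : (Matrix (Fin n) (Fin n) Q)ˣ) :
    stab h' (stab h u) = stab (h.trans h') u := by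
  ext a b
  simp only [stab, Units.coe_map, stabMat_apply]
  split_ifs <;> simp_all <;> omega

variable {A Q : Type*} [Ring A] [TopologicalSpace A] [Ring Q] [TopologicalSpace Q]
  [IsTopologicalRing Q]

/-- The invertible matrices that lift to invertible matrices form an open subgroup. -/
theorem isOpen_range_glMap
    (hA : ∀ N : ℕ, {M : Matrix (Fin N) (Fin N) A | IsUnit M} ∈ 𝓝 1)
    {π : A →+* Q} (hπ : IsOpenMap π) (N : ℕ) :
    IsOpen ((glMap π N).range : Set (Matrix (Fin N) (Fin N) Q)ˣ) := by
  refine Subgroup.isOpen_of_mem_nhds (g := 1) _ ?_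
  have hop : IsOpenMap fun M : Matrix (Fin N) (Fin N) A => M.map π :=
    IsOpenMap.piMap (fun _ => IsOpenMap.piMap (fun _ => hπ) (by simp)) (by simp)
  have h1 := hop.image_mem_nhds (hA N)
  rw [Matrix.map_one _ (map_zero π) (map_one π)] at h1
  have h2 := (Units.continuous_val (M := Matrix (Fin N) (Fin N) Q)).tendsto 1
  filter_upwards [h2 h1] with g hg
  obtain ⟨M, ⟨u, rfl⟩, hM⟩ := hg
  exact ⟨u, Units.ext hM⟩

/-- An open subgroup is closed as well, hence contains the path component of the identity;
therefore invertible matrices joined by a path differ by a liftable one. The hypothesis `hA` says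
that the invertible matrices over `A` are a neighbourhood of the identity. -/
theorem exists_glMap_mul_of_joined
    (hA : ∀ N : ℕ, {M : Matrix (Fin N) (Fin N) A | IsUnit M} ∈ 𝓝 1)
    {π : A →+* Q} (hπ : IsOpenMap π) {N : ℕ}
    {u v : (Matrix (Fin N) (Fin N) Q)ˣ} (h : Joined u v) :
    ∃ G : (Matrix (Fin N) (Fin N) A)ˣ, u = glMap π N G * v := by
  have h1 : Joined (1 : (Matrix (Fin N) (Fin N) Q)ˣ) (u * v⁻¹) := by
    have := h.symm.map (f := fun x => x * v⁻¹) (continuous_mul_const _)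
    rwa [mul_inv_cancel] at this
  have hcl : IsClopen ((glMap π N).range : Set (Matrix (Fin N) (Fin N) Q)ˣ) :=
    ⟨Subgroup.isClosed_of_isOpen _ (isOpen_range_glMap hA hπ N), isOpen_range_glMap hA hπ N⟩
  have h2 : u * v⁻¹ ∈ ((glMap π N).range : Set (Matrix (Fin N) (Fin N) Q)ˣ) :=
    hcl.connectedComponent_subset (one_mem _) (pathComponent_subset_component _ h1)
  obtain ⟨G, hG⟩ := h2
  exact ⟨G, by rw [hG, inv_mul_cancel_right]⟩

/-- Representatives of the same class in `K₁` differ, after stabilisation, by an invertible matrix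
that lifts along a given open homomorphism. -/
theorem exists_lift_of_k1cls_eq
    (hA : ∀ N : ℕ, {M : Matrix (Fin N) (Fin N) A | IsUnit M} ∈ 𝓝 1)
    {π : A →+* Q} (hπ : IsOpenMap π) {n m : ℕ}
    {u : (Matrix (Fin n) (Fin n) Q)ˣ} {v : (Matrix (Fin m) (Fin m) Q)ˣ}
    (h : k1cls u = k1cls v) : ∃ (N : ℕ) (hn : n ≤ N) (hm : m ≤ N) (G : (Matrix (Fin N) (Fin N) A)ˣ),
      stab hn u = glMap π N G * stab hm v := by
  obtain ⟨l, a, b, ha, hb, hab⟩ := (Con.eq _).1 h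
  obtain ⟨k, hnk, hlk, h1⟩ := toGLInf_eq ha
  obtain ⟨k', hmk, hlk', h2⟩ := toGLInf_eq hb
  have h1' := congrArg (stab (le_max_left k k')) h1
  have h2' := congrArg (stab (le_max_right k k')) h2
  rw [stab_stab, stab_stab] at h1' h2'
  obtain ⟨G, hG⟩ := exists_glMap_mul_of_joined hA hπ
    (hab.map (continuous_stab (hlk.trans (le_max_left k k'))))
  exact ⟨max k k', _, _, G, by rw [h1', h2', hG]⟩

end Homotopy

section Diagonal

variable {B : Type*} [Ring B]

theorem idem_diagonal {a : B} (ha : a * a = a) (r : ℕ) :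
    diagonal (fun _ : Fin r => a) * diagonal (fun _ : Fin r => a) =
      diagonal (fun _ : Fin r => a) := by
  rw [diagonal_mul_diagonal, ha]

/-- The class of `diag(a, …, a)` is `r` times the class of `a`. -/
theorem k0cls_diagonal {a : B} (ha : a * a = a)
    (ha' : (Matrix.of fun _ _ : Fin 1 => a) * (Matrix.of fun _ _ : Fin 1 => a) =
      Matrix.of fun _ _ : Fin 1 => a) (r : ℕ) :
    k0cls (diagonal (fun _ : Fin r => a)) (idem_diagonal ha r) =
      r • k0cls (Matrix.of fun _ _ : Fin 1 => a) ha' := by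
  induction r with
  | zero =>
    rw [zero_smul, ← k0cls_zero (ι := Fin 0)]
    congr 1
    exact Subsingleton.elim _ _
  | succ r ih =>
    rw [add_smul, one_smul, ← ih, ← k0cls_fromBlocks (idem_diagonal ha r) ha',
      ← k0cls_reindex _ finSumFinEquiv]
    congr 1
    ext i j
    obtain ⟨i, rfl⟩ := finSumFinEquiv.surjective i
    obtain ⟨j, rfl⟩ := finSumFinEquiv.surjective j
    have hne : ∀ (i : Fin r) (j : Fin 1), Fin.castAdd 1 i ≠ Fin.natAdd r j := fun i j h => by
      have := congrArg Fin.val h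
      simp only [Fin.val_castAdd, Fin.val_natAdd] at this
      omega
    rcases i with i | i <;> rcases j with j | j
    · simp [diagonal_apply]
    · simp [hne]
    · simp [(hne _ _).symm]
    · obtain rfl := Subsingleton.elim i j
      simp

/-- If `F = ∑ xᵢ yᵢ` with `yᵢ xⱼ = δᵢⱼ E`, then `F` is equivalent to a direct sum of copies of
`E`. -/
theorem k0cls_sum_mul {R : Type*} [Ring R] [Algebra ℂ R] {J : NonUnitalSubalgebra ℂ R} {F E : J}
    (hF : F * F = F) (hE : E * E = E) {r : ℕ} {x y : Fin r → R} (hx : ∀ i, x i ∈ J)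
    (hy : ∀ i, y i ∈ J) (hxy : ∑ i, x i * y i = F)
    (hyx : ∀ i j, y i * x j = if i = j then (E : R) else 0) :
    k0cls (Matrix.of fun _ _ : Fin 1 => (F : Unitization ℂ J)) (idem_single hF) =
      r • k0cls (Matrix.of fun _ _ : Fin 1 => (E : Unitization ℂ J)) (idem_single hE) := by
  have hEu : (E : Unitization ℂ J) * E = E := by rw [← Unitization.inr_mul, hE]
  rw [← k0cls_diagonal hEu]
  have hdiag : IsLift (diagonal fun _ : Fin r => (E : Unitization ℂ J)) 0
      (diagonal fun _ : Fin r => (E : R)) := by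
    constructor
    · ext i j
      rw [Matrix.map_apply, diagonal_apply]
      split_ifs
      · exact congrFun (congrFun (isLift_single E).1 0) 0
      · exact map_zero _
    · rw [diagonal_map (map_zero _)]
      congr 1
      ext1 i
      exact congrFun (congrFun (isLift_single E).2 0) 0
  refine k0cls_eq _ _ ((isLift_single F).mvN hdiag (a := 0) (b := 0)
    (x := Matrix.of fun _ i => x i) (y := Matrix.of fun i _ => y i)
    (Matrix.mul_zero _) (Matrix.mul_zero _) ?_ ?_ ?_ ?_)
  · ext1 i j
    rw [Matrix.mul_apply]
    exact hxy
  · ext1 i j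
    simp [Matrix.mul_apply, hyx, diagonal_apply]
  · intro i j
    simpa using hx j
  · intro i j
    simpa using hy i

end Diagonal

end OpKTheory

namespace CylinderAlgebra

open OpKTheory Matrix

/-! ### Classes of finite-rank idempotents -/

variable {H : Type*} [NormedAddCommGroup H] [NormedSpace ℂ H]

/-- A basis of the range of an idempotent of finite rank, with its dual family of functionals. -/
theorem exists_coordinates {T : H →L[ℂ] H} {r : ℕ}
    (hfin : FiniteDimensional ℂ (T : H →ₗ[ℂ] H).range)
    (hr : Module.finrank ℂ (T : H →ₗ[ℂ] H).range = r) (hT : T * T = T) :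
    ∃ (b : Fin r → H) (φ : Fin r → H →L[ℂ] ℂ),
      (∀ v, T v = ∑ i, φ i v • b i) ∧ ∀ i j, φ i (b j) = if i = j then 1 else 0 := by
  let B := Module.finBasisOfFinrankEq ℂ (T : H →ₗ[ℂ] H).range hr
  let T' : H →L[ℂ] (T : H →ₗ[ℂ] H).range := T.codRestrict _ fun x => ⟨x, rfl⟩
  refine ⟨fun i => B i, fun i => (B.coord i).toContinuousLinearMap ∘L T', fun v => ?_,
    fun i j => ?_⟩
  · have := congrArg Subtype.val (B.sum_repr (T' v))
    rw [Submodule.coe_sum] at this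
    exact this.symm
  · have h1 : T' (B j) = B j := by
      obtain ⟨w, hw⟩ := (B j).2
      refine Subtype.ext ?_
      change T (B j : H) = (B j : H)
      rw [← hw]
      exact DFunLike.congr_fun hT w
    change B.coord i (T' (B j)) = _
    rw [h1, Module.Basis.coord_apply, Module.Basis.repr_self, Finsupp.single_apply]
    simp only [eq_comm]

theorem isCompactOperator_smulRight (φ : H →L[ℂ] ℂ) (b : H) :
    IsCompactOperator (φ.smulRight b) := by
  have h : IsCompactOperator (ContinuousLinearMap.toSpanSingleton ℂ b) :=
    isCompactOperator_of_locallyCompactSpace_rng _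
  exact h.comp_clm φ

set_option synthInstance.maxHeartbeats 200000 in
/-- An idempotent of finite rank `r` has the class `r [E]₀`, where `E` has rank one. -/
theorem k0cls_finiteRank {J : NonUnitalSubalgebra ℂ (H →L[ℂ] H)}
    (hJ : ∀ (φ : H →L[ℂ] ℂ) (b : H), φ.smulRight b ∈ J) {F E : J} (hF : F * F = F) (hE : E * E = E)
    (hfin : FiniteDimensional ℂ ((F : H →L[ℂ] H) : H →ₗ[ℂ] H).range)
    (hE1 : Module.finrank ℂ ((E : H →L[ℂ] H) : H →ₗ[ℂ] H).range = 1) :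
    k0cls (Matrix.of fun _ _ : Fin 1 => (F : Unitization ℂ J)) (idem_single hF) =
      Module.finrank ℂ ((F : H →L[ℂ] H) : H →ₗ[ℂ] H).range •
        k0cls (Matrix.of fun _ _ : Fin 1 => (E : Unitization ℂ J)) (idem_single hE) := by
  obtain ⟨b, φ, hb, hφ⟩ := exists_coordinates hfin rfl (congrArg Subtype.val hF)
  obtain ⟨b', φ', hb', hφ'⟩ := exists_coordinates (Module.finite_of_finrank_pos (by omega)) hE1
    (congrArg Subtype.val hE)
  simp only [Finset.univ_unique, Finset.sum_singleton] at hb'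
  refine k0cls_sum_mul hF hE (x := fun i => (φ' 0).smulRight (b i))
    (y := fun i => (φ i).smulRight (b' 0)) (fun i => hJ _ _) (fun i => hJ _ _) ?_ ?_
  · refine ContinuousLinearMap.ext fun v => ?_
    rw [_root_.sum_apply]
    change ∑ l, φ' 0 (φ l v • b' 0) • b l = (F : H →L[ℂ] H) v
    rw [hb]
    simp [hφ']
  · intro i j
    refine ContinuousLinearMap.ext fun v => ?_
    change φ i (φ' 0 v • b j) • b' 0 = _
    rw [map_smul, hφ]
    split_ifs
    · simp [hb']
    · simp

end CylinderAlgebra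

end

section

open Topology

namespace OpKTheory

open Matrix

/-! ### The index map in terms of a generalised inverse -/

section Connecting

/-- The quotient homomorphism from `A` to `(A/K)/(E/K)` is open. -/
theorem isOpenMap_mk_mk {A : Type*} [Ring A] [TopologicalSpace A] [IsTopologicalRing A]
    (K E : Ideal A) [K.IsTwoSided] [E.IsTwoSided] :
    IsOpenMap ((Ideal.Quotient.mk (quotIdeal K E)).comp (Ideal.Quotient.mk K)) := by
  have h1 : IsOpenQuotientMap (Ideal.Quotient.mk K) := QuotientAddGroup.isOpenQuotientMap_mk
  have h2 : IsOpenQuotientMap (Ideal.Quotient.mk (quotIdeal K E)) :=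
    QuotientAddGroup.isOpenQuotientMap_mk
  exact h2.isOpenMap.comp h1.isOpenMap

theorem unitMap_fst_snd {J J' : Type*} [NonUnitalRing J] [Module ℂ J] [IsScalarTower ℂ J J]
    [SMulCommClass ℂ J J] [NonUnitalRing J'] [Module ℂ J'] [IsScalarTower ℂ J' J']
    [SMulCommClass ℂ J' J'] (f : J →ₙₐ[ℂ] J') (z : Unitization ℂ J) :
    (unitMap f z).fst = z.fst ∧ (unitMap f z).snd = f z.snd := by
  have h : unitMap f z = algebraMap ℂ _ z.fst + ((f z.snd : J') : Unitization ℂ J') := rfl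
  rw [h]
  simp [Unitization.algebraMap_eq_inl]

variable {A : Type*} [Ring A] [Algebra ℂ A] [TopologicalSpace A] [IsTopologicalRing A]
  {K E : Ideal A}
  [K.IsTwoSided] [E.IsTwoSided]
  {R : Type*} [Ring R] [Algebra ℂ R] {I : Ideal R} [I.IsTwoSided] {J : NonUnitalSubalgebra ℂ R}

/-- Let `σ` be a homomorphism of algebras that kills `K` and maps `E` to the ideal `I`. The image
under `σ` of the index of a unit `[a] ∈ A/E` is the difference of the classes of `1 - st` and
`1 - ts`, where `s` is a generalised inverse of `t = σ(a)`. -/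
theorem map_connecting_k1unit
    (hA : ∀ N : ℕ, {M : Matrix (Fin N) (Fin N) A | IsUnit M} ∈ 𝓝 1)
    {σ : A →ₐ[ℂ] R} (hK : ∀ a ∈ K, σ a = 0)
    (hJ : ∀ r, r ∈ J ↔ r ∈ I) {φ : idealAlg (quotIdeal K E) →ₙₐ[ℂ] J}
    (hφ : ∀ (a : A) (ha : a ∈ E), (φ (toQuotIdeal K E a ha) : R) = σ a)
    {a : A} {u : (A ⧸ E)ˣ} (hu : (u : A ⧸ E) = Ideal.Quotient.mk E a)
    {s : R} (hts : σ a * s * σ a = σ a) (hst : s * σ a * s = s) {f f' : J}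
    (hf : (f : R) = 1 - σ a * s) (hf' : (f' : R) = 1 - s * σ a) (hf2 : f * f = f)
    (hf2' : f' * f' = f') :
    (KZero.map φ (connecting K E (k1unit u)) : K0 (Unitization ℂ J)) =
      k0cls (Matrix.of fun _ _ : Fin 1 => (f' : Unitization ℂ J)) (idem_single hf2') -
        k0cls (Matrix.of fun _ _ : Fin 1 => (f : Unitization ℂ J)) (idem_single hf2) := by
  obtain ⟨n, U, w, e, p, he, hp, hx, hw, hp1, he1, he2, hy⟩ :=
    Classical.choose_spec (exists_isIndexClass
      (K1.map (canQuot K E) (continuous_canQuot K E) (k1unit u)))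
  have hval : (KZero.map φ (connecting K E (k1unit u)) : K0 (Unitization ℂ J)) =
      k0cls (e.map (unitMap φ).toRingHom) (idem_map (unitMap φ).toRingHom he) -
        k0cls (p.map (unitMap φ).toRingHom) (idem_map (unitMap φ).toRingHom hp) := by
    rw [← K0.map_k0cls _ e he, ← K0.map_k0cls _ p hp, ← map_sub, ← hy]
    rfl
  rw [hval]
  -- the homomorphisms induced by `σ` on the quotients
  let σ' : A ⧸ K →+* R := Ideal.Quotient.lift K σ.toRingHom hK
  have hσ' : ∀ x : idealAlg (quotIdeal K E), (φ x : R) = σ' x := by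
    rintro ⟨x, hx⟩
    obtain ⟨b, hb, rfl⟩ := (Ideal.mem_map_iff_of_surjective _ Ideal.Quotient.mk_surjective).1 hx
    exact hφ b hb
  let ρ : (A ⧸ K) ⧸ quotIdeal K E →+* R ⧸ I :=
    Ideal.Quotient.lift _ ((Ideal.Quotient.mk I).comp σ') fun x hx => by
      rw [RingHom.comp_apply, Ideal.Quotient.eq_zero_iff_mem, ← hJ, ← hσ' ⟨x, hx⟩]
      exact (φ _).2
  have hk : k1cls U =
      k1cls (glMap (canQuot K E) 1 (Units.map (Matrix.scalar (Fin 1)).toMonoidHom u)) := by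
    rw [← hx]
    rfl
  obtain ⟨N, hn, h1, G, hG⟩ := exists_lift_of_k1cls_eq hA (isOpenMap_mk_mk K E) hk
  have hblock : ∀ {B C : Type _} [Ring B] [Ring C] (g : B →+* C),
      (upperBlock (Fin n) B).map g = upperBlock (Fin n) C := fun g => by
    rw [fromBlocks_map, Matrix.map_one _ (map_zero _) (map_one _), Matrix.map_zero _ (map_zero _)]
  refine index_class_eq hJ hn h1 (U := glMap ρ n U) (W := Units.map σ'.mapMatrix.toMonoidHom w)
    ?_ ⟨?_, ?_⟩ _ ?_ _ hts hst hf hf' hf2 hf2' (glMap σ.toRingHom N G) ?_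
  · have h2 := congrArg (fun M => M.map ρ) hw
    simp only [fromBlocks_map, Matrix.map_zero _ (map_zero ρ)] at h2
    exact h2
  · refine Eq.trans ?_ he1
    ext1 i j
    exact (unitMap_fst_snd φ (e i j)).1
  · have h2 := congrArg (fun M => σ'.mapMatrix M) he2
    simp only [map_mul] at h2
    have h3 : σ'.mapMatrix (upperBlock (Fin n) (A ⧸ K)) = upperBlock (Fin n) R := hblock σ'
    rw [h3] at h2
    refine Eq.trans ?_ h2
    ext1 i j
    change algebraMap ℂ R (unitMap φ (e i j)).fst + ((unitMap φ (e i j)).snd : R) =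
      σ' (algebraMap ℂ (A ⧸ K) (e i j).fst + ((e i j).snd : A ⧸ K))
    rw [(unitMap_fst_snd φ (e i j)).1, (unitMap_fst_snd φ (e i j)).2, map_add, hσ']
    congr 1
    exact (σ.commutes _).symm
  · rw [hp1]
    exact hblock _
  · have h2 := congrArg (glMap ρ N) hG
    rw [glMap_stab, map_mul, glMap_stab] at h2
    refine (congrArg Units.val h2).trans ?_
    rw [Units.val_mul]
    congr 1
    change stabMat h1 _ = _
    congr 1
    ext i j
    obtain rfl := Subsingleton.elim i j
    have h3 : Matrix.scalar (Fin 1) (u : A ⧸ E) i i = (u : A ⧸ E) := by simp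
    change ρ (canQuot K E (Matrix.scalar (Fin 1) (u : A ⧸ E) i i)) = _
    rw [h3, hu]
    rfl

end Connecting

end OpKTheory

end

section

open Topology

namespace OpKTheory

/-! ### The homomorphism on the quotient -/

/-- Functoriality of `K₀` for algebras without unit. -/
theorem KZero.map_map {J J' J'' : Type*} [NonUnitalRing J] [Module ℂ J] [IsScalarTower ℂ J J]
    [SMulCommClass ℂ J J] [NonUnitalRing J'] [Module ℂ J'] [IsScalarTower ℂ J' J']
    [SMulCommClass ℂ J' J'] [NonUnitalRing J''] [Module ℂ J''] [IsScalarTower ℂ J'' J'']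
    [SMulCommClass ℂ J'' J''] (g : J' →ₙₐ[ℂ] J'') (f : J →ₙₐ[ℂ] J') (y : KZero J) :
    KZero.map g (KZero.map f y) = KZero.map (g.comp f) y := by
  refine Subtype.ext ?_
  have h : (unitMap g).toRingHom.comp (unitMap f).toRingHom = (unitMap (g.comp f)).toRingHom := by
    refine RingHom.ext fun z => ?_
    change unitMap g (unitMap f z) = unitMap (g.comp f) z
    refine Unitization.ext ?_ ?_
    · rw [(unitMap_fst_snd _ _).1, (unitMap_fst_snd _ _).1, (unitMap_fst_snd _ _).1]
    · rw [(unitMap_fst_snd _ _).2, (unitMap_fst_snd _ _).2, (unitMap_fst_snd _ _).2]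
      rfl
  change K0.map (unitMap g).toRingHom (K0.map (unitMap f).toRingHom (y : K0 (Unitization ℂ J))) =
    K0.map (unitMap (g.comp f)).toRingHom (y : K0 (Unitization ℂ J))
  rw [← h, ← K0.map_comp]
  rfl

/-- A continuous family of homomorphisms that vanish on `K` and map `E` to `S` induces a
homomorphism from `E/K` to the algebra of continuous functions with values in `S`. -/
theorem exists_funAlg_hom {A : Type*} [Ring A] [Algebra ℂ A] {K E : Ideal A} [K.IsTwoSided]
    [E.IsTwoSided] {X : Type*} [TopologicalSpace X] {B : Type*} [NormedRing B] [NormedAlgebra ℂ B]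
    {S : NonUnitalSubalgebra ℂ B} {σ : X → A →ₐ[ℂ] B} (hK : ∀ x, ∀ a ∈ K, σ x a = 0)
    (hE : ∀ x, ∀ a ∈ E, σ x a ∈ S) (hc : ∀ a, Continuous fun x => σ x a) :
    ∃ Ψ : idealAlg (quotIdeal K E) →ₙₐ[ℂ] CylinderAlgebra.FunAlg X S,
      ∀ (a : A) (ha : a ∈ E) (x : X), (Ψ (toQuotIdeal K E a ha) x : B) = σ x a := by
  let σ' : X → A ⧸ K →+* B := fun x => Ideal.Quotient.lift K (σ x).toRingHom (hK x)
  have hex : ∀ q : idealAlg (quotIdeal K E), ∃ a ∈ E, Ideal.Quotient.mk K a = q := fun q =>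
    (Ideal.mem_map_iff_of_surjective _ Ideal.Quotient.mk_surjective).1 q.2
  have hsmul : ∀ (x) (c : ℂ) (q : A ⧸ K), σ' x (c • q) = c • σ' x q := fun x c q => by
    obtain ⟨a, rfl⟩ := Ideal.Quotient.mk_surjective q
    exact map_smul (σ x) c a
  have hS : ∀ (q : idealAlg (quotIdeal K E)) (x : X), σ' x q ∈ S := fun q x => by
    obtain ⟨a, ha, h⟩ := hex q
    rw [← h]
    exact hE x a ha
  have hcont : ∀ q : idealAlg (quotIdeal K E), Continuous fun x => (⟨σ' x q, hS q x⟩ : S) :=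
    fun q => by
      refine Continuous.subtype_mk ?_ _
      obtain ⟨a, ha, h⟩ := hex q
      rw [← h]
      exact hc a
  exact ⟨{
    toFun := fun q => ⟨fun x => ⟨σ' x q, hS q x⟩, hcont q⟩
    map_smul' := fun c q => ContinuousMap.ext fun x => Subtype.ext (hsmul x c q)
    map_zero' := ContinuousMap.ext fun x => Subtype.ext (map_zero (σ' x))
    map_add' := fun q r => ContinuousMap.ext fun x => Subtype.ext (map_add (σ' x) q.1 r.1)
    map_mul' := fun q r => ContinuousMap.ext fun x => Subtype.ext (map_mul (σ' x) q.1 r.1) },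
    fun a ha x => rfl⟩

end OpKTheory

namespace CylinderAlgebra

open LimitOperator OpKTheory

/-- The two-sided ideal of compact operators on a normed space. -/
def compactOperators (H : Type*) [NormedAddCommGroup H] [NormedSpace ℂ H] : Ideal (H →L[ℂ] H) where
  carrier := {A | IsCompactOperator A}
  add_mem' := fun ha hb => IsCompactOperator.add ha hb
  zero_mem' := isCompactOperator_zero
  smul_mem' := fun c _ ha => IsCompactOperator.clm_comp ha c

instance (H : Type*) [NormedAddCommGroup H] [NormedSpace ℂ H] :
    (compactOperators H).IsTwoSided where
  mul_mem_of_left := fun b ha => IsCompactOperator.comp_clm ha b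

/-! ### The index map and the Fredholm index -/

set_option synthInstance.maxHeartbeats 200000 in
/-- Let `σ` be a representation of `A` on a normed space that kills `K` and maps `E` to compact
operators. The image under `σ` of the index of a unit `[a] ∈ A/E` is the Fredholm index of `σ(a)`
times the class of an idempotent of rank one. -/
theorem map_connecting_eq_fredIndex {A : Type*} [Ring A] [Algebra ℂ A]
    [TopologicalSpace A] [IsTopologicalRing A]
    (hA : ∀ N : ℕ, {M : Matrix (Fin N) (Fin N) A | IsUnit M} ∈ 𝓝 1)
    {K E : Ideal A} [K.IsTwoSided] [E.IsTwoSided]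
    {H : Type*} [NormedAddCommGroup H] [NormedSpace ℂ H]
    {J : NonUnitalSubalgebra ℂ (H →L[ℂ] H)} (hJ : ∀ r, r ∈ J ↔ IsCompactOperator r)
    {σ : A →ₐ[ℂ] (H →L[ℂ] H)} (hK : ∀ a ∈ K, σ a = 0)
    {φ : idealAlg (quotIdeal K E) →ₙₐ[ℂ] J}
    (hφ : ∀ (a : A) (ha : a ∈ E), (φ (toQuotIdeal K E a ha) : H →L[ℂ] H) = σ a)
    {a : A} {u : (A ⧸ E)ˣ} (hu : (u : A ⧸ E) = Ideal.Quotient.mk E a) (ha : (σ a).IsFredholm)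
    {P : J} (hP : P * P = P)
    (hP1 : Module.finrank ℂ ((P : H →L[ℂ] H) : H →ₗ[ℂ] H).range = 1) :
    KZero.map φ (connecting K E (k1unit u)) = fredIndex (σ a) • KZero.cls P hP := by
  obtain ⟨S, hts, hst, hfin', hfin, hker, hcoker⟩ := exists_generalised_inverse ha
  have hsmul : ∀ (ψ : H →L[ℂ] ℂ) (b : H), ψ.smulRight b ∈ J := fun ψ b =>
    (hJ _).2 (isCompactOperator_smulRight ψ b)
  let f : J := ⟨1 - σ a * S, (hJ _).2 (isCompactOperator_of_finiteDimensional_range _ hfin)⟩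
  let f' : J := ⟨1 - S * σ a, (hJ _).2 (isCompactOperator_of_finiteDimensional_range _ hfin')⟩
  have hidem : ∀ T T' : H →L[ℂ] H, T * T' * T = T →
      (1 - T * T') * (1 - T * T') = 1 - T * T' := fun T T' h =>
    IsIdempotentElem.one_sub (a := T * T') (by rw [IsIdempotentElem, ← mul_assoc, h])
  have hf2 : f * f = f := Subtype.ext (hidem _ _ hts)
  have hf2' : f' * f' = f' := Subtype.ext (hidem _ _ hst)
  refine Subtype.ext ?_
  have h1 := map_connecting_k1unit hA (I := compactOperators H) hK hJ hφ hu hts hst (f := f)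
    (f' := f') rfl rfl hf2 hf2'
  refine h1.trans ?_
  rw [k0cls_finiteRank hsmul hf2 hP hfin hP1, k0cls_finiteRank hsmul hf2' hP hfin' hP1,
    fredIndex, ← hker, ← hcoker, sub_smul, natCast_zsmul, natCast_zsmul]
  rfl

set_option synthInstance.maxHeartbeats 200000 in
/-- The index formula for a homomorphism to an algebra of functions with values in the compact
operators, followed by an evaluation. -/
theorem map_eval_connecting_eq_fredIndex {A : Type*} [Ring A] [Algebra ℂ A]
    [TopologicalSpace A] [IsTopologicalRing A]
    (hA : ∀ N : ℕ, {M : Matrix (Fin N) (Fin N) A | IsUnit M} ∈ 𝓝 1)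
    {K E : Ideal A} [K.IsTwoSided] [E.IsTwoSided]
    {H : Type*} [NormedAddCommGroup H] [NormedSpace ℂ H]
    {J : NonUnitalSubalgebra ℂ (H →L[ℂ] H)} (hJ : ∀ r, r ∈ J ↔ IsCompactOperator r)
    {X : Type*} [TopologicalSpace X] {x : X} {ev : FunAlg X J →ₙₐ[ℂ] J} (hev : ∀ f, ev f = f x)
    {σ : A →ₐ[ℂ] (H →L[ℂ] H)} (hK : ∀ a ∈ K, σ a = 0)
    {Ψ : idealAlg (quotIdeal K E) →ₙₐ[ℂ] FunAlg X J}
    (hΨ : ∀ (a : A) (ha : a ∈ E), (Ψ (toQuotIdeal K E a ha) x : H →L[ℂ] H) = σ a)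
    {a : A} {u : (A ⧸ E)ˣ} (hu : (u : A ⧸ E) = Ideal.Quotient.mk E a) (ha : (σ a).IsFredholm)
    {P : J} (hP : P * P = P)
    (hP1 : Module.finrank ℂ ((P : H →L[ℂ] H) : H →ₗ[ℂ] H).range = 1) :
    KZero.map (J := FunAlg X J) ev
        (KZero.map (J' := FunAlg X J) Ψ (connecting K E (k1unit u))) =
      fredIndex (σ a) • KZero.cls P hP := by
  refine (KZero.map_map (J' := FunAlg X J) ev Ψ _).trans ?_
  refine map_connecting_eq_fredIndex hA hJ hK (fun b hb => ?_) hu ha hP hP1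
  rw [← hΨ b hb, ← hev]
  rfl

theorem kEval_apply (y : KZero BdCompact) : kEval y =
    (KZero.map (J := BdCompact) (evalAt (1, -1)) y,
      KZero.map (J := BdCompact) (evalAt (1, 1)) y) :=
  AddMonoidHom.prod_apply _ _ y

section Symbol

variable {γ : cylAlg →⋆ₐ[ℂ] C(Bd, L2ZS1 →L[ℂ] L2ZS1)}

/-- The homomorphism `Ψ` from `ℰ/𝒦` induced by the boundary symbol. -/
theorem exists_quotientSymbol
    (hγ : ∀ A : cylAlg, ((A : L2Cyl →L[ℂ] L2Cyl), γ A) ∈ symbolGraph boundaryPacket) :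
    ∃ Ψ : commQuot →ₙₐ[ℂ] BdCompact,
    ∀ (A : cylAlg) (hA : A ∈ commIdeal) (x : Bd),
      (Ψ (toQuotIdeal compactIdeal commIdeal A hA) x : L2ZS1 →L[ℂ] L2ZS1) = γ A x := by
  exact exists_funAlg_hom (σ := fun x => (symbolAt γ x).toAlgHom)
    (fun x A hA => DFunLike.congr_fun (boundarySymbol_compact hγ hA) x)
    (fun x A hA => boundarySymbol_isCompactOperator hγ hA x) fun A => (γ A).continuous

/-- The boundary symbol of an element invertible modulo the commutator ideal is invertible modulo
compact operators, hence Fredholm. -/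
theorem isFredholm_boundarySymbol
    (hγ : ∀ A : cylAlg, ((A : L2Cyl →L[ℂ] L2Cyl), γ A) ∈ symbolGraph boundaryPacket)
    {A : cylAlg} {u : (cylAlg ⧸ commIdeal)ˣ}
    (hu : (u : cylAlg ⧸ commIdeal) = Ideal.Quotient.mk commIdeal A) (x : Bd) :
    (γ A x).IsFredholm := by
  obtain ⟨B, hB⟩ := Ideal.Quotient.mk_surjective (↑u⁻¹ : cylAlg ⧸ commIdeal)
  have key : ∀ {A B : cylAlg}, Ideal.Quotient.mk commIdeal A * Ideal.Quotient.mk commIdeal B = 1 →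
      IsCompactOperator (γ A x * γ B x - 1 : L2ZS1 →L[ℂ] L2ZS1) := fun {A B} h => by
    have h1 : A * B - 1 ∈ commIdeal := by
      rw [← Ideal.Quotient.eq, map_mul, h, map_one]
    have h2 := boundarySymbol_isCompactOperator hγ h1 x
    rw [← symbolAt_apply, map_sub, map_mul, map_one] at h2
    exact h2
  refine isFredholm_of_isCompactOperator (S := γ B x) (key ?_) (key ?_)
  · rw [hB, ← hu, Units.inv_mul]
  · rw [hB, ← hu, Units.mul_inv]

set_option synthInstance.maxHeartbeats 200000 in
/-- The component of the index map at a point of `S¹ × {-1, +1}`. -/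
theorem evalAt_deltaOne
    (hγ : ∀ A : cylAlg, ((A : L2Cyl →L[ℂ] L2Cyl), γ A) ∈ symbolGraph boundaryPacket)
    {Ψ : commQuot →ₙₐ[ℂ] BdCompact}
    (hΨ : ∀ (A : cylAlg) (hA : A ∈ commIdeal) (x : Bd),
      (Ψ (toQuotIdeal compactIdeal commIdeal A hA) x : L2ZS1 →L[ℂ] L2ZS1) = γ A x)
    {A : cylAlg} {u : (cylAlg ⧸ commIdeal)ˣ}
    (hu : (u : cylAlg ⧸ commIdeal) = Ideal.Quotient.mk commIdeal A)
    {E : compactZS1} (hE : E * E = E)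
    (hE1 : Module.finrank ℂ ((E : L2ZS1 →L[ℂ] L2ZS1) : L2ZS1 →ₗ[ℂ] L2ZS1).range = 1) (x : Bd) :
    KZero.map (J := BdCompact) (evalAt x) (kMap Ψ (deltaOne (k1unit u))) =
      fredIndex (γ A x) • KZero.cls E hE := by
  have : CompleteSpace cylAlg := isClosed_cylAlg.completeSpace_coe
  exact map_eval_connecting_eq_fredIndex (K := compactIdeal) (E := commIdeal) (J := compactZS1)
    (fun N => isUnit_mem_nhds_one N) (fun _ => Iff.rfl) (x := x) (fun _ => rfl)
    (σ := (symbolAt γ x).toAlgHom)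
    (fun B hB => DFunLike.congr_fun (boundarySymbol_compact hγ hB) x) (fun B hB => hΨ B hB x) hu
    (isFredholm_boundarySymbol hγ hu x) hE hE1

end Symbol

end CylinderAlgebra

end

theorem mainTheorem9 :
    ∃ γ : cylAlg →⋆ₐ[ℂ] C(Bd, L2ZS1 →L[ℂ] L2ZS1), IsBoundarySymbol γ ∧
    ∃ Ψ : commQuot →ₙₐ[ℂ] BdCompact,
      (∀ (A : cylAlg) (hA : A ∈ commIdeal) (x : Bd),
        (Ψ (toQuotIdeal compactIdeal commIdeal A hA) x : L2ZS1 →L[ℂ] L2ZS1) = γ A x) ∧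
      ∀ (A : cylAlg) (u : (cylAlg ⧸ commIdeal)ˣ),
        (u : cylAlg ⧸ commIdeal) = Ideal.Quotient.mk commIdeal A →
        (∀ (z : Circle) (s : ℤˣ), (γ A (z, s)).IsFredholm) ∧
        ∀ (E : compactZS1) (hE : E * E = E),
          IsSelfAdjoint (E : L2ZS1 →L[ℂ] L2ZS1) →
          Module.finrank ℂ ((E : L2ZS1 →L[ℂ] L2ZS1) : L2ZS1 →ₗ[ℂ] L2ZS1).range = 1 →
          kEval (kMap Ψ (deltaOne (k1unit u))) =
            (fredIndex (γ A (1, -1)) • KZero.cls E hE,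
              fredIndex (γ A (1, 1)) • KZero.cls E hE) := by
  refine Exists.elim exists_boundarySymbol fun γ hγ => ⟨γ, isBoundarySymbol_of_graph hγ, ?_⟩
  refine Exists.elim (exists_quotientSymbol hγ) fun Ψ hΨ => ⟨Ψ, hΨ, fun A u hu =>
    ⟨fun z s => isFredholm_boundarySymbol hγ hu (z, s), fun E hE _ hE1 => ?_⟩⟩
  exact (kEval_apply _).trans (congrArg₂ Prod.mk (evalAt_deltaOne hγ hΨ hu hE hE1 (1, -1))
    (evalAt_deltaOne hγ hΨ hu hE hE1 (1, 1)))
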